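/- **Conventions.** Graph embeddings are cellular embeddings in orientable surfaces, described by rotation systems; the genus of a connected graph is the least genus of such an embedding. A *current graph* with current group $\mathbb Z_n$ is an embedded graph each of whose arcs $e$ carries a current $\alpha(e)\in\mathbb Z_n$ with $\alpha(e^-)=-\alpha(e^+)$. It has *index* 1 if the embedding has one face; the *log* is the cyclic sequence of currents along the boundary walk of this face. The *excess* of a vertex is the sum of the currents entering it. Certain vertices are *vortices*; their face corners are labeled by distinct letters, which are inserted in the log at their corners. The vortices are of type (V1), i.e. of degree 1 with excess generating $\mathbb Z_n$, or of type (V3), i.e. of degree 3 with excess generating the subgroup of index 3 and with all incoming currents congruent modulo 3 to one and the same $j\not\equiv 0$. The *standard properties* are: all vertices have degree 1 or 3; each nonzero element of $\mathbb Z_n$ appears exactly once in the log (the element of order 2 is recorded once); the element of order 2 is the current of an edge incident with an unlabeled vertex of degree 1, and every other vertex of degree 1 is a vortex; unlabeled vertices of degree 3 have excess 0. The *derived embedding* of such a graph has as vertices the elements of $\mathbb Z_n$ (numbered vertices) and the letters. The rotation at vertex $0$ is the log; the rotation at vertex $i$ is obtained by adding $i$ to each number in the log, the two numbers around each letter position being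 separated by the letter that subdivides the face at that corner, so that corners of the same face receive the same letter; faces of length 2 are suppressed. An *edge flip* removes an edge between two triangular faces and adds the other diagonal of the resulting quadrangle. A *sequence of edge flips* $e_0\to e_1\to\dots\to e_k$ removes $e_0$, redraws each of $e_1,\dots,e_{k-1}$ as the diagonal of the quadrangle left by its predecessor, and finally adds the new edge $e_k$ in the quadrangle left by $e_{k-1}$. **Theorem.** Let $s\ge 2$ be an integer, and let $\gamma=6s-2$, $\delta=1$, $\varepsilon=6s+5$ in $\mathbb Z_{12s+6}$. There is an index 1 current graph with current group $\mathbb Z_{12s+6}$ that has the standard properties and the following ones. 1. It has vortices $x$ and $y$ of type (V1) with excesses $\delta$ and $\varepsilon$, where $\varepsilon\equiv 2\pmod 3$, and a vortex of type (V3) with corners $a,b,c$, which is adjacent to $y$. The log has the form $$(\dots\ 2\varepsilon\ a\ \varepsilon\ y\ {-\varepsilon}\ b\ \dots\ c\ \dots\ x\ \dots),$$ and $\gamma$ is the current of the remaining arc entering the (V3) vortex (at the corner $c$). 2. If $s\ge 3$, it contains a ladder whose successive rungs have currents $6s-12,\,6s-15,\,\dots,\,9$ (consecutive multiples of 3; no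 rungs if $s=3$) and alternate in direction, and whose vertices satisfy Kirchhoff's current law over $\mathbb Z$, when each current is represented by the integer of least absolute value. 3. Its derived embedding is a triangular embedding of $K_{12s+11}-K_5$, where the missing $K_5$ is on $a,b,c,x,y$. Let $g$ be its genus. 4. This embedding can be completed to an embedding of $K_{12s+11}$ of genus $g+2$ as follows. First perform the sequence of edge flips $(\gamma,b)\to(\gamma+2\varepsilon,\gamma+\varepsilon)\to(a,y)$ and the edge flip $(0,-\varepsilon)\to(b,y)$. Then change the rotation at vertex $0$, which now has the form $(b\ {-\gamma}\dots\gamma\ c\dots x\ {-\delta}\dots 2\varepsilon\ a\dots y)$, to $$(b\ a\dots y\ {-\delta}\dots 2\varepsilon\ c\dots x\ {-\gamma}\dots\gamma).$$ This increases the genus by 2 and merges the five triangles $[0,c,\gamma]$, $[0,b,y]$, $[0,-\delta,x]$, $[0,-\gamma,b]$, $[0,a,2\varepsilon]$ into the 15-sided face $[0,c,\gamma,0,b,y,0,-\delta,x,0,-\gamma,b,0,a,2\varepsilon]$. Draw the nine edges $ac$, $xy$, $bx$, $\gamma b$, $ab$, $ax$, $cx$, $cy$, $bc$ inside this face, leaving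 the quadrangles $[0,c,a,2\varepsilon]$, $[0,-\delta,x,y]$ and $[0,-\gamma,b,x]$. Finally, perform the sequence of edge flips $(-\gamma,x)\to(-\gamma-\delta,-\gamma+\delta)\to(0,-\varepsilon)$, and redraw $(-\gamma,x)$ in the quadrangle $[0,-\gamma,b,x]$. 5. The resulting embedding of $K_{12s+11}$ has minimum genus, so that for $n=12s+11$ $$\gamma(K_n)=g+2=\left\lceil\frac{(n-3)(n-4)}{12}\right\rceil .$$ -/

import Mathlib

open Equiv

/-! ### Graph embeddings given by rotation systems -/

/-- A cellular embedding of a simple graph in an oriented surface, described by a rotation system: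
`rot v` cyclically permutes the neighbours of `v` (the clockwise order of the edges at `v`). -/
structure RotationSystem (V : Type*) where
  graph : SimpleGraph V
  rot : V → Perm V
  rot_cyclic : ∀ v, (rot v).IsCycleOn (graph.neighborSet v)
  rot_fixed : ∀ v w, ¬ graph.Adj v w → rot v w = w

namespace RotationSystem

variable {V : Type*}

theorem adj_rot (R : RotationSystem V) {v w : V} (h : R.graph.Adj v w) :
    R.graph.Adj v (R.rot v w) :=
  (R.rot_cyclic v).1.1 h

theorem adj_rot_symm (R : RotationSystem V) {v w : V} (h : R.graph.Adj v w) :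
    R.graph.Adj v ((R.rot v).symm w) := by
  obtain ⟨u, hu, rfl⟩ := (R.rot_cyclic v).1.2.2 h
  simpa using hu

/-- Face tracing: the arc `u → v` is followed by `v → w`, where `w` is next after `u` in the
rotation at `v`. -/
def facePerm (R : RotationSystem V) : Perm R.graph.Dart where
  toFun d := ⟨(d.snd, R.rot d.snd d.fst), R.adj_rot d.adj.symm⟩
  invFun d := ⟨((R.rot d.fst).symm d.snd, d.fst), (R.adj_rot_symm d.adj).symm⟩
  left_inv d := by ext <;> simp
  right_inv d := by ext <;> simp

/-- The faces are the orbits of face tracing. -/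
def Face (R : RotationSystem V) : Type _ :=
  Quotient (Perm.SameCycle.setoid R.facePerm)

/-- The embedding of the (connected) graph lives in the orientable surface of genus `g`:
Euler's equation `|V| - |E| + |F| = 2 - 2g`. -/
def HasGenus (R : RotationSystem V) (g : ℕ) : Prop :=
  R.graph.Connected ∧
    (Nat.card V : ℤ) - Nat.card R.graph.edgeSet + Nat.card R.Face = 2 - 2 * (g : ℤ)

/-- `w 0, w 1, …, w (n-1)` (read cyclically) is the complete boundary walk of one face. -/
def IsFace (R : RotationSystem V) {n : ℕ} [NeZero n] (w : Fin n → V) : Prop :=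
  (∀ i, R.graph.Adj (w i) (w (i + 1)) ∧ R.rot (w (i + 1)) (w i) = w (i + 2)) ∧
    Function.Injective fun i => (w i, w (i + 1))

/-- Every face is a triangle. -/
def IsTriangular (R : RotationSystem V) : Prop :=
  ∀ d : R.graph.Dart, (R.facePerm ^ 3) d = d

variable [DecidableEq V]

/-- `R'` arises from `R` by deleting the edge `uv`: in the rotation at `u` the vertex `v` is
skipped, and conversely. -/
def DeleteEdge (R R' : RotationSystem V) (u v : V) : Prop :=
  R.graph.Adj u v ∧
  R'.graph = R.graph.deleteEdges {s(u, v)} ∧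
  R'.rot u = swap v (R.rot u v) * R.rot u ∧
  R'.rot v = swap u (R.rot v u) * R.rot v ∧
  ∀ z, z ≠ u → z ≠ v → R'.rot z = R.rot z

/-- `R'` arises from `R` by drawing, inside the face with boundary `w`, a new edge from the `i`-th
to the `j`-th corner: in the rotation at `w i` the vertex `w j` is inserted between
`w (i - 1)` and `w (i + 1)`, and conversely. -/
def DrawEdge (R R' : RotationSystem V) {n : ℕ} [NeZero n] (w : Fin n → V) (i j : Fin n) : Prop :=
  R.IsFace w ∧ w i ≠ w j ∧ ¬ R.graph.Adj (w i) (w j) ∧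
  R'.graph = R.graph ⊔ SimpleGraph.edge (w i) (w j) ∧
  R'.rot (w i) = swap (w j) (w (i + 1)) * R.rot (w i) ∧
  R'.rot (w j) = swap (w i) (w (j + 1)) * R.rot (w j) ∧
  ∀ z, z ≠ w i → z ≠ w j → R'.rot z = R.rot z

/-- Edge flip: an edge `e = uv` incident with two triangular faces `[u, v, p]` and `[v, u, q]` is
removed and replaced by the other diagonal `f = pq` of the resulting quadrangular face. -/
def EdgeFlip (R R' : RotationSystem V) (e f : Sym2 V) : Prop :=
  ∃ u v p q, e = s(u, v) ∧ f = s(p, q) ∧ R.IsFace ![u, v, p] ∧ R.IsFace ![v, u, q] ∧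
    ∃ M : RotationSystem V, R.DeleteEdge M u v ∧ M.DrawEdge R' ![u, q, v, p] 1 3

/-- The sequence of edge flips `e₀, e₁, …, eₖ`: the edge `e₀` is removed, each of the edges
`e₁, …, eₖ₋₁` is removed from its place and redrawn as the other diagonal of the quadrangle
that its predecessor left, and `eₖ` is added in the quadrangle left by `eₖ₋₁`. The flips are
carried out starting from the last one, so that the graph stays simple throughout. -/
def FlipSequence (R R' : RotationSystem V) : List (Sym2 V) → Prop
  | [] => R' = R
  | [_] => R' = R
  | e :: f :: l => ∃ M : RotationSystem V, FlipSequence R M (f :: l) ∧ M.EdgeFlip R' e f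

end RotationSystem

/-- `g` is the genus of the connected graph `G` (which has at least one edge): the least genus of
a cellular embedding. -/
def IsGraphGenus {V : Type*} (G : SimpleGraph V) (g : ℕ) : Prop :=
  IsLeast {g : ℕ | ∃ R : RotationSystem V, R.graph = G ∧ R.HasGenus g} g

/-! ### Current graphs -/

/-- A current graph with vertex set `W`, set of arcs `D`, current group `Γ`, and letters `L` on
some of its face corners. Each edge consists of two arcs `d` and `rev d`; `rot` gives the
rotation of the arcs leaving each vertex. -/
structure CurrentGraph (Γ : Type*) [AddCommGroup Γ] (L W D : Type*) where
  tail : D → W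
  rev : D → D
  rev_rev : ∀ d, rev (rev d) = d
  rev_ne : ∀ d, rev d ≠ d
  rot : Perm D
  rot_cyclic : ∀ v, rot.IsCycleOn {d | tail d = v}
  curr : D → Γ
  curr_rev : ∀ d, curr (rev d) = - curr d
  /-- The letter, if any, of the face corner that a face-boundary walk passes (at the head of `d`)
  right after traversing `d`. -/
  label : D → Option L

namespace CurrentGraph

section General

variable {Γ : Type*} [AddCommGroup Γ] {L W D : Type*}

def head (G : CurrentGraph Γ L W D) (d : D) : W := G.tail (G.rev d)

/-- Face tracing on the arcs. -/
def face (G : CurrentGraph Γ L W D) : Perm D where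
  toFun d := G.rot (G.rev d)
  invFun d := G.rev (G.rot.symm d)
  left_inv d := by simp [G.rev_rev]
  right_inv d := by simp [G.rev_rev]

/-- The number of faces of the embedding. -/
noncomputable def index (G : CurrentGraph Γ L W D) : ℕ :=
  Nat.card (Quotient (Perm.SameCycle.setoid G.face))

variable [Fintype D] [DecidableEq W]

def degree (G : CurrentGraph Γ L W D) (v : W) : ℕ :=
  (Finset.univ.filter fun d => G.tail d = v).card

/-- Sum of the currents on the arcs entering `v`. -/
def excess (G : CurrentGraph Γ L W D) (v : W) : Γ :=
  ∑ d ∈ Finset.univ.filter (fun d => G.head d = v), G.curr d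

/-- The embedding of the complement of a complete graph on the letters in the complete graph on
numbered and lettered vertices that is derived from an index 1 current graph.

The corner of the current graph after the arc `d` gives, at each numbered vertex `i`, a corner
between the neighbours `i + curr d` and `i + curr (face d)`. Its letter is `ℓ i d`; corners of the
same face have the same letter, and at vertex `0` the letters are those of the log. A face
with a letter is subdivided by a vertex with that name. The corner at the dead end of an edge
with a current of order 2 belongs to a two-sided face, which is suppressed. -/
def IsDerived (G : CurrentGraph Γ L W D) (R : RotationSystem (Γ ⊕ L)) : Prop :=
  ∃ ℓ : Γ → D → Option L,
    (∀ d, ℓ 0 d = G.label d) ∧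
    (∀ i d, (ℓ i d).isSome = (G.label d).isSome) ∧
    (∀ i d, ℓ (i + G.curr (G.face d)) (G.rev (G.face d)) = ℓ i d) ∧
    (∀ i d, ℓ i d = none → G.curr (G.face d) ≠ G.curr d →
      R.rot (.inl i) (.inl (i + G.curr d)) = .inl (i + G.curr (G.face d))) ∧
    (∀ i d z, ℓ i d = some z →
      R.rot (.inl i) (.inl (i + G.curr d)) = .inr z ∧
      R.rot (.inl i) (.inr z) = .inl (i + G.curr (G.face d)) ∧
      R.rot (.inr z) (.inl (i + G.curr (G.face d))) = .inl i)

end General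

section Cyclic

variable {n : ℕ} {L W D : Type*} [Fintype D] [DecidableEq W]

/-- A vortex is a vertex whose face corners carry letters. -/
def IsVortex (G : CurrentGraph (ZMod n) L W D) (v : W) : Prop :=
  ∃ d, G.head d = v ∧ (G.label d).isSome

/-- Vortex of type (V1). -/
def IsV1 (G : CurrentGraph (ZMod n) L W D) (v : W) : Prop :=
  G.degree v = 1 ∧ AddSubgroup.zmultiples (G.excess v) = ⊤

/-- Vortex of type (V3). -/
def IsV3 (G : CurrentGraph (ZMod n) L W D) (v : W) : Prop :=
  G.degree v = 3 ∧ (AddSubgroup.zmultiples (G.excess v)).index = 3 ∧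
    ∃ j, (j = 1 ∨ j = 2) ∧ ∀ d, G.head d = v → (G.curr d).val % 3 = j

/-- The standard properties of an index 1 current graph, all of whose vortices are
of type (V1) or (V3). -/
structure IsStandard (G : CurrentGraph (ZMod n) L W D) : Prop where
  index_one : G.index = 1
  /-- Vertices have degree 1 and 3. -/
  degree_eq : ∀ v, G.degree v = 1 ∨ G.degree v = 3
  /-- The log consists of nonzero elements, each of which appears exactly once (the element of
  order 2 is on both arcs of its edge, and is recorded once). -/
  curr_ne : ∀ d, G.curr d ≠ 0
  curr_surj : ∀ g : ZMod n, g ≠ 0 → ∃ d, G.curr d = g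
  curr_inj : ∀ d d', G.curr d = G.curr d' → d' = d ∨ d' = G.rev d
  /-- The element of order 2 is the current of an arc incident with a vertex of degree 1. -/
  order_two : ∀ d, G.curr d + G.curr d = 0 → G.degree (G.tail d) = 1 ∨ G.degree (G.head d) = 1
  /-- Unlabeled vertices of degree 3 satisfy Kirchhoff's current law. -/
  kirchhoff : ∀ v, ¬ G.IsVortex v → G.degree v = 3 → G.excess v = 0
  /-- An unlabeled vertex of degree 1 is the dead end of the edge with current of order 2. -/
  dead_end : ∀ d, ¬ G.IsVortex (G.head d) → G.degree (G.head d) = 1 → G.curr d + G.curr d = 0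
  vortex_type : ∀ v, G.IsVortex v → G.IsV1 v ∨ G.IsV3 v
  /-- All face corners of a vortex are labeled, with distinct letters. -/
  label_all : ∀ d, G.IsVortex (G.head d) → (G.label d).isSome
  label_inj : ∀ d d' z, G.label d = some z → G.label d' = some z → d = d'

end Cyclic

end CurrentGraph

/-! ### The construction -/

inductive Letter
  | a | b | c | x | y
  deriving DecidableEq

/-- Numbered and lettered vertices: `12s + 11` in total. -/
abbrev Vert (s : ℕ) : Type := ZMod (12 * s + 6) ⊕ Letter

/-- The numbered vertex `i`. -/
abbrev num {s : ℕ} (i : ZMod (12 * s + 6)) : Vert s := Sum.inl i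

/-- The lettered vertex `z`. -/
abbrev letter {s : ℕ} (z : Letter) : Vert s := Sum.inr z

/-- `K_{12s+11} - K₅`: all pairs of distinct vertices are adjacent except pairs of letters. -/
def completeMinusLetters (s : ℕ) : SimpleGraph (Vert s) where
  Adj u v := u ≠ v ∧ ¬ (u.isRight ∧ v.isRight)
  symm := ⟨fun _ _ h => ⟨h.1.symm, fun h' => h.2 h'.symm⟩⟩
  loopless := ⟨fun _ h => h.1 rfl⟩

/-- The constraints on the vortices: `x` and `y` are vortices of type (V1) with excesses `δ` and
`ε ≡ 2 (mod 3)`; there is a vortex of type (V3) with corners `a`, `b`, `c`, adjacent to the vortex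
`y`; the log has the form `(… 2ε a ε y -ε b … c … x …)`; and `γ` is the current of the
remaining arc entering the (V3) vortex. -/
def VortexConstraints {n : ℕ} {W D : Type*} [Fintype D] [DecidableEq W]
    (G : CurrentGraph (ZMod n) Letter W D) (γ δ ε : ZMod n) : Prop :=
  ε.val % 3 = 2 ∧
  ∃ (X Y Z : W) (d : D),
    G.IsV1 X ∧ G.excess X = δ ∧ G.IsV1 Y ∧ G.excess Y = ε ∧ G.IsV3 Z ∧
    G.head d = Z ∧ G.curr d = 2 * ε ∧ G.label d = some .a ∧
    G.head (G.face d) = Y ∧ G.curr (G.face d) = ε ∧ G.label (G.face d) = some .y ∧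
    G.head ((G.face ^ 2) d) = Z ∧ G.curr ((G.face ^ 2) d) = -ε ∧
    G.label ((G.face ^ 2) d) = some .b ∧
    ∃ k m : ℕ, 2 < k ∧ k < m ∧ m < Fintype.card D ∧
      G.head ((G.face ^ k) d) = Z ∧ G.curr ((G.face ^ k) d) = γ ∧
      G.label ((G.face ^ k) d) = some .c ∧
      G.head ((G.face ^ m) d) = X ∧ G.label ((G.face ^ m) d) = some .x

/-- The current graph contains a ladder with rungs `6s - 12, 6s - 15, …, 9`, consecutive multiples
of 3 whose arcs alternate in direction, such that the vertices of the ladder have degree 3 and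
satisfy Kirchhoff's current law over `ℤ`, when each element of the current group is represented
by an integer of least absolute value. (For `s = 3` there are no rungs.) -/
def HasLadder (s : ℕ) {W D : Type*} [Fintype D] [DecidableEq W]
    (G : CurrentGraph (ZMod (12 * s + 6)) Letter W D) : Prop :=
  ∃ top bot : Fin (2 * s - 6) → W,
    Function.Injective (Sum.elim top bot) ∧
    (∀ v ∈ Set.range (Sum.elim top bot), G.degree v = 3 ∧ ¬ G.IsVortex v ∧
      ∑ d ∈ Finset.univ.filter (fun d => G.head d = v), (G.curr d).valMinAbs = 0) ∧
    (∀ k : Fin (2 * s - 6), ∃ d, G.curr d = 6 * s - 12 - 3 * (k : ℕ) ∧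
      if Even (k : ℕ) then G.tail d = top k ∧ G.head d = bot k
      else G.tail d = bot k ∧ G.head d = top k) ∧
    (∀ k l : Fin (2 * s - 6), (k : ℕ) + 1 = l →
      (∃ d, G.tail d = top k ∧ G.head d = top l) ∧ ∃ d, G.tail d = bot k ∧ G.head d = bot l)

open Letter in
/-- The handle modification: the rotation at vertex `0`
`(b -γ … γ c … x -δ … 2ε a … y)` is changed to `(b a … y -δ … 2ε c … x -γ … γ)`.
This merges five triangles into a 15-sided face. -/
def HandleModification {s : ℕ} (R R' : RotationSystem (Vert s)) (γ δ ε : ZMod (12 * s + 6)) :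
    Prop :=
  R.IsFace ![num 0, letter c, num γ] ∧
  R.IsFace ![num 0, letter b, letter y] ∧
  R.IsFace ![num 0, num (-δ), letter x] ∧
  R.IsFace ![num 0, num (-γ), letter b] ∧
  R.IsFace ![num 0, letter a, num (2 * ε)] ∧
  R'.graph = R.graph ∧
  (∀ v, v ≠ num 0 → R'.rot v = R.rot v) ∧
  R'.rot (num 0) (letter b) = letter a ∧
  R'.rot (num 0) (letter y) = num (-δ) ∧
  R'.rot (num 0) (num (2 * ε)) = letter c ∧
  R'.rot (num 0) (letter x) = num (-γ) ∧
  R'.rot (num 0) (num γ) = letter b ∧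
  (∀ v, v ≠ letter b → v ≠ letter y → v ≠ num (2 * ε) → v ≠ letter x → v ≠ num γ →
    R'.rot (num 0) v = R.rot (num 0) v) ∧
  R'.IsFace ![num 0, letter c, num γ, num 0, letter b, letter y, num 0, num (-δ), letter x,
    num 0, num (-γ), letter b, num 0, letter a, num (2 * ε)]

open Letter in
/-- Nine edges are drawn inside the 15-sided face: `ac`, `xy`, `bx`, `γb`, `ab`, `ax`, `cx`, `cy`,
`bc`, in such a way that the three quadrangles `[0, c, a, 2ε]`, `[0, -δ, x, y]` and `[0, -γ, b, x]`
are left. (Each `DrawEdge` clause lists the part of the 15-gon that is still to be filled.) -/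
def FillFace {s : ℕ} (R R' : RotationSystem (Vert s)) (γ δ ε : ZMod (12 * s + 6)) : Prop :=
  ∃ Q : Fin 10 → RotationSystem (Vert s), Q 0 = R ∧ Q 9 = R' ∧
    (Q 0).DrawEdge (Q 1) ![num 0, letter c, num γ, num 0, letter b, letter y, num 0, num (-δ),
      letter x, num 0, num (-γ), letter b, num 0, letter a, num (2 * ε)] 1 13 ∧
    (Q 1).DrawEdge (Q 2) ![letter c, num γ, num 0, letter b, letter y, num 0, num (-δ),
      letter x, num 0, num (-γ), letter b, num 0, letter a] 4 7 ∧
    (Q 2).DrawEdge (Q 3) ![letter c, num γ, num 0, letter b, letter y, letter x, num 0, num (-γ),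
      letter b, num 0, letter a] 5 8 ∧
    (Q 3).DrawEdge (Q 4) ![letter c, num γ, num 0, letter b, letter y, letter x, letter b, num 0,
      letter a] 1 3 ∧
    (Q 4).DrawEdge (Q 5) ![letter c, num γ, letter b, letter y, letter x, letter b, num 0,
      letter a] 5 7 ∧
    (Q 5).DrawEdge (Q 6) ![letter c, num γ, letter b, letter y, letter x, letter b, letter a] 4 6 ∧
    (Q 6).DrawEdge (Q 7) ![letter c, num γ, letter b, letter y, letter x, letter a] 4 0 ∧
    (Q 7).DrawEdge (Q 8) ![letter c, num γ, letter b, letter y, letter x] 0 3 ∧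
    (Q 8).DrawEdge (Q 9) ![letter c, num γ, letter b, letter y] 0 2 ∧
    R'.IsFace ![num 0, letter c, letter a, num (2 * ε)] ∧
    R'.IsFace ![num 0, num (-δ), letter x, letter y] ∧
    R'.IsFace ![num 0, num (-γ), letter b, letter x]

open Letter in
/-- The completion of the derived embedding `R₀`: the initial flips give `R₁`, the handle
modification gives `R₂`, drawing edges in the 15-sided face gives `R₃`, the flip sequence
triggered by redrawing the edge `(-γ, x)` gives `R₄`, and redrawing that edge gives `R₅`. -/
structure IsCompletion {s : ℕ} (γ δ ε : ZMod (12 * s + 6))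
    (R₀ R₁ R₂ R₃ R₄ R₅ : RotationSystem (Vert s)) : Prop where
  initial_flips : ∃ M : RotationSystem (Vert s),
    R₀.FlipSequence M
      [s(num γ, letter b), s(num (γ + 2 * ε), num (γ + ε)), s(letter a, letter y)] ∧
    M.FlipSequence R₁ [s(num 0, num (-ε)), s(letter b, letter y)]
  handle : HandleModification R₁ R₂ γ δ ε
  fill : FillFace R₂ R₃ γ δ ε
  final_flips : R₃.FlipSequence R₄
    [s(num (-γ), letter x), s(num (-γ - δ), num (-γ + δ)), s(num 0, num (-ε))]
  redraw : R₄.DrawEdge R₅ ![num 0, num (-γ), letter b, letter x] 1 3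

/-!
# Minimum genus embeddings of `K_{12s+11}`

The current graph is described by its log. The arcs are named by their currents, except that the
arc leaving the dead end, whose current is the element of order 2 as is that of its reverse, is
named `0`. So a log is a permutation `F` of the current group, and `IsLog` collects what is asked
of it. For `s = 2` and `s = 3` the log is an explicit list. For `s ≥ 4` the arcs are listed by the
vertices that they enter: 13 individual vertices of degree 3, three vertices of degree 1, and the
vertices of a ladder (`LadderLog`). In the rotation chosen at the vertices of the ladder, the face
boundary runs straight through the ladder from left to right, once along each side, and zigzags
over the rungs from right to left. The position of each arc in the log is therefore an affine
function of `s` and of its place in the ladder, and comparing these positions shows that there is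
just one face.

In the derived embedding, a corner with a letter lies in a triangle which arises from an edge of
the face that this letter subdivides, and every other corner lies in a triangle which arises from
a vertex where Kirchhoff's current law holds (`IsLog.derived_pairPerm_pow_three`). Hence the
embedding is triangular, and its genus `g = 12s² + 15s + 3` follows from Euler's formula.

For the completion, faces are counted as cycles of a permutation of all ordered pairs of vertices,
whose cycles are the faces and the pairs of non-adjacent vertices (`RotationSystem.pairPerm`). Then
Euler's formula does not mention the number of edges (`RotationSystem.hasGenus_iff`). Drawing an
edge composes this permutation with two transpositions, one of which merges two cycles while the
other splits one, so edges can be drawn and flipped without a change of the genus. The handle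
modification composes it with a cycle that meets five different faces and merges them into one,
so that the number of cycles decreases by 4 and the genus grows by 2. That all the faces exist
which the operations need is a matter of 42 corners of the derived embedding, involving 15 vertices;
these are recorded in a `CornerTable`, which is updated along with the rotation system. The new
rotation at `0` is cyclic since the old one is cut into segments and these are reassembled
(`IsLog.exists_segments`).

Finally, in an embedding of a complete graph every face has at least three sides, whence the genus
is at least `⌈(n - 3)(n - 4) / 12⌉`, the value that is attained (`genus_complete_ge`).
-/


/-! ### Cycles of permutations -/

namespace Equiv.Perm

section

variable {α β : Type*}

theorem SameCycle.map_of_forall {σ : Perm α} {τ : Perm β} (f : α → β)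
    (h : ∀ w, τ.SameCycle (f w) (f (σ w))) {x y : α} (hxy : σ.SameCycle x y) :
    τ.SameCycle (f x) (f y) := by
  obtain ⟨k, rfl⟩ := hxy
  induction k using Int.induction_on with
  | zero => exact SameCycle.refl _ _
  | succ k ih =>
    have := h ((σ ^ (k : ℤ)) x)
    rw [← mul_apply, ← zpow_one_add, add_comm] at this
    exact ih.trans this
  | pred k ih =>
    have := h ((σ ^ (-(k : ℤ) - 1)) x)
    rw [← mul_apply, ← zpow_one_add, add_sub_cancel] at this
    exact ih.trans this.symm

theorem SameCycle.eq_of_invariant {σ : Perm α} (f : α → β) (h : ∀ w, f (σ w) = f w) {x y : α}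
    (hxy : σ.SameCycle x y) : f x = f y := by
  have := hxy.map_of_forall (τ := (1 : Perm β)) f (fun w => by simp [h])
  simpa using this

theorem isCycleOn_of {σ : Perm α} {s : Set α} (h : ∀ x, σ x ∈ s ↔ x ∈ s)
    (h' : ∀ x ∈ s, ∀ y ∈ s, σ.SameCycle x y) : σ.IsCycleOn s :=
  ⟨Equiv.bijOn σ (fun x => h x), h'⟩

theorem IsCycleOn.apply_mem_iff' {σ : Perm α} {s : Set α} (h : σ.IsCycleOn s) (x : α) :
    σ x ∈ s ↔ x ∈ s := by
  refine ⟨fun hx => ?_, fun hx => h.1.1 hx⟩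
  obtain ⟨u, hu, hux⟩ := h.1.2.2 hx
  rwa [← σ.injective hux]

variable [DecidableEq α]

/-- Inserting a fixed point `z` of `σ` into a cycle, right after the element `a`. -/
theorem IsCycleOn.insert_swap {σ : Perm α} {s : Set α} (h : σ.IsCycleOn s) {a z : α} (ha : a ∈ s)
    (hz : σ z = z) (hzs : z ∉ s) : (swap z (σ a) * σ).IsCycleOn (insert z s) := by
  set τ := swap z (σ a) * σ with hτ
  have haz : a ≠ z := fun e => hzs (e ▸ ha)
  have h1 : τ a = z := by simp [hτ]
  have h2 : τ z = σ a := by simp [hτ, hz]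
  have h3 : ∀ x, x ≠ a → x ≠ z → τ x = σ x := fun x hxa hxz => by
    simp only [hτ, mul_apply]
    refine swap_apply_of_ne_of_ne (fun e => hxz (σ.injective (e.trans hz.symm)))
      (fun e => hxa (σ.injective e))
  have step : ∀ w, τ.SameCycle w (σ w) := fun w => by
    by_cases hwa : w = a
    · subst hwa
      exact ⟨2, by rw [show (2 : ℤ) = 1 + 1 by norm_num, zpow_one_add, mul_apply, zpow_one, h1, h2]⟩
    by_cases hwz : w = z
    · subst hwz; rw [hz]
    · exact ⟨1, by rw [zpow_one, h3 w hwa hwz]⟩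
  have all : ∀ x ∈ insert z s, τ.SameCycle a x := by
    rintro x (rfl | hx)
    · exact ⟨1, by simpa using h1⟩
    · exact (h.2 ha hx).map_of_forall id step
  refine isCycleOn_of (fun x => ?_) (fun x hx y hy => (all x hx).symm.trans (all y hy))
  by_cases hxa : x = a
  · subst hxa; simp [h1, ha]
  by_cases hxz : x = z
  · subst hxz; rw [h2]; simp [h.1.1 ha]
  · rw [h3 x hxa hxz, Set.mem_insert_iff, Set.mem_insert_iff, h.apply_mem_iff']
    have : σ x ≠ z := fun e => hxz (σ.injective (e.trans hz.symm))
    simp [this, hxz]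

/-- Skipping the element `v` of a cycle. -/
theorem IsCycleOn.erase_swap {σ : Perm α} {s : Set α} (h : σ.IsCycleOn s) {v : α} (hv : v ∈ s) :
    (swap v (σ v) * σ).IsCycleOn (s \ {v}) := by
  set τ := swap v (σ v) * σ with hτ
  have h1 : τ v = v := by simp [hτ]
  have h2 : ∀ x, σ x = v → τ x = σ v := fun x hx => by simp [hτ, hx]
  have h3 : ∀ x, σ x ≠ v → x ≠ v → τ x = σ x := fun x hx hxv => by
    simp only [hτ, mul_apply]
    exact swap_apply_of_ne_of_ne hx (fun e => hxv (σ.injective e))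
  have step : ∀ w, τ.SameCycle (if w = v then σ v else w) (if σ w = v then σ v else σ w) := by
    intro w
    by_cases hwv : w = v
    · subst hwv
      by_cases hw : σ w = w <;> simp [hw, SameCycle.refl]
    · by_cases hw : σ w = v
      · simp only [if_neg hwv, if_pos hw]
        exact ⟨1, by rw [zpow_one, h2 w hw]⟩
      · simp only [if_neg hwv, if_neg hw]
        exact ⟨1, by rw [zpow_one, h3 w hw hwv]⟩
  refine isCycleOn_of (fun x => ?_) ?_
  · by_cases hxv : x = v
    · subst hxv; simp [h1]
    · have key : τ x ∈ s ↔ x ∈ s := by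
        by_cases hx : σ x = v
        · rw [h2 x hx]
          have := h.apply_mem_iff' x
          rw [hx] at this
          exact ⟨fun _ => this.1 hv, fun _ => h.1.1 hv⟩
        · rw [h3 x hx hxv]; exact h.apply_mem_iff' x
      have : τ x ≠ v := fun e => hxv (τ.injective (e.trans h1.symm))
      simp [key, hxv, this]
  · rintro x ⟨hx, hxv⟩ y ⟨hy, hyv⟩
    simp only [Set.mem_singleton_iff] at hxv hyv
    have := (h.2 hx hy).map_of_forall (τ := τ) (fun w => if w = v then σ v else w) step
    simpa [hxv, hyv] using this

end

/-! ### The number of cycles of a permutation -/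

section

variable {α : Type*}

/-- The number of cycles of a permutation, fixed points included. -/
noncomputable def orbitCount (σ : Perm α) : ℕ :=
  Nat.card (Quotient (SameCycle.setoid σ))

variable [DecidableEq α]

/-- Along the `σ`-path from `a`, the permutation `swap a b * σ` does the same as `σ` until the
path arrives at `a` or `b`. -/
theorem swap_mul_pow_apply {σ : Perm α} {a b : α} {k : ℕ}
    (h : ∀ i, 0 < i → i < k → (σ ^ i) a ≠ a ∧ (σ ^ i) a ≠ b) {i : ℕ} (hi : i < k) :
    ((swap a b * σ) ^ i) a = (σ ^ i) a := by
  induction i with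
  | zero => simp
  | succ i ih =>
    rw [pow_succ', mul_apply, ih (by omega), mul_apply, ← mul_apply σ, ← pow_succ']
    exact swap_apply_of_ne_of_ne (h (i + 1) (by omega) hi).1 (h (i + 1) (by omega) hi).2

/-- A property that is constant on the cycles of `σ` and agrees at `a` and `b` is constant on the
cycles of `swap a b * σ`. -/
theorem SameCycle.eq_of_swap_mul {β : Type*} {σ : Perm α} {a b : α} (f : α → β)
    (hf : ∀ w, f (σ w) = f w) (hab : f a = f b) {x y : α}
    (hxy : (swap a b * σ).SameCycle x y) : f x = f y := by
  refine hxy.eq_of_invariant f fun w => ?_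
  rw [mul_apply]
  by_cases h1 : σ w = a
  · rw [h1, swap_apply_left, ← hab, ← h1, hf]
  by_cases h2 : σ w = b
  · rw [h2, swap_apply_right, hab, ← h2, hf]
  · rw [swap_apply_of_ne_of_ne h1 h2, hf]

variable [Finite α]

theorem sameCycle_swap_mul {σ : Perm α} {a b : α} (h : ¬ σ.SameCycle a b) :
    (swap a b * σ).SameCycle a b := by
  classical
  have hex : ∃ k, 0 < k ∧ (σ ^ k) a = a :=
    ⟨orderOf σ, orderOf_pos σ, by simp [pow_orderOf_eq_one]⟩
  obtain ⟨hk0, hk⟩ := Nat.find_spec hex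
  set k := Nat.find hex
  have hmin : ∀ i, 0 < i → i < k → (σ ^ i) a ≠ a ∧ (σ ^ i) a ≠ b := fun i hi hik =>
    ⟨fun e => Nat.find_min hex hik ⟨hi, e⟩, fun e => h ⟨i, by simpa using e⟩⟩
  have := swap_mul_pow_apply hmin (i := k - 1) (by omega)
  have e : ∀ ρ : Perm α, (ρ ^ k) a = ρ ((ρ ^ (k - 1)) a) := fun ρ => by
    rw [← mul_apply, ← pow_succ', Nat.sub_add_cancel hk0]
  refine ⟨k, ?_⟩
  rw [zpow_natCast, e, this, mul_apply, ← e, hk, swap_apply_left]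

theorem not_sameCycle_swap_mul {σ : Perm α} {a b : α} (hab : a ≠ b) (h : σ.SameCycle a b) :
    ¬ (swap a b * σ).SameCycle a b := by
  classical
  have hex : ∃ k, 0 < k ∧ (σ ^ k) a = b := by
    obtain ⟨k, h0, -, hk⟩ := h.exists_pow_eq''
    exact ⟨k, h0, hk⟩
  obtain ⟨hk0, hk⟩ := Nat.find_spec hex
  set k := Nat.find hex
  have hmin : ∀ i, 0 < i → i < k → (σ ^ i) a ≠ a ∧ (σ ^ i) a ≠ b := fun i hi hik =>
    ⟨fun e => Nat.find_min hex (m := k - i) (by omega) ⟨by omega, by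
      have : (σ ^ (k - i)) ((σ ^ i) a) = b := by
        rw [← mul_apply, ← pow_add, Nat.sub_add_cancel hik.le, hk]
      rwa [e] at this⟩, fun e => Nat.find_min hex hik ⟨hi, e⟩⟩
  have hpre := fun i hi => swap_mul_pow_apply hmin (i := i) hi
  set τ := swap a b * σ with hτ
  have hper : (τ ^ k) a = a := by
    have := hpre (k - 1) (by omega)
    have e : ∀ ρ : Perm α, (ρ ^ k) a = ρ ((ρ ^ (k - 1)) a) := fun ρ => by
      rw [← mul_apply, ← pow_succ', Nat.sub_add_cancel hk0]
    rw [e, this, hτ, mul_apply, ← e, hk, swap_apply_right]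
  intro hc
  obtain ⟨i, hi⟩ := hc.exists_nat_pow_eq
  have hmod : (τ ^ (i % k)) a = b := by
    have e : ∀ q : ℕ, ((τ ^ k) ^ q) a = a := fun q => by
      induction q with
      | zero => simp
      | succ q ih => rw [pow_succ, mul_apply, hper, ih]
    rw [← Nat.mod_add_div i k, pow_add, mul_apply, pow_mul, e] at hi
    exact hi
  have hlt := Nat.mod_lt i hk0
  rw [hpre _ hlt] at hmod
  rcases Nat.eq_zero_or_pos (i % k) with h0 | h0
  · rw [h0] at hmod; exact hab (by simpa using hmod)
  · exact (hmin _ h0 hlt).2 hmod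

/-- A swap that merges two cycles keeps the elements of each cycle together. -/
theorem SameCycle.swap_mul {σ : Perm α} {a b : α} (h : ¬ σ.SameCycle a b) {x y : α}
    (hxy : σ.SameCycle x y) : (swap a b * σ).SameCycle x y := by
  refine hxy.map_of_forall id fun w => ?_
  have hab := sameCycle_swap_mul h
  simp only [id]
  by_cases h1 : σ w = a
  · rw [h1]
    exact SameCycle.trans ⟨1, by simp [h1]⟩ hab.symm
  by_cases h2 : σ w = b
  · rw [h2]
    exact SameCycle.trans ⟨1, by simp [h2]⟩ hab
  · exact ⟨1, by simp [swap_apply_of_ne_of_ne h1 h2]⟩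

/-- A swap of two elements in different cycles merges these cycles. -/
theorem orbitCount_swap_mul_of_not_sameCycle {σ : Perm α} {a b : α} (h : ¬ σ.SameCycle a b) :
    orbitCount (swap a b * σ) + 1 = orbitCount σ := by
  classical
  set τ := swap a b * σ with hτ
  let Q := Quotient (SameCycle.setoid σ)
  let B : Q := Quotient.mk (SameCycle.setoid σ) b
  have hfin : Finite Q := Quotient.finite _
  let f : {q : Q // q ≠ B} → Quotient (SameCycle.setoid τ) := fun q =>
    Quotient.lift (fun w => Quotient.mk (SameCycle.setoid τ) w)
      (fun x y (hxy : σ.SameCycle x y) => Quotient.sound (hxy.swap_mul h)) q.1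
  have hbij : Function.Bijective f := by
    constructor
    · rintro ⟨q, hq⟩ ⟨q', hq'⟩ e
      obtain ⟨x, rfl⟩ := Quotient.exists_rep q
      obtain ⟨y, rfl⟩ := Quotient.exists_rep q'
      have hxy : τ.SameCycle x y := Quotient.exact e
      have hx : ¬ σ.SameCycle x b := fun e => hq (Quotient.sound e)
      have hy : ¬ σ.SameCycle y b := fun e => hq' (Quotient.sound e)
      have := hxy.eq_of_swap_mul (σ := σ)
        (fun w => if σ.SameCycle w b then Quotient.mk (SameCycle.setoid σ) a
          else Quotient.mk (SameCycle.setoid σ) w) (fun w => ?_) (by simp [h, SameCycle.refl])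
      · simpa [hx, hy] using this
      · have : Quotient.mk (SameCycle.setoid σ) (σ w) = Quotient.mk (SameCycle.setoid σ) w :=
          Quotient.sound (sameCycle_apply_left.2 (SameCycle.refl _ _))
        simp only [sameCycle_apply_left, this]
    · intro q
      obtain ⟨w, rfl⟩ := Quotient.exists_rep q
      by_cases hw : σ.SameCycle w b
      · refine ⟨⟨Quotient.mk _ a, fun e => h (Quotient.exact e)⟩, Quotient.sound ?_⟩
        exact (sameCycle_swap_mul h).trans (hw.symm.swap_mul h)
      · exact ⟨⟨Quotient.mk _ w, fun e => hw (Quotient.exact e)⟩, rfl⟩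
  have hcard : Nat.card {q : Q // q ≠ B} + 1 = Nat.card Q := by
    have : Fintype Q := Fintype.ofFinite Q
    rw [Nat.card_eq_fintype_card, Nat.card_eq_fintype_card, Fintype.card_subtype_compl]
    have : 0 < Fintype.card Q := Fintype.card_pos_iff.2 ⟨B⟩
    simp only [Fintype.card_unique]
    omega
  rw [orbitCount, orbitCount, ← Nat.card_congr (Equiv.ofBijective f hbij), hcard]

/-- A swap of two elements in the same cycle splits this cycle. -/
theorem orbitCount_swap_mul_of_sameCycle {σ : Perm α} {a b : α} (hab : a ≠ b)
    (h : σ.SameCycle a b) : orbitCount (swap a b * σ) = orbitCount σ + 1 := by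
  have := orbitCount_swap_mul_of_not_sameCycle (not_sameCycle_swap_mul hab h)
  rw [← mul_assoc, swap_mul_self, one_mul] at this
  exact this.symm

/-- Composition of the swaps of consecutive elements of a list. -/
def swapChain : List α → Perm α
  | a :: b :: l => swapChain (b :: l) * swap a b
  | _ => 1

/-- Swaps along a list of elements in different cycles merge all these cycles. -/
theorem orbitCount_swapChain_mul {l : List α} {a : α} {σ : Perm α}
    (h : (a :: l).Pairwise fun x y => ¬ σ.SameCycle x y) :
    orbitCount (swapChain (a :: l) * σ) + l.length = orbitCount σ := by
  induction l generalizing a σ with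
  | nil => simp [swapChain]
  | cons b l ih =>
    rw [List.pairwise_cons] at h
    obtain ⟨ha, hbl⟩ := h
    rw [List.pairwise_cons] at hbl
    have hab := ha b (by simp)
    have inv : ∀ z, ¬ σ.SameCycle z a → ¬ σ.SameCycle z b → ∀ z',
        (swap a b * σ).SameCycle z z' → σ.SameCycle z z' := fun z hza hzb z' hz => by
      have := hz.eq_of_swap_mul (σ := σ) (fun w => σ.SameCycle z w) (fun w => by simp)
        (by simp [hza, hzb])
      exact this.mp (SameCycle.refl _ _)
    have := ih (a := b) (σ := swap a b * σ) ?_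
    · have h2 := orbitCount_swap_mul_of_not_sameCycle hab
      rw [swapChain, mul_assoc, List.length_cons]
      omega
    · refine List.pairwise_cons.2 ⟨fun z hz e => ?_, hbl.2.imp_of_mem fun {z z'} hz _ hzz' e => ?_⟩
      · have hza := ha z (by simp [hz])
        have hzb := hbl.1 z hz
        exact hzb (inv z (fun e => hza e.symm) (fun e => hzb e.symm) b e.symm).symm
      · have hza := ha z (by simp [hz])
        have hzb := hbl.1 z hz
        exact hzz' (inv z (fun e => hza e.symm) (fun e => hzb e.symm) z' e)

end

/-- If no cycle has length less than 3, there are at most a third as many cycles as elements. -/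
theorem three_mul_orbitCount_le {α : Type*} [Finite α] {σ : Perm α} (h1 : ∀ x, σ x ≠ x)
    (h2 : ∀ x, σ (σ x) ≠ x) : 3 * orbitCount σ ≤ Nat.card α := by
  let f : Quotient (SameCycle.setoid σ) × Fin 3 → α := fun q => (σ ^ (q.2 : ℕ)) q.1.out
  have hf : Function.Injective f := by
    rintro ⟨q, i⟩ ⟨q', j⟩ e
    have hq : q = q' := by
      have : σ.SameCycle q.out q'.out := by
        have e1 : σ.SameCycle q.out (f (q, i)) := ⟨(i : ℕ), by simp [f]⟩
        have e2 : σ.SameCycle q'.out (f (q', j)) := ⟨(j : ℕ), by simp [f]⟩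
        exact e1.trans (e ▸ e2.symm)
      rw [← Quotient.out_eq q, ← Quotient.out_eq q']
      exact Quotient.sound this
    subst hq
    have h1' := h1 q.out
    have h2' := h2 q.out
    have h3' := h1 (σ q.out)
    have e' : (σ ^ (i : ℕ)) q.out = (σ ^ (j : ℕ)) q.out := e
    fin_cases i <;> fin_cases j <;> first
      | rfl
      | exact absurd e' h1'
      | exact absurd e'.symm h1'
      | exact absurd (σ.injective e') h1'
      | exact absurd (σ.injective e').symm h1'
      | exact absurd e' h2'
      | exact absurd e'.symm h2'
  have := Nat.card_le_card_of_injective f hf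
  rwa [Nat.card_prod, Nat.card_fin, mul_comm] at this

theorem three_mul_orbitCount {α : Type*} [Finite α] {σ : Perm α} (h1 : ∀ x, σ x ≠ x)
    (h3 : ∀ x, (σ ^ 3) x = x) : 3 * orbitCount σ = Nat.card α := by
  have h3' : ∀ x, σ (σ (σ x)) = x := fun x => by simpa [pow_succ] using h3 x
  refine le_antisymm (three_mul_orbitCount_le h1 fun x e => ?_) ?_
  · have := h3' x
    rw [e] at this
    exact h1 x this
  · let f : Quotient (SameCycle.setoid σ) × Fin 3 → α := fun q => (σ ^ (q.2 : ℕ)) q.1.out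
    have hf : Function.Surjective f := fun x => by
      let q : Quotient (SameCycle.setoid σ) := Quotient.mk _ x
      have hq : σ.SameCycle q.out x := Quotient.exact (Quotient.out_eq q)
      obtain ⟨k, hk⟩ := hq.exists_nat_pow_eq
      refine ⟨(q, ⟨k % 3, Nat.mod_lt _ (by norm_num)⟩), ?_⟩
      have : σ ^ 3 = 1 := by ext x; simp [h3]
      show (σ ^ (k % 3)) q.out = x
      rw [← pow_eq_pow_mod k this, hk]
    have hfin : Finite (Quotient (SameCycle.setoid σ)) := Quotient.finite _
    have := Nat.card_le_card_of_surjective f hf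
    rwa [Nat.card_prod, Nat.card_fin, mul_comm] at this

end Equiv.Perm


/-! ### Counting faces -/

namespace RotationSystem

variable {V : Type*}

open Perm

/-- Face tracing, extended to all ordered pairs of vertices. Since `rot` fixes non-neighbours, a
pair of non-adjacent vertices is reversed. Surgery on the graph leaves the underlying set of this
permutation unchanged. -/
def pairPerm (R : RotationSystem V) : Perm (V × V) where
  toFun p := (p.2, R.rot p.2 p.1)
  invFun p := ((R.rot p.1).symm p.2, p.1)
  left_inv p := by simp
  right_inv p := by simp

theorem pairPerm_apply (R : RotationSystem V) (u v : V) :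
    R.pairPerm (u, v) = (v, R.rot v u) := rfl

theorem adj_rot_iff (R : RotationSystem V) (v w : V) :
    R.graph.Adj v (R.rot v w) ↔ R.graph.Adj v w :=
  (R.rot_cyclic v).apply_mem_iff' w

theorem adj_of_rot_ne (R : RotationSystem V) {v w : V} (h : R.rot v w ≠ w) : R.graph.Adj v w := by
  by_contra h'
  exact h (R.rot_fixed v w h')

theorem pairPerm_adj (R : RotationSystem V) (p : V × V) :
    R.graph.Adj (R.pairPerm p).1 (R.pairPerm p).2 = R.graph.Adj p.1 p.2 := by
  refine propext ⟨fun h => ?_, fun h => ?_⟩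
  · exact ((R.adj_rot_iff p.2 p.1).1 h).symm
  · exact (R.adj_rot_iff p.2 p.1).2 h.symm

theorem facePerm_zpow_toProd (R : RotationSystem V) (k : ℤ) (d : R.graph.Dart) :
    ((R.facePerm ^ k) d).toProd = (R.pairPerm ^ k) d.toProd := by
  induction k using Int.induction_on with
  | zero => rfl
  | succ k ih =>
    rw [add_comm, zpow_one_add, zpow_one_add, mul_apply, mul_apply, ← ih]; rfl
  | pred k ih =>
    rw [sub_eq_neg_add, zpow_add, zpow_add, mul_apply, mul_apply, ← ih, zpow_neg_one, zpow_neg_one]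
    rfl

theorem finite_dart [Finite V] (G : SimpleGraph V) : Finite G.Dart :=
  Finite.of_injective _ SimpleGraph.Dart.toProd_injective

/-- The cycles of `pairPerm` are the faces and the non-adjacent pairs of vertices. -/
theorem orbitCount_pairPerm [Finite V] (R : RotationSystem V) :
    orbitCount R.pairPerm + Nat.card R.graph.edgeSet
      = Nat.card R.Face + Nat.card (Sym2 V) := by
  classical
  have hS : Finite (Sym2 V) := Finite.of_surjective (fun p : V × V => s(p.1, p.2)) Quot.mk_surjective
  have hD := finite_dart R.graph
  have hF : Finite R.Face := Quotient.finite _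
  let f : R.Face ⊕ {e : Sym2 V // e ∉ R.graph.edgeSet} → Quotient (SameCycle.setoid R.pairPerm) :=
    Sum.elim
      (Quotient.lift (fun d => Quotient.mk _ d.toProd) fun d d' h => by
        obtain ⟨k, hk⟩ := (h : R.facePerm.SameCycle d d')
        exact Quotient.sound ⟨k, by rw [← hk, facePerm_zpow_toProd]⟩)
      fun e => Quotient.mk _ e.1.out
  have hout : ∀ e : Sym2 V, s(e.out.1, e.out.2) = e := fun e => Quot.out_eq e
  have hadj : ∀ {p q}, R.pairPerm.SameCycle p q → (R.graph.Adj p.1 p.2 ↔ R.graph.Adj q.1 q.2) :=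
    fun h => iff_of_eq (h.eq_of_invariant (fun p => R.graph.Adj p.1 p.2) R.pairPerm_adj)
  have hnon : ∀ u v, ¬ R.graph.Adj u v → R.pairPerm (u, v) = (v, u) := fun u v h => by
    rw [pairPerm_apply, R.rot_fixed v u fun e => h e.symm]
  have hsame : ∀ {p q}, R.pairPerm.SameCycle p q → ¬ R.graph.Adj p.1 p.2 →
      s(p.1, p.2) = s(q.1, q.2) := fun {p q} h hp => by
    have := h.eq_of_invariant (fun p => if R.graph.Adj p.1 p.2 then none else some s(p.1, p.2))
      (fun p => by
        by_cases hp : R.graph.Adj p.1 p.2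
        · simp only [R.pairPerm_adj, hp, if_true]
        · simp only [R.pairPerm_adj, hp, if_false]
          rw [show p = (p.1, p.2) from rfl, hnon _ _ hp, Sym2.eq_swap])
    simp only [hp, if_false, (hadj h).not.1 hp] at this
    exact Option.some.inj this
  have hf : Function.Bijective f := by
    constructor
    · rintro (q | ⟨e, he⟩) (q' | ⟨e', he'⟩) h
      · obtain ⟨d, rfl⟩ := Quotient.exists_rep q
        obtain ⟨d', rfl⟩ := Quotient.exists_rep q'
        obtain ⟨k, hk⟩ : R.pairPerm.SameCycle d.toProd d'.toProd := Quotient.exact h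
        rw [← facePerm_zpow_toProd] at hk
        exact congrArg Sum.inl (Quotient.sound ⟨k, SimpleGraph.Dart.ext _ _ hk⟩)
      · obtain ⟨d, rfl⟩ := Quotient.exists_rep q
        have h : R.pairPerm.SameCycle d.toProd e'.out := Quotient.exact h
        refine absurd ?_ he'
        rw [← hout e']
        exact (hadj h).1 d.adj
      · obtain ⟨d, rfl⟩ := Quotient.exists_rep q'
        have h : R.pairPerm.SameCycle e.out d.toProd := Quotient.exact h
        refine absurd ?_ he
        rw [← hout e]
        exact (hadj h).2 d.adj
      · have h : R.pairPerm.SameCycle e.out e'.out := Quotient.exact h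
        have := hsame h (by rw [← hout e] at he; exact he)
        rw [hout, hout] at this
        subst this; rfl
    · intro q
      obtain ⟨⟨u, v⟩, rfl⟩ := Quotient.exists_rep q
      by_cases h : R.graph.Adj u v
      · exact ⟨Sum.inl (Quotient.mk _ ⟨(u, v), h⟩), rfl⟩
      · refine ⟨Sum.inr ⟨s(u, v), h⟩, Quotient.sound ?_⟩
        show R.pairPerm.SameCycle (s(u, v)).out (u, v)
        have := hout s(u, v)
        rcases Sym2.eq_iff.1 this with ⟨h1, h2⟩ | ⟨h1, h2⟩
        · rw [show (s(u, v)).out = (u, v) from Prod.ext h1 h2]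
        · rw [show (s(u, v)).out = (v, u) from Prod.ext h1 h2]
          exact ⟨1, by rw [zpow_one, hnon v u fun e => h e.symm]⟩
  have hc := Nat.card_congr (Equiv.ofBijective f hf)
  rw [Nat.card_sum] at hc
  have hE : Nat.card {e : Sym2 V // e ∉ R.graph.edgeSet} + Nat.card R.graph.edgeSet
      = Nat.card (Sym2 V) := by
    rw [add_comm, ← Nat.card_sum]
    exact Nat.card_congr (Equiv.sumCompl (· ∈ R.graph.edgeSet))
  rw [orbitCount, ← hc, ← hE, add_assoc]

/-- Euler's equation in terms of the cycles of `pairPerm`. -/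
theorem hasGenus_iff [Finite V] (R : RotationSystem V) (g : ℕ) :
    R.HasGenus g ↔ R.graph.Connected ∧
      (Nat.card V : ℤ) + orbitCount R.pairPerm - Nat.card (Sym2 V) = 2 - 2 * (g : ℤ) := by
  have := R.orbitCount_pairPerm
  unfold HasGenus
  refine and_congr_right fun _ => ?_
  constructor <;> intro h <;> rw [← h] <;> zify at this <;> linarith

theorem card_dart [Finite V] (G : SimpleGraph V) :
    Nat.card G.Dart = 2 * Nat.card G.edgeSet := by
  classical
  have := Fintype.ofFinite V
  have e := G.dart_card_eq_twice_card_edges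
  rw [SimpleGraph.edgeFinset_card] at e
  rw [Nat.card_eq_fintype_card, Nat.card_eq_fintype_card, e]

theorem facePerm_ne (R : RotationSystem V) (d : R.graph.Dart) : R.facePerm d ≠ d := fun e => by
  have : d.snd = d.fst := congrArg (fun d : R.graph.Dart => d.fst) e
  exact d.adj.ne this.symm

theorem IsTriangular.three_mul_card_face [Finite V] {R : RotationSystem V} (h : R.IsTriangular) :
    3 * Nat.card R.Face = 2 * Nat.card R.graph.edgeSet := by
  have := finite_dart R.graph
  rw [← card_dart]
  exact three_mul_orbitCount R.facePerm_ne h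

theorem three_mul_card_face_le [Finite V] (R : RotationSystem V)
    (h : ∀ u v, R.graph.Adj v u → ∃ u', u' ≠ u ∧ R.graph.Adj v u') :
    3 * Nat.card R.Face ≤ 2 * Nat.card R.graph.edgeSet := by
  have := finite_dart R.graph
  rw [← card_dart]
  refine three_mul_orbitCount_le R.facePerm_ne fun d e => ?_
  have e1 : R.rot d.snd d.fst = d.fst := congrArg (fun d : R.graph.Dart => d.fst) e
  obtain ⟨u', hne, hu'⟩ := h d.fst d.snd d.adj.symm
  obtain ⟨k, hk⟩ := (R.rot_cyclic d.snd).2 d.adj.symm hu'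
  rw [zpow_apply_eq_self_of_apply_eq_self e1] at hk
  exact hne hk.symm

/-! ### Drawing and deleting edges -/

theorem _root_.Fin.sub_one_add_two {n : ℕ} [NeZero n] (i : Fin n) : i - 1 + 2 = i + 1 := by
  have : (2 : Fin n) = 1 + 1 := by
    apply Fin.ext
    rw [Fin.val_add]
    simp
  rw [this, ← add_assoc, sub_add_cancel]

theorem IsFace.rot_apply {R : RotationSystem V} {n : ℕ} [NeZero n] {w : Fin n → V}
    (h : R.IsFace w) (i : Fin n) : R.rot (w i) (w (i - 1)) = w (i + 1) := by
  have := (h.1 (i - 1)).2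
  rwa [sub_add_cancel, Fin.sub_one_add_two] at this

theorem IsFace.adj_pred {R : RotationSystem V} {n : ℕ} [NeZero n] {w : Fin n → V}
    (h : R.IsFace w) (i : Fin n) : R.graph.Adj (w i) (w (i - 1)) := by
  have := (h.1 (i - 1)).1
  rw [sub_add_cancel] at this
  exact this.symm

theorem IsFace.sameCycle {R : RotationSystem V} {n : ℕ} [NeZero n] {w : Fin n → V}
    (h : R.IsFace w) (i j : Fin n) :
    R.pairPerm.SameCycle (w i, w (i + 1)) (w j, w (j + 1)) := by
  have key : ∀ k : ℕ, R.pairPerm.SameCycle (w i, w (i + 1))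
      (w (i + Fin.ofNat n k), w (i + Fin.ofNat n k + 1)) := fun k => by
    induction k with
    | zero =>
      rw [show Fin.ofNat n 0 = 0 from Fin.ext (by simp), add_zero]
    | succ k ih =>
      have e : i + Fin.ofNat n (k + 1) = i + Fin.ofNat n k + 1 := by
        rw [add_assoc]
        congr 1
        apply Fin.ext
        simp [Fin.val_add]
      have e2 := Fin.sub_one_add_two (i + Fin.ofNat n k + 1)
      rw [add_sub_cancel_right] at e2
      refine ih.trans ⟨1, ?_⟩
      rw [zpow_one, pairPerm_apply, (h.1 _).2, e, e2]
  have := key (j - i).val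
  rwa [Fin.ofNat_val_eq_self, add_sub_cancel] at this

theorem not_adj_of_rot_eq {R : RotationSystem V} {v u u' : V}
    (h : R.rot v u = u) (hu' : R.graph.Adj v u') (hne : u' ≠ u) : ¬ R.graph.Adj v u := fun hu => by
  obtain ⟨k, hk⟩ := (R.rot_cyclic v).2 hu hu'
  rw [Perm.zpow_apply_eq_self_of_apply_eq_self h] at hk
  exact hne hk.symm

theorem IsFace.eq_of_sameCycle [Finite V] {R : RotationSystem V} {n : ℕ} [NeZero n] {w : Fin n → V}
    (h : R.IsFace w) {i : Fin n} {z : V × V} (hz : R.pairPerm.SameCycle (w i, w (i + 1)) z) :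
    ∃ j, z = (w j, w (j + 1)) := by
  obtain ⟨k, rfl⟩ := hz.exists_nat_pow_eq
  induction k with
  | zero => exact ⟨i, rfl⟩
  | succ k ih =>
    obtain ⟨j, hj⟩ := ih ⟨k, by simp⟩
    refine ⟨j + 1, ?_⟩
    have e := Fin.sub_one_add_two (j + 1)
    rw [add_sub_cancel_right] at e
    rw [pow_succ', Perm.mul_apply, hj, pairPerm_apply, (h.1 j).2, e]

variable [DecidableEq V]

theorem exists_drawEdge {R : RotationSystem V} {n : ℕ} [NeZero n] {w : Fin n → V} {i j : Fin n}
    (h : R.IsFace w) (hne : w i ≠ w j) (hadj : ¬ R.graph.Adj (w i) (w j)) :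
    ∃ R' : RotationSystem V, R.DrawEdge R' w i j := by
  have cyc : ∀ i j, w i ≠ w j → ¬ R.graph.Adj (w i) (w j) →
      (swap (w j) (w (i + 1)) * R.rot (w i)).IsCycleOn
        ((R.graph ⊔ SimpleGraph.edge (w i) (w j)).neighborSet (w i)) := fun i j hne hadj => by
    have := (R.rot_cyclic (w i)).insert_swap (h.adj_pred i) (R.rot_fixed _ _ hadj) hadj
    rw [h.rot_apply] at this
    convert this using 1
    ext u
    simp only [SimpleGraph.mem_neighborSet, SimpleGraph.sup_adj, SimpleGraph.edge_adj,
      Set.mem_insert_iff]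
    grind
  have fixed : ∀ i j, w i ≠ w j → ¬ R.graph.Adj (w i) (w j) → ∀ u, ¬ R.graph.Adj (w i) u →
      u ≠ w j → (swap (w j) (w (i + 1)) * R.rot (w i)) u = u := fun i j hne hadj u hu huj => by
    rw [mul_apply, R.rot_fixed _ _ hu]
    exact swap_apply_of_ne_of_ne huj fun e => hu (e ▸ (h.1 i).1)
  refine ⟨{
    graph := R.graph ⊔ SimpleGraph.edge (w i) (w j)
    rot := fun v => if v = w i then swap (w j) (w (i + 1)) * R.rot (w i) else
      if v = w j then swap (w i) (w (j + 1)) * R.rot (w j) else R.rot v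
    rot_cyclic := fun v => ?_
    rot_fixed := fun v u hu => ?_ }, h, hne, hadj, rfl, if_pos rfl, ?_, fun z hi hj => ?_⟩
  · split_ifs with hi hj
    · subst hi; exact cyc i j hne hadj
    · subst hj
      rw [SimpleGraph.edge_comm]
      exact cyc j i hne.symm fun e => hadj e.symm
    · convert R.rot_cyclic v using 1
      ext u
      simp [SimpleGraph.edge_adj, hi, hj]
  · simp only [SimpleGraph.sup_adj, SimpleGraph.edge_adj, not_or, not_and] at hu
    split_ifs with hi hj
    · subst hi
      exact fixed i j hne hadj u hu.1 (by grind)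
    · subst hj
      exact fixed j i hne.symm (fun e => hadj e.symm) u hu.1 (by grind)
    · exact R.rot_fixed v u hu.1
  · exact (if_neg hne.symm).trans (if_pos rfl)
  · exact (if_neg hi).trans (if_neg hj)

theorem exists_deleteEdge {R : RotationSystem V} {u v : V} (h : R.graph.Adj u v) :
    ∃ R' : RotationSystem V, R.DeleteEdge R' u v := by
  have cyc : ∀ u v, R.graph.Adj u v → (swap v (R.rot u v) * R.rot u).IsCycleOn
      ((R.graph.deleteEdges {s(u, v)}).neighborSet u) := fun u v h => by
    have := (R.rot_cyclic u).erase_swap h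
    convert this using 1
    ext z
    simp only [SimpleGraph.mem_neighborSet, SimpleGraph.deleteEdges_adj, Set.mem_sdiff,
      Set.mem_singleton_iff, Sym2.eq_iff]
    have := h.ne
    grind
  have fixed : ∀ u v z, R.graph.Adj u v → (¬ R.graph.Adj u z ∨ z = v) →
      (swap v (R.rot u v) * R.rot u) z = z := by
    rintro u v z h (hz | rfl)
    · rw [mul_apply, R.rot_fixed _ _ hz]
      exact swap_apply_of_ne_of_ne (fun e => hz (e ▸ h)) fun e => hz (e ▸ R.adj_rot h)
    · simp
  have hne := h.ne
  refine ⟨{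
    graph := R.graph.deleteEdges {s(u, v)}
    rot := fun z => if z = u then swap v (R.rot u v) * R.rot u else
      if z = v then swap u (R.rot v u) * R.rot v else R.rot z
    rot_cyclic := fun z => ?_
    rot_fixed := fun z y hy => ?_ }, h, rfl, if_pos rfl, ?_, fun z hu hv => ?_⟩
  · split_ifs with hi hj
    · subst hi; exact cyc z v h
    · subst hj
      rw [Sym2.eq_swap]
      exact cyc z u h.symm
    · convert R.rot_cyclic z using 1
      ext y
      simp [hi, hj]
  · simp only [SimpleGraph.deleteEdges_adj, Set.mem_singleton_iff, Sym2.eq_iff] at hy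
    split_ifs with hi hj
    · subst hi
      exact fixed z v y h (by grind)
    · subst hj
      exact fixed z u y h.symm (by grind)
    · exact R.rot_fixed z y (by grind)
  · exact (if_neg hne.symm).trans (if_pos rfl)
  · exact (if_neg hu).trans (if_neg hv)

theorem DrawEdge.pairPerm_eq {R R' : RotationSystem V} {n : ℕ} [NeZero n] {w : Fin n → V}
    {i j : Fin n} (h : R.DrawEdge R' w i j) :
    R'.pairPerm = swap (w i, w j) (w i, w (i + 1)) *
      (swap (w j, w i) (w j, w (j + 1)) * R.pairPerm) := by
  obtain ⟨-, hne, -, -, hi, hj, ho⟩ := h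
  have hs : ∀ a b c d : V, swap (a, b) (a, c) (a, d) = (a, swap b c d) := fun a b c d => by
    simp only [swap_apply_def, Prod.mk.injEq, true_and]
    split_ifs <;> rfl
  have hs' : ∀ a b c a' d : V, a' ≠ a → swap (a, b) (a, c) (a', d) = (a', d) :=
    fun a b c a' d h => swap_apply_of_ne_of_ne (by simp [h]) (by simp [h])
  ext1 ⟨u, v⟩
  rw [mul_apply, mul_apply, pairPerm_apply, pairPerm_apply]
  by_cases h1 : v = w i
  · subst h1
    rw [hs' _ _ _ _ _ hne, hs, hi, mul_apply]
  by_cases h2 : v = w j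
  · subst h2
    rw [hs, hs' _ _ _ _ _ hne.symm, hj, mul_apply]
  · rw [hs' _ _ _ _ _ h2, hs' _ _ _ _ _ h1, ho v h1 h2]

/-- An edge drawn inside a face splits this face, and removes a pair of non-adjacent vertices. -/
theorem DrawEdge.orbitCount_eq [Finite V] {R R' : RotationSystem V} {n : ℕ} [NeZero n]
    {w : Fin n → V} {i j : Fin n} (h : R.DrawEdge R' w i j) :
    orbitCount R'.pairPerm = orbitCount R.pairPerm := by
  rw [h.pairPerm_eq]
  obtain ⟨hf, hne, hadj, -⟩ := h
  have h1 : ¬ R.pairPerm.SameCycle (w j, w i) (w j, w (j + 1)) := fun e => by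
    have := e.eq_of_invariant (fun p => R.graph.Adj p.1 p.2) R.pairPerm_adj
    exact hadj (this.mpr (hf.1 j).1).symm
  set σ := swap (w j, w i) (w j, w (j + 1)) * R.pairPerm with hσ
  have h2 : σ.SameCycle (w i, w j) (w i, w (i + 1)) := by
    have e1 : σ.SameCycle (w i, w j) (w j, w (j + 1)) := ⟨1, by
      rw [zpow_one, hσ, mul_apply, pairPerm_apply, R.rot_fixed _ _ fun e => hadj e.symm,
        swap_apply_left]⟩
    exact e1.trans ((hf.sameCycle j i).swap_mul h1)
  have h3 : orbitCount σ + 1 = _ := orbitCount_swap_mul_of_not_sameCycle h1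
  have h4 := orbitCount_swap_mul_of_sameCycle (σ := σ) (a := (w i, w j)) (b := (w i, w (i + 1)))
    (fun e => hadj (by rw [(Prod.mk.inj e).2]; exact (hf.1 i).1)) h2
  omega

/-- An edge flip does not change the genus: the deleted edge and the new one are both diagonals of
the same quadrangle, and drawing either of them preserves the number of cycles. -/
theorem EdgeFlip.orbitCount_eq [Finite V] {R R' : RotationSystem V} {e f : Sym2 V}
    (h : R.EdgeFlip R' e f) : orbitCount R'.pairPerm = orbitCount R.pairPerm := by
  obtain ⟨u, v, p, q, -, -, hp, hq, M, hM, hd⟩ := h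
  rw [hd.orbitCount_eq]
  -- the deleted edge can be drawn again in the quadrangle that it left
  have back : M.DrawEdge R ![u, q, v, p] 0 2 := by
    obtain ⟨h1, h2, h3, h4, h5⟩ := hM
    have hv : R.rot u v = q := (hq.1 0).2
    have hu : R.rot v u = p := (hp.1 0).2
    refine ⟨hd.1, h1.ne, ?_, ?_, ?_, ?_, fun z hu hv => (h5 z hu hv).symm⟩
    · rw [h2]; simp
    · rw [h2]
      ext a b
      simp only [SimpleGraph.sup_adj, SimpleGraph.deleteEdges_adj, SimpleGraph.edge_adj,
        Set.mem_singleton_iff, Sym2.eq_iff]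
      show _ ↔ _ ∨ ((a = u ∧ b = v ∨ a = v ∧ b = u) ∧ a ≠ b)
      have := h1.symm
      have := h1.ne
      grind
    · show R.rot u = swap v q * M.rot u
      rw [h3, hv, ← mul_assoc, swap_mul_self, one_mul]
    · show R.rot v = swap u p * M.rot v
      rw [h4, hu, ← mul_assoc, swap_mul_self, one_mul]
  exact back.orbitCount_eq.symm

end RotationSystem


/-! ### Surgery on finitely many named vertices -/

theorem comp_vecCons {α β : Type*} {n : ℕ} (f : α → β) (a : α) (w : Fin n → α) :
    f ∘ Matrix.vecCons a w = Matrix.vecCons (f a) (f ∘ w) :=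
  funext (Fin.cases rfl fun _ => rfl)

theorem comp_vecEmpty {α β : Type*} (f : α → β) : f ∘ ![] = ![] :=
  Subsingleton.elim _ _

/-- A finite amount of information on a rotation system: `T v u = some w` says that `w` comes after
`u` in the rotation at `v`. -/
abbrev CornerTable (P : Type*) : Type _ := P → P → Option P

namespace CornerTable

variable {P V : Type*}

/-- The table holds for the rotation system `R`, when the names in `P` are interpreted by `ι`. -/
def Agrees (T : CornerTable P) (ι : P → V) (R : RotationSystem V) : Prop :=
  ∀ v u w, T v u = some w → R.rot (ι v) (ι u) = ι w

/-- The walk `w` is a face according to the table. That consecutive vertices are adjacent follows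
from `w i ≠ w (i + 2)`, since non-neighbours are fixed by the rotation. -/
def IsFace (T : CornerTable P) {n : ℕ} [NeZero n] (w : Fin n → P) : Prop :=
  (∀ i, T (w (i + 1)) (w i) = some (w (i + 2)) ∧ w i ≠ w (i + 2)) ∧
    Function.Injective fun i => (w i, w (i + 1))

instance [DecidableEq P] (T : CornerTable P) {n : ℕ} [NeZero n] (w : Fin n → P) :
    Decidable (T.IsFace w) :=
  inferInstanceAs (Decidable (_ ∧ _))

variable {ι : P → V}

theorem IsFace.isFace {T : CornerTable P} {R : RotationSystem V} (hι : Function.Injective ι)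
    (h : T.Agrees ι R) {n : ℕ} [NeZero n] {w : Fin n → P} (hw : T.IsFace w) :
    R.IsFace (ι ∘ w) := by
  refine ⟨fun i => ?_, fun i j e => hw.2 ?_⟩
  · have h1 := h _ _ _ (hw.1 i).1
    refine ⟨(R.adj_of_rot_ne (w := ι (w i)) ?_).symm, h1⟩
    show R.rot (ι (w (i + 1))) (ι (w i)) ≠ ι (w i)
    rw [h1]
    exact fun e => (hw.1 i).2 (hι e).symm
  · have e := Prod.mk.inj e
    exact Prod.ext (hι e.1) (hι e.2)

variable [DecidableEq P]

/-- The rotation at `a` is composed with the swap of `b` and `c`. -/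
def swapAt (T : CornerTable P) (a b c : P) : CornerTable P := fun v u =>
  if v = a then (T v u).map (swap b c) else T v u

variable [DecidableEq V]

theorem Agrees.congr_swap {T : CornerTable P} (hι : Function.Injective ι) {σ : Perm V}
    {v b c : P} {R : RotationSystem V} (h : T.Agrees ι R) (hσ : σ = swap (ι b) (ι c) * R.rot (ι v))
    {u w : P} (hw : (T v u).map (swap b c) = some w) : σ (ι u) = ι w := by
  obtain ⟨w', hw', rfl⟩ := Option.map_eq_some_iff.1 hw
  rw [hσ, Perm.mul_apply, h _ _ _ hw', hι.swap_apply]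

/-- The rotations at two vertices are composed with a swap, the others stay the same. -/
theorem Agrees.of_swaps {T : CornerTable P} (hι : Function.Injective ι) {R R' : RotationSystem V}
    (h : T.Agrees ι R) {a b c a' b' c' : P} (ha : a ≠ a')
    (h1 : R'.rot (ι a) = swap (ι b) (ι c) * R.rot (ι a))
    (h2 : R'.rot (ι a') = swap (ι b') (ι c') * R.rot (ι a'))
    (h3 : ∀ z, z ≠ ι a → z ≠ ι a' → R'.rot z = R.rot z) :
    ((T.swapAt a b c).swapAt a' b' c').Agrees ι R' := by
  intro v u w hw
  unfold swapAt at hw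
  by_cases hv' : v = a'
  · subst hv'
    rw [if_pos rfl, if_neg ha.symm] at hw
    exact h.congr_swap hι h2 hw
  · rw [if_neg hv'] at hw
    by_cases hv : v = a
    · subst hv
      rw [if_pos rfl] at hw
      exact h.congr_swap hι h1 hw
    · rw [if_neg hv] at hw
      rw [h3 _ (hι.ne hv) (hι.ne hv')]
      exact h _ _ _ hw

/-- The effect of drawing an edge. -/
def draw (T : CornerTable P) {n : ℕ} [NeZero n] (w : Fin n → P) (i j : Fin n) : CornerTable P :=
  (T.swapAt (w i) (w j) (w (i + 1))).swapAt (w j) (w i) (w (j + 1))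

/-- The table allows drawing an edge between the corners `i` and `j` of the face `w`. -/
def CanDraw (T : CornerTable P) {n : ℕ} [NeZero n] (w : Fin n → P) (i j : Fin n) : Prop :=
  T.IsFace w ∧ w i ≠ w j ∧ T (w i) (w j) = some (w j) ∧ w (i + 1) ≠ w j

instance (T : CornerTable P) {n : ℕ} [NeZero n] (w : Fin n → P) (i j : Fin n) :
    Decidable (T.CanDraw w i j) :=
  inferInstanceAs (Decidable (_ ∧ _))

theorem CanDraw.exists_drawEdge {T : CornerTable P} {R : RotationSystem V}
    (hι : Function.Injective ι) (h : T.Agrees ι R) {n : ℕ} [NeZero n] {w : Fin n → P} {i j : Fin n}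
    (hw : T.CanDraw w i j) :
    ∃ R', R.DrawEdge R' (ι ∘ w) i j ∧ (T.draw w i j).Agrees ι R' := by
  obtain ⟨hf, hne, hij, hij'⟩ := hw
  have hF := hf.isFace hι h
  have hadj : ¬ R.graph.Adj (ι (w i)) (ι (w j)) :=
    RotationSystem.not_adj_of_rot_eq (h _ _ _ hij) (hF.1 i).1 (hι.ne hij')
  obtain ⟨R', hR'⟩ := RotationSystem.exists_drawEdge hF (hι.ne hne) hadj
  exact ⟨R', hR', h.of_swaps hι hne hR'.2.2.2.2.1 hR'.2.2.2.2.2.1 hR'.2.2.2.2.2.2⟩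

/-- The effect of deleting the edge `uv` between the faces `[u, v, p]` and `[v, u, q]`. -/
def delete (T : CornerTable P) (u v p q : P) : CornerTable P :=
  (T.swapAt u v q).swapAt v u p

/-- The effect of flipping the edge `uv` to `pq`. -/
def flip (T : CornerTable P) (u v p q : P) : CornerTable P :=
  (T.delete u v p q).draw ![u, q, v, p] 1 3

/-- The table allows flipping the edge `uv` to `pq`. -/
def CanFlip (T : CornerTable P) (u v p q : P) : Prop :=
  T.IsFace ![u, v, p] ∧ T.IsFace ![v, u, q] ∧ (T.delete u v p q).CanDraw ![u, q, v, p] 1 3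

instance (T : CornerTable P) (u v p q : P) : Decidable (T.CanFlip u v p q) :=
  inferInstanceAs (Decidable (_ ∧ _))

theorem CanFlip.exists_edgeFlip {T : CornerTable P} {R : RotationSystem V}
    (hι : Function.Injective ι) (h : T.Agrees ι R) {u v p q : P} (hT : T.CanFlip u v p q)
    {e f : Sym2 V} (he : s(ι u, ι v) = e) (hf : s(ι p, ι q) = f) :
    ∃ R', R.EdgeFlip R' e f ∧ (T.flip u v p q).Agrees ι R' ∧
      (∀ x y, R'.graph.Adj x y ↔ (R.graph.Adj x y ∧ s(x, y) ≠ e) ∨ s(x, y) = f) ∧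
      (u ≠ p → u ≠ q → R'.rot (ι u) = swap (ι v) (ι q) * R.rot (ι u)) ∧
      (∀ z, z ≠ ι u → z ≠ ι v → z ≠ ι p → z ≠ ι q → R'.rot z = R.rot z) := by
  subst he hf
  obtain ⟨h1, h2, h3⟩ := hT
  have f1 := h1.isFace hι h
  have f2 := h2.isFace hι h
  have huv : R.graph.Adj (ι u) (ι v) := (f1.1 0).1
  have hvu : R.rot (ι v) (ι u) = ι p := (f1.1 0).2
  have huv' : R.rot (ι u) (ι v) = ι q := (f2.1 0).2
  obtain ⟨M, hM⟩ := RotationSystem.exists_deleteEdge huv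
  obtain ⟨-, hG, hu, hv, ho⟩ := id hM
  rw [huv'] at hu
  rw [hvu] at hv
  have hMT : (T.delete u v p q).Agrees ι M :=
    h.of_swaps hι (fun e => huv.ne (congrArg ι e)) hu hv ho
  obtain ⟨R', hR', hT'⟩ := h3.exists_drawEdge hι hMT
  rw [comp_vecCons, comp_vecCons, comp_vecCons, comp_vecCons, comp_vecEmpty] at hR'
  rw [comp_vecCons, comp_vecCons, comp_vecCons, comp_vecEmpty] at f1 f2
  refine ⟨R', ⟨ι u, ι v, ι p, ι q, rfl, rfl, f1, f2, M, hM, hR'⟩, hT', fun x y => ?_,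
    fun hup huq => ?_, fun z h1 h2 h3 h4 => ?_⟩
  · obtain ⟨-, hne, -, hG', -⟩ := hR'
    replace hne : ι q ≠ ι p := hne
    rw [hG', hG]
    simp only [SimpleGraph.sup_adj, SimpleGraph.deleteEdges_adj, SimpleGraph.edge_adj,
      Set.mem_singleton_iff, Sym2.eq_iff]
    show _ ∨ ((x = ι q ∧ y = ι p ∨ x = ι p ∧ y = ι q) ∧ x ≠ y) ↔ _
    grind
  · rw [hR'.2.2.2.2.2.2 (ι u) (hι.ne huq) (hι.ne hup), hu]
  · rw [hR'.2.2.2.2.2.2 z h4 h3, ho z h1 h2]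

end CornerTable

namespace RotationSystem

variable {V : Type*} [DecidableEq V]

theorem DrawEdge.adj_iff {R R' : RotationSystem V} {n : ℕ} [NeZero n] {w : Fin n → V} {i j : Fin n}
    (h : R.DrawEdge R' w i j) (x y : V) :
    R'.graph.Adj x y ↔ R.graph.Adj x y ∨ s(x, y) = s(w i, w j) := by
  obtain ⟨-, hne, -, hG, -⟩ := h
  rw [hG]
  simp only [SimpleGraph.sup_adj, SimpleGraph.edge_adj, Sym2.eq_iff]
  grind

/-- If `τ` differs from the cycle `σ` only at elements of `B`, every element of the cycle is
connected by `τ` to an element of `B`, and a label that only changes after elements of `B`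
determines which one. -/
theorem exists_sameCycle_of_label {α β : Type*} [Finite α] {σ τ : Perm α} {A B : Set α}
    (hσ : σ.IsCycleOn A) {t : α} (htA : t ∈ A) (htB : t ∈ B) (hτ : ∀ v, v ∉ B → τ v = σ v)
    (f : α → β) (hf : ∀ v, v ∉ B → f (σ v) = f v) {v : α} (hv : v ∈ A) :
    ∃ b ∈ B, τ.SameCycle v b ∧ f b = f v := by
  obtain ⟨k, hk⟩ := (hσ.2 hv htA).exists_nat_pow_eq
  clear hv
  induction k generalizing v with
  | zero => exact ⟨t, htB, by rw [← hk]; exact Perm.SameCycle.refl _ _, by rw [← hk]; rfl⟩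
  | succ k ih =>
    by_cases hvB : v ∈ B
    · exact ⟨v, hvB, Perm.SameCycle.refl _ _, rfl⟩
    · obtain ⟨b, hb, h1, h2⟩ := ih (v := σ v) (by rw [← hk, pow_succ, Perm.mul_apply])
      refine ⟨b, hb, Perm.SameCycle.trans ⟨1, ?_⟩ h1, h2.trans (hf v hvB)⟩
      rw [zpow_one, hτ v hvB]

end RotationSystem


/-! ### Completing the triangular embedding -/

instance : Fintype Letter :=
  ⟨{.a, .b, .c, .x, .y}, fun z => by cases z <;> decide⟩

/-- Names of the vertices that take part in the completion: the numbered vertices `0`, `γ`, `-γ`,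
`2ε`, `-δ`, `-ε`, `γ + ε`, `γ + 2ε`, `-γ - δ`, `-γ + δ`, and the letters. -/
inductive Pt
  | o | g | mg | e2 | md | me | ge | ge2 | p | q | a | b | c | x | y
  deriving DecidableEq

namespace Pt

/-- The vertex with a given name. -/
def toVert {s : ℕ} (γ δ ε : ZMod (12 * s + 6)) : Pt → Vert s
  | o => num 0
  | g => num γ
  | mg => num (-γ)
  | e2 => num (2 * ε)
  | md => num (-δ)
  | me => num (-ε)
  | ge => num (γ + ε)
  | ge2 => num (γ + 2 * ε)
  | p => num (-γ - δ)
  | q => num (-γ + δ)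
  | a => letter .a
  | b => letter .b
  | c => letter .c
  | x => letter .x
  | y => letter .y

/-- Whether the vertex is a letter. -/
def isLetter : Pt → Bool
  | a | b | c | x | y => true
  | _ => false

/-- The corners of the derived embedding that the completion uses. Letters are not adjacent. -/
def derivedTable : CornerTable Pt
  | .o, .g => some .c | .o, .e2 => some .a | .o, .me => some .b | .o, .q => some .p
  | .o, .b => some .mg | .o, .x => some .md | .o, .y => some .me
  | .g, .ge2 => some .b | .g, .b => some .ge | .g, .c => some .o
  | .mg, .o => some .b | .mg, .q => some .x | .mg, .x => some .p
  | .e2, .a => some .o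
  | .md, .o => some .x
  | .me, .o => some .y | .me, .p => some .q | .me, .b => some .o
  | .ge, .g => some .b | .ge, .ge2 => some .y | .ge, .a => some .ge2
  | .ge2, .ge => some .a | .ge2, .b => some .g | .ge2, .y => some .ge
  | .p, .o => some .q | .p, .mg => some .x | .p, .q => some .me
  | .q, .me => some .p | .q, .p => some .o | .q, .x => some .mg
  | .a, .o => some .e2 | .a, .ge2 => some .ge
  | .b, .o => some .me | .b, .g => some .ge2 | .b, .mg => some .o | .b, .ge => some .g
  | .c, .o => some .g
  | .x, .mg => some .q | .x, .md => some .o | .x, .p => some .mg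
  | .y, .me => some .o | .y, .ge => some .ge2
  | v, u => if v.isLetter ∧ u.isLetter then some u else none

/-- The corners after the initial flips. -/
def flippedTable : CornerTable Pt :=
  ((derivedTable.flip ge ge2 a y).flip g b ge2 ge).flip o me y b

/-- The corners after the handle modification, whose effect at `0` is composition with the cycle
`(-γ a c b -δ)`. -/
def handleTable : CornerTable Pt :=
  (((flippedTable.swapAt o md b).swapAt o b c).swapAt o c a).swapAt o a mg

/-- The corners after drawing nine edges in the 15-sided face. -/
def filledTable : CornerTable Pt :=
  ((((((((handleTable.draw ![o, c, g, o, b, y, o, md, x, o, mg, b, o, a, e2] 1 13).draw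
    ![c, g, o, b, y, o, md, x, o, mg, b, o, a] 4 7).draw
    ![c, g, o, b, y, x, o, mg, b, o, a] 5 8).draw
    ![c, g, o, b, y, x, b, o, a] 1 3).draw
    ![c, g, b, y, x, b, o, a] 5 7).draw
    ![c, g, b, y, x, b, a] 4 6).draw
    ![c, g, b, y, x, a] 4 0).draw
    ![c, g, b, y, x] 0 3).draw
    ![c, g, b, y] 0 2

end Pt

namespace RotationSystem

open Pt CornerTable

variable {s : ℕ} {γ δ ε : ZMod (12 * s + 6)}

local notation "ι" => Pt.toVert γ δ ε

/-- The edge flips before the handle modification exist and lead to `flippedTable`. -/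
theorem exists_initial_flips (hι : Function.Injective (ι)) {R : RotationSystem (Vert s)}
    (hR : derivedTable.Agrees (ι) R) :
    ∃ M R' : RotationSystem (Vert s),
      R.FlipSequence M
        [s(num γ, letter .b), s(num (γ + 2 * ε), num (γ + ε)), s(letter .a, letter .y)] ∧
      M.FlipSequence R' [s(num 0, num (-ε)), s(letter .b, letter .y)] ∧
      flippedTable.Agrees (ι) R' ∧
      Perm.orbitCount R'.pairPerm = Perm.orbitCount R.pairPerm ∧
      R'.rot (num 0) = swap (num (-ε)) (letter .b) * R.rot (num 0) ∧
      ∀ u v, R'.graph.Adj u v ↔ (((R.graph.Adj u v ∧ s(u, v) ≠ s(ι ge, ι ge2) ∨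
        s(u, v) = s(ι a, ι y)) ∧ s(u, v) ≠ s(ι g, ι b) ∨ s(u, v) = s(ι ge2, ι ge)) ∧
        s(u, v) ≠ s(ι o, ι me) ∨ s(u, v) = s(ι y, ι b)) := by
  have c1 : derivedTable.CanFlip ge ge2 a y := by decide +kernel
  have c2 : (derivedTable.flip ge ge2 a y).CanFlip g b ge2 ge := by decide +kernel
  have c3 : ((derivedTable.flip ge ge2 a y).flip g b ge2 ge).CanFlip o me y b := by
    decide +kernel
  obtain ⟨M₁, f1, t1, g1, -, r1⟩ := c1.exists_edgeFlip hι hR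
    (e := s(num (γ + 2 * ε), num (γ + ε))) (f := s(letter .a, letter .y)) Sym2.eq_swap rfl
  obtain ⟨M₂, f2, t2, g2, -, r2⟩ := c2.exists_edgeFlip hι t1
    (e := s(num γ, letter .b)) (f := s(num (γ + 2 * ε), num (γ + ε))) rfl rfl
  obtain ⟨M₃, f3, t3, g3, r3, -⟩ := c3.exists_edgeFlip hι t2
    (e := s(num 0, num (-ε))) (f := s(letter .b, letter .y)) rfl Sym2.eq_swap
  have e1 : M₁.rot (ι o) = R.rot (ι o) := by
    apply r1 <;> exact hι.ne (by decide)
  have e2 : M₂.rot (ι o) = M₁.rot (ι o) := by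
    apply r2 <;> exact hι.ne (by decide)
  refine ⟨M₂, M₃, ⟨M₁, ⟨R, rfl, f1⟩, f2⟩, ⟨M₂, rfl, f3⟩, t3, ?_, ?_, fun u v => ?_⟩
  · rw [f3.orbitCount_eq, f2.orbitCount_eq, f1.orbitCount_eq]
  · rw [e1] at e2
    exact (r3 (by decide) (by decide)).trans (congrArg (_ * ·) e2)
  · rw [g3, g2, g1, Sym2.eq_swap (a := ι ge), Sym2.eq_swap (a := ι y)]
    rfl

/-- The handle modification is possible if the vertices in the rotation at `0` can be labeled by
`0, …, 4` in such a way that the label changes only after `b`, `γ`, `x`, `2ε`, `y`. -/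
theorem exists_handleModification (hι : Function.Injective (ι)) {R : RotationSystem (Vert s)}
    (hR : flippedTable.Agrees (ι) R) (f : Vert s → Fin 5)
    (hf : ∀ v, v ≠ ι b → v ≠ ι g → v ≠ ι x → v ≠ ι e2 → v ≠ ι y → f (R.rot (ι o) v) = f v)
    (hmg : f (ι mg) = 0) (hg : f (ι g) = 0) (hc : f (ι c) = 1) (hx : f (ι x) = 1)
    (hmd : f (ι md) = 2) (he2 : f (ι e2) = 2) (hy : f (ι y) = 3) :
    ∃ R' : RotationSystem (Vert s), HandleModification R R' γ δ ε ∧ handleTable.Agrees (ι) R' ∧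
      Perm.orbitCount R'.pairPerm + 4 = Perm.orbitCount R.pairPerm := by
  have F : ∀ {n : ℕ} [NeZero n] (w : Fin n → Pt), flippedTable.IsFace w → R.IsFace (ι ∘ w) :=
    fun w hw => hw.isFace hι hR
  have f1 := F ![o, c, g] (by decide +kernel)
  have f2 := F ![o, b, y] (by decide +kernel)
  have f3 := F ![o, md, x] (by decide +kernel)
  have f4 := F ![o, mg, b] (by decide +kernel)
  have f5 := F ![o, a, e2] (by decide +kernel)
  have rb : R.rot (ι o) (ι b) = ι mg := hR o b mg (by decide +kernel)
  have rg : R.rot (ι o) (ι g) = ι c := hR o g c (by decide +kernel)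
  have rx : R.rot (ι o) (ι x) = ι md := hR o x md (by decide +kernel)
  have re2 : R.rot (ι o) (ι e2) = ι a := hR o e2 a (by decide +kernel)
  have ry : R.rot (ι o) (ι y) = ι b := hR o y b (by decide +kernel)
  set σ := R.rot (ι o) with hσ
  set κ : Perm (Vert s) := Perm.swapChain [ι md, ι b, ι c, ι a, ι mg] with hκ
  have hκ' : κ = swap (ι a) (ι mg) * (swap (ι c) (ι a) * (swap (ι b) (ι c) * swap (ι md) (ι b))) := by
    simp [hκ, Perm.swapChain, mul_assoc]
  have kap : ∀ u : Pt, κ (ι u) = ι ((swap a mg * (swap c a * (swap b c * swap md b)) : Perm Pt) u) :=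
    fun u => by simp only [hκ', Perm.mul_apply, hι.swap_apply]
  have tb : (κ * σ) (ι b) = ι a := by rw [Perm.mul_apply, rb, kap]; rfl
  have tg : (κ * σ) (ι g) = ι b := by rw [Perm.mul_apply, rg, kap]; rfl
  have tx : (κ * σ) (ι x) = ι mg := by rw [Perm.mul_apply, rx, kap]; rfl
  have te2 : (κ * σ) (ι e2) = ι c := by rw [Perm.mul_apply, re2, kap]; rfl
  have ty : (κ * σ) (ι y) = ι md := by rw [Perm.mul_apply, ry, kap]; rfl
  have toff : ∀ v, v ≠ ι b → v ≠ ι y → v ≠ ι e2 → v ≠ ι x → v ≠ ι g → (κ * σ) v = σ v := by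
    intro v h1 h2 h3 h4 h5
    have n1 : σ v ≠ ι mg := fun e => h1 (σ.injective (e.trans rb.symm))
    have n2 : σ v ≠ ι b := fun e => h2 (σ.injective (e.trans ry.symm))
    have n3 : σ v ≠ ι a := fun e => h3 (σ.injective (e.trans re2.symm))
    have n4 : σ v ≠ ι md := fun e => h4 (σ.injective (e.trans rx.symm))
    have n5 : σ v ≠ ι c := fun e => h5 (σ.injective (e.trans rg.symm))
    rw [hκ', Perm.mul_apply, Perm.mul_apply, Perm.mul_apply, Perm.mul_apply,
      swap_apply_of_ne_of_ne n4 n2, swap_apply_of_ne_of_ne n2 n5, swap_apply_of_ne_of_ne n5 n3,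
      swap_apply_of_ne_of_ne n3 n1]
  have adj : ∀ {u v : Pt}, σ (ι u) = ι v → u ≠ v → R.graph.Adj (ι o) (ι u) := fun {u v} h hne =>
    R.adj_of_rot_ne (by rw [← hσ, h]; exact hι.ne hne.symm)
  have ab := adj rb (by decide)
  have key : ∀ v, R.graph.Adj (ι o) v → (κ * σ).SameCycle v (ι b) := by
    have one : ∀ {v w}, (κ * σ) v = w → (κ * σ).SameCycle v w := fun h => ⟨1, by rw [zpow_one, h]⟩
    -- every element is followed, within its part of the rotation, by the end of that part
    have ex : ∀ v, R.graph.Adj (ι o) v →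
        (f v = 0 ∧ (κ * σ).SameCycle v (ι g)) ∨ (f v = 1 ∧ (κ * σ).SameCycle v (ι x)) ∨
        (f v = 2 ∧ (κ * σ).SameCycle v (ι e2)) ∨ (f v = 3 ∧ (κ * σ).SameCycle v (ι y)) ∨
        (κ * σ).SameCycle v (ι b) := fun v hv => by
      obtain ⟨t, ht, h1, h2⟩ := exists_sameCycle_of_label (τ := κ * σ)
        (B := {ι b, ι g, ι x, ι e2, ι y}) (R.rot_cyclic (ι o)) ab (by simp)
        (fun v hv => by
          simp only [Set.mem_insert_iff, Set.mem_singleton_iff, not_or] at hv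
          exact toff v hv.1 hv.2.2.2.2 hv.2.2.2.1 hv.2.2.1 hv.2.1) f
        (fun v hv => by
          simp only [Set.mem_insert_iff, Set.mem_singleton_iff, not_or] at hv
          exact hf v hv.1 hv.2.1 hv.2.2.1 hv.2.2.2.1 hv.2.2.2.2) hv
      simp only [Set.mem_insert_iff, Set.mem_singleton_iff] at ht
      rcases ht with rfl | rfl | rfl | rfl | rfl
      · exact Or.inr (Or.inr (Or.inr (Or.inr h1)))
      · exact Or.inl ⟨h2.symm.trans hg, h1⟩
      · exact Or.inr (Or.inl ⟨h2.symm.trans hx, h1⟩)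
      · exact Or.inr (Or.inr (Or.inl ⟨h2.symm.trans he2, h1⟩))
      · exact Or.inr (Or.inr (Or.inr (Or.inl ⟨h2.symm.trans hy, h1⟩)))
    have adj' : ∀ {u v : Pt}, σ (ι u) = ι v → u ≠ v → R.graph.Adj (ι o) (ι v) := fun h hne => by
      rw [← h]
      exact R.adj_rot (adj h hne)
    have sg : (κ * σ).SameCycle (ι g) (ι b) := one tg
    have smg := ex _ (adj' rb (by decide))
    have sc := ex _ (adj' rg (by decide))
    have smd := ex _ (adj' rx (by decide))
    simp only [hmg, hc, hmd, true_and, Fin.reduceEq, false_and, false_or,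
      zero_ne_one, one_ne_zero] at smg sc smd
    have s1 : (κ * σ).SameCycle (ι x) (ι b) :=
      (one tx).trans (smg.elim (fun h => h.trans sg) id)
    have s2 : (κ * σ).SameCycle (ι e2) (ι b) :=
      (one te2).trans (sc.elim (fun h => h.trans s1) id)
    have s3 : (κ * σ).SameCycle (ι y) (ι b) :=
      (one ty).trans (smd.elim (fun h => h.trans s2) id)
    intro v hv
    rcases ex v hv with h | h | h | h | h
    · exact h.2.trans sg
    · exact h.2.trans s1
    · exact h.2.trans s2
    · exact h.2.trans s3
    · exact h
  have kmem : ∀ v, ¬ R.graph.Adj (ι o) v → κ v = v := fun v hv => by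
    have h1 : ∀ {u w : Pt}, σ (ι u) = ι w → u ≠ w → v ≠ ι w := fun h hne e => hv (by
      rw [e, ← h]
      exact R.adj_rot (adj h hne))
    rw [hκ', Perm.mul_apply, Perm.mul_apply, Perm.mul_apply,
      swap_apply_of_ne_of_ne (h1 rx (by decide)) (h1 ry (by decide)),
      swap_apply_of_ne_of_ne (h1 ry (by decide)) (h1 rg (by decide)),
      swap_apply_of_ne_of_ne (h1 rg (by decide)) (h1 re2 (by decide)),
      swap_apply_of_ne_of_ne (h1 re2 (by decide)) (h1 rb (by decide))]
  have tfix : ∀ v, ¬ R.graph.Adj (ι o) v → (κ * σ) v = v := fun v hv => by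
    rw [Perm.mul_apply, hσ, R.rot_fixed _ _ hv, kmem v hv]
  let R' : RotationSystem (Vert s) :=
    { graph := R.graph
      rot := fun v => if v = ι o then κ * σ else R.rot v
      rot_cyclic := fun v => by
        split_ifs with h
        · subst h
          refine Perm.isCycleOn_of (fun v => ?_)
            (fun v hv w hw => (key v hv).trans (key w hw).symm)
          by_cases hv : R.graph.Adj (ι o) v
          · refine iff_of_true ?_ hv
            by_contra h'
            exact h' (by rwa [(κ * σ).injective (tfix _ h')])
          · rw [tfix v hv]
        · exact R.rot_cyclic v
      rot_fixed := fun v w h => by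
        split_ifs with hv
        · subst hv; exact tfix w h
        · exact R.rot_fixed v w h }
  have ro : R'.rot (ι o) = κ * σ := by simp [R']
  have rne : ∀ v, v ≠ ι o → R'.rot v = R.rot v := fun v hv => by simp [R', hv]
  have hT : handleTable.Agrees (ι) R' := by
    intro v u w hw
    by_cases hv : v = o
    · subst hv
      rw [ro]
      unfold handleTable swapAt at hw
      simp only [if_true, Option.map_map] at hw
      obtain ⟨w', hw', rfl⟩ := Option.map_eq_some_iff.1 hw
      rw [Perm.mul_apply, hσ, hR _ _ _ hw', kap]
      rfl
    · rw [rne _ (hι.ne hv)]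
      unfold handleTable swapAt at hw
      simp only [hv, if_false] at hw
      exact hR _ _ _ hw
  have f15 := IsFace.isFace hι hT (w := ![o, c, g, o, b, y, o, md, x, o, mg, b, o, a, e2])
    (by decide +kernel)
  have hpair : R'.pairPerm = Perm.swapChain [(ι o, ι md), (ι o, ι b), (ι o, ι c), (ι o, ι a),
      (ι o, ι mg)] * R.pairPerm := by
    have hs : ∀ b c d : Vert s, swap (ι o, b) (ι o, c) (ι o, d) = (ι o, swap b c d) :=
      fun b c d => by
        simp only [swap_apply_def, Prod.mk.injEq, true_and]
        split_ifs <;> rfl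
    have hs' : ∀ b c v d : Vert s, v ≠ ι o → swap (ι o, b) (ι o, c) (v, d) = (v, d) :=
      fun b c v d h => swap_apply_of_ne_of_ne (by simp [h]) (by simp [h])
    ext1 ⟨u, v⟩
    simp only [Perm.swapChain, Perm.mul_apply, Perm.one_apply, pairPerm_apply]
    by_cases hv : v = ι o
    · subst hv
      simp only [hs, ro, hκ', Perm.mul_apply, ← hσ]
    · simp only [hs' _ _ v _ hv, rne v hv]
  have hcount := Perm.orbitCount_swapChain_mul (σ := R.pairPerm) (a := (ι o, ι md))
    (l := [(ι o, ι b), (ι o, ι c), (ι o, ι a), (ι o, ι mg)]) (by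
      have no : ∀ {v w : Pt} (u : Pt), R.IsFace (ι ∘ ![o, v, w]) → o ≠ v → o ≠ w → u ≠ v →
          ¬ R.pairPerm.SameCycle (ι o, ι v) (ι o, ι u) := fun u hF h1 h2 h3 h => by
        obtain ⟨j, hj⟩ := hF.eq_of_sameCycle (i := 0) h
        have e1 := hι (Prod.mk.inj hj).1
        have e2 := hι (Prod.mk.inj hj).2
        fin_cases j
        · exact h3 e2
        · exact h1 e1
        · exact h2 e1
      simp only [List.pairwise_cons, List.mem_cons, List.not_mem_nil, or_false, forall_eq_or_imp,
        forall_eq, false_imp_iff, implies_true, List.Pairwise.nil, and_true]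
      refine ⟨⟨?_, ?_, ?_, ?_⟩, ⟨?_, ?_, ?_⟩, ⟨?_, ?_⟩, ?_⟩
      iterate 4 exact no _ f3 (by decide) (by decide) (by decide)
      iterate 3 exact no _ f2 (by decide) (by decide) (by decide)
      iterate 2 exact no _ f1 (by decide) (by decide) (by decide)
      exact no _ f5 (by decide) (by decide) (by decide))
  rw [← hpair] at hcount
  simp only [comp_vecCons, comp_vecEmpty] at f1 f2 f3 f4 f5 f15
  refine ⟨R', ⟨f1, f2, f3, f4, f5, rfl, rne, ?_, ?_, ?_, ?_, ?_, fun v h1 h2 h3 h4 h5 => ?_, f15⟩,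
    hT, hcount⟩
  · exact (congrArg (· (ι b)) ro).trans tb
  · exact (congrArg (· (ι y)) ro).trans ty
  · exact (congrArg (· (ι e2)) ro).trans te2
  · exact (congrArg (· (ι x)) ro).trans tx
  · exact (congrArg (· (ι g)) ro).trans tg
  · exact (congrArg (· v) ro).trans (toff v h1 h2 h3 h4 h5)

/-- The nine edges can be drawn one by one in the 15-sided face. -/
theorem exists_fillFace (hι : Function.Injective (ι)) {R : RotationSystem (Vert s)}
    (hR : handleTable.Agrees (ι) R) :
    ∃ R' : RotationSystem (Vert s), FillFace R R' γ δ ε ∧ filledTable.Agrees (ι) R' ∧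
      Perm.orbitCount R'.pairPerm = Perm.orbitCount R.pairPerm ∧
      ∀ u v, R'.graph.Adj u v ↔ R.graph.Adj u v ∨ s(u, v) = s(ι c, ι a) ∨ s(u, v) = s(ι y, ι x) ∨
        s(u, v) = s(ι x, ι b) ∨ s(u, v) = s(ι g, ι b) ∨ s(u, v) = s(ι b, ι a) ∨
        s(u, v) = s(ι x, ι a) ∨ s(u, v) = s(ι x, ι c) ∨ s(u, v) = s(ι c, ι y) ∨
        s(u, v) = s(ι c, ι b) := by
  have D : ∀ {T : CornerTable Pt} {R : RotationSystem (Vert s)} {n : ℕ} [NeZero n]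
      (w : Fin n → Pt) (i j : Fin n), T.Agrees (ι) R → T.CanDraw w i j →
      ∃ R', R.DrawEdge R' (ι ∘ w) i j ∧ (T.draw w i j).Agrees (ι) R' :=
    fun w i j h hw => hw.exists_drawEdge hι h
  obtain ⟨Q1, d1, t1⟩ := D ![o, c, g, o, b, y, o, md, x, o, mg, b, o, a, e2] 1 13 hR
    (by decide +kernel)
  obtain ⟨Q2, d2, t2⟩ := D ![c, g, o, b, y, o, md, x, o, mg, b, o, a] 4 7 t1 (by decide +kernel)
  obtain ⟨Q3, d3, t3⟩ := D ![c, g, o, b, y, x, o, mg, b, o, a] 5 8 t2 (by decide +kernel)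
  obtain ⟨Q4, d4, t4⟩ := D ![c, g, o, b, y, x, b, o, a] 1 3 t3 (by decide +kernel)
  obtain ⟨Q5, d5, t5⟩ := D ![c, g, b, y, x, b, o, a] 5 7 t4 (by decide +kernel)
  obtain ⟨Q6, d6, t6⟩ := D ![c, g, b, y, x, b, a] 4 6 t5 (by decide +kernel)
  obtain ⟨Q7, d7, t7⟩ := D ![c, g, b, y, x, a] 4 0 t6 (by decide +kernel)
  obtain ⟨Q8, d8, t8⟩ := D ![c, g, b, y, x] 0 3 t7 (by decide +kernel)
  obtain ⟨Q9, d9, t9⟩ := D ![c, g, b, y] 0 2 t8 (by decide +kernel)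
  have F : ∀ {n : ℕ} [NeZero n] (w : Fin n → Pt), filledTable.IsFace w → Q9.IsFace (ι ∘ w) :=
    fun w hw => hw.isFace hι t9
  have f1 := F ![o, c, a, e2] (by decide +kernel)
  have f2 := F ![o, md, x, y] (by decide +kernel)
  have f3 := F ![o, mg, b, x] (by decide +kernel)
  have hcount : Perm.orbitCount Q9.pairPerm = Perm.orbitCount R.pairPerm := by
    rw [d9.orbitCount_eq, d8.orbitCount_eq, d7.orbitCount_eq, d6.orbitCount_eq, d5.orbitCount_eq,
      d4.orbitCount_eq, d3.orbitCount_eq, d2.orbitCount_eq, d1.orbitCount_eq]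
  have hadj := fun u v => (d9.adj_iff u v).trans <| or_congr_left <| (d8.adj_iff u v).trans <|
    or_congr_left <| (d7.adj_iff u v).trans <| or_congr_left <| (d6.adj_iff u v).trans <|
    or_congr_left <| (d5.adj_iff u v).trans <| or_congr_left <| (d4.adj_iff u v).trans <|
    or_congr_left <| (d3.adj_iff u v).trans <| or_congr_left <| (d2.adj_iff u v).trans <|
    or_congr_left <| d1.adj_iff u v
  simp only [comp_vecCons, comp_vecEmpty] at d1 d2 d3 d4 d5 d6 d7 d8 d9 f1 f2 f3
  refine ⟨Q9, ⟨![R, Q1, Q2, Q3, Q4, Q5, Q6, Q7, Q8, Q9], rfl, rfl, d1, d2, d3, d4, d5, d6, d7, d8,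
    d9, f1, f2, f3⟩, t9, hcount, fun u v => (hadj u v).trans ?_⟩
  simp only [or_assoc]
  rfl

/-- The last edge flips exist, and they leave the quadrangle in which the edge `(-γ, x)` is redrawn. -/
theorem exists_final_flips (hι : Function.Injective (ι)) {R : RotationSystem (Vert s)}
    (hR : filledTable.Agrees (ι) R) :
    ∃ R' R'' : RotationSystem (Vert s),
      R.FlipSequence R'
        [s(num (-γ), letter .x), s(num (-γ - δ), num (-γ + δ)), s(num 0, num (-ε))] ∧
      R'.DrawEdge R'' ![num 0, num (-γ), letter .b, letter .x] 1 3 ∧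
      Perm.orbitCount R''.pairPerm = Perm.orbitCount R.pairPerm ∧
      ∀ u v, R''.graph.Adj u v ↔ (((R.graph.Adj u v ∧ s(u, v) ≠ s(ι p, ι q) ∨
        s(u, v) = s(ι o, ι me)) ∧ s(u, v) ≠ s(ι mg, ι x) ∨ s(u, v) = s(ι p, ι q)) ∨
        s(u, v) = s(ι mg, ι x)) := by
  have c1 : filledTable.CanFlip p q o me := by decide +kernel
  have c2 : (filledTable.flip p q o me).CanFlip mg x q p := by decide +kernel
  have c3 : ((filledTable.flip p q o me).flip mg x q p).CanDraw ![o, mg, b, x] 1 3 := by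
    decide +kernel
  obtain ⟨M₁, f1, t1, g1, -, -⟩ := c1.exists_edgeFlip hι hR
    (e := s(num (-γ - δ), num (-γ + δ))) (f := s(num 0, num (-ε))) rfl rfl
  obtain ⟨M₂, f2, t2, g2, -, -⟩ := c2.exists_edgeFlip hι t1
    (e := s(num (-γ), letter .x)) (f := s(num (-γ - δ), num (-γ + δ))) rfl Sym2.eq_swap
  obtain ⟨M₃, d, -⟩ := c3.exists_drawEdge hι t2
  have hadj := d.adj_iff
  simp only [comp_vecCons, comp_vecEmpty] at d
  refine ⟨M₂, M₃, ⟨M₁, ⟨R, rfl, f1⟩, f2⟩, d, ?_, fun u v => ?_⟩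
  · rw [d.orbitCount_eq, f2.orbitCount_eq, f1.orbitCount_eq]
  · rw [hadj, g2, g1]
    rfl

end RotationSystem


/-! ### Arithmetic in the current group -/

section

variable (s : ℕ)

theorem natCast_card_eq_zero : (12 * s + 6 : ZMod (12 * s + 6)) = 0 := by
  have := ZMod.natCast_self (12 * s + 6)
  push_cast at this
  exact this

variable {s}

theorem intCast_inj_of_lt {a b : ℤ} (h1 : a - b < 12 * s + 6) (h2 : b - a < 12 * s + 6)
    (h : (a : ZMod (12 * s + 6)) = b) : a = b := by
  rw [ZMod.intCast_eq_intCast_iff_dvd_sub] at h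
  have := Int.eq_zero_of_abs_lt_dvd h (by rw [abs_lt]; push_cast; omega)
  omega

theorem intCast_ne_of_lt {a b : ℤ} (h1 : a < b) (h2 : b - a < 12 * s + 6) :
    (a : ZMod (12 * s + 6)) ≠ b := fun h => by
  have := intCast_inj_of_lt (s := s) (by omega) h2 h
  omega

theorem exists_intCast_eq (d : ZMod (12 * s + 6)) :
    ∃ k : ℤ, 0 ≤ k ∧ k < 12 * s + 6 ∧ (k : ZMod (12 * s + 6)) = d :=
  ⟨d.val, by positivity, by exact_mod_cast d.val_lt, by simp⟩

variable (s)

/-- The element of order 2. -/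
def half : ZMod (12 * s + 6) := 6 * s + 3

theorem half_eq_intCast : half s = ((6 * s + 3 : ℤ) : ZMod (12 * s + 6)) := by
  simp [half]

theorem half_ne_zero : half s ≠ 0 := by
  have := intCast_ne_of_lt (s := s) (a := 0) (b := 6 * s + 3) (by omega) (by omega)
  rw [half_eq_intCast]
  simpa using this.symm

theorem half_add_half : half s + half s = 0 := by
  rw [half]
  linear_combination natCast_card_eq_zero s

theorem neg_half : -half s = half s := neg_eq_of_add_eq_zero_left (half_add_half s)

theorem eq_zero_or_half {d : ZMod (12 * s + 6)} (h : d + d = 0) : d = 0 ∨ d = half s := by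
  obtain ⟨k, h0, h1, rfl⟩ := exists_intCast_eq d
  rw [← Int.cast_add, ZMod.intCast_zmod_eq_zero_iff_dvd] at h
  obtain ⟨m, hm⟩ := h
  push_cast at hm
  have hm2 : m < 2 := by nlinarith
  have hm0 : -1 < m := by nlinarith
  obtain rfl | rfl : m = 0 ∨ m = 1 := by omega
  · left; rw [show k = 0 by omega]; simp
  · right; rw [half_eq_intCast, show k = 6 * s + 3 by omega]

/-- Reduction of the current group modulo 3. -/
def mod3 : ZMod (12 * s + 6) →+* ZMod 3 := ZMod.castHom ⟨4 * s + 2, by ring⟩ (ZMod 3)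

theorem exists_three_mul_of_mod3_eq_zero {d : ZMod (12 * s + 6)} (h : mod3 s d = 0) :
    ∃ k : ℤ, d = k * 3 := by
  obtain ⟨k, -, -, rfl⟩ := exists_intCast_eq d
  rw [map_intCast, ZMod.intCast_zmod_eq_zero_iff_dvd] at h
  obtain ⟨m, rfl⟩ := h
  exact ⟨m, by push_cast; ring⟩

theorem zmultiples_eps : AddSubgroup.zmultiples (6 * s + 5 : ZMod (12 * s + 6)) = ⊤ := by
  have h1 : ∃ k : ℤ, (k : ZMod (12 * s + 6)) * (6 * s + 5) = 1 := by
    have hn := natCast_card_eq_zero s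
    rcases Nat.even_or_odd' s with ⟨t, ht | ht⟩
    · refine ⟨-6 * t - 1, ?_⟩
      have : (s : ZMod (12 * s + 6)) = 2 * t := by exact_mod_cast congrArg Nat.cast ht
      push_cast
      rw [this] at hn ⊢
      linear_combination (-(3 * t + 1 : ZMod (12 * s + 6))) * hn
    · refine ⟨6 * t + 5, ?_⟩
      have : (s : ZMod (12 * s + 6)) = 2 * t + 1 := by exact_mod_cast congrArg Nat.cast ht
      push_cast
      rw [this] at hn ⊢
      linear_combination (3 * t + 3 : ZMod (12 * s + 6)) * hn
  obtain ⟨k, hk⟩ := h1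
  rw [eq_top_iff]
  intro d _
  obtain ⟨m, -, -, rfl⟩ := exists_intCast_eq d
  exact ⟨m * k, by simp only [zsmul_eq_mul, Int.cast_mul]; rw [mul_assoc, hk, mul_one]⟩

theorem zmultiples_one : AddSubgroup.zmultiples (1 : ZMod (12 * s + 6)) = ⊤ := by
  rw [eq_top_iff]
  intro d _
  obtain ⟨m, -, -, rfl⟩ := exists_intCast_eq d
  exact ⟨m, by simp⟩

theorem index_zmultiples_neg_three :
    (AddSubgroup.zmultiples (-3 : ZMod (12 * s + 6))).index = 3 := by
  have h := AddSubgroup.card_mul_index (AddSubgroup.zmultiples (-3 : ZMod (12 * s + 6)))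
  rw [Nat.card_zmultiples, addOrderOf_neg, Nat.card_zmod] at h
  have h3 : addOrderOf (3 : ZMod (12 * s + 6)) = 4 * s + 2 := by
    have := ZMod.addOrderOf_coe 3 (n := 12 * s + 6) (by omega)
    have e : Nat.gcd (12 * s + 6) 3 = 3 := Nat.gcd_eq_right ⟨4 * s + 2, by ring⟩
    rw [Nat.cast_ofNat, e] at this
    rw [this]
    omega
  rw [h3] at h
  exact Nat.eq_of_mul_eq_mul_left (show 0 < 4 * s + 2 by omega) (by rw [h]; ring)

/-! ### Current graphs described by their log -/

/-- The arcs are named by their currents, except that `0` is the arc with a current of order 2 that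
leaves the dead end. -/
def arcCurr (d : ZMod (12 * s + 6)) : ZMod (12 * s + 6) := if d = 0 then half s else d

/-- The reverse of an arc. -/
def arcRev (d : ZMod (12 * s + 6)) : ZMod (12 * s + 6) :=
  if d = 0 then half s else if d = half s then 0 else -d

/-- The arc that enters the corner with a given letter. -/
def letterArc : Letter → ZMod (12 * s + 6)
  | .a => 4
  | .y => 6 * s + 5
  | .b => -(6 * s + 5)
  | .c => 6 * s - 2
  | .x => 1

/-- The arc that leaves the corner with a given letter. -/
def letterNext : Letter → ZMod (12 * s + 6)
  | .a => 6 * s + 5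
  | .y => -(6 * s + 5)
  | .b => -(6 * s - 2)
  | .c => -4
  | .x => -1

/-- The letter after an arc. -/
def arcLabel (d : ZMod (12 * s + 6)) : Option Letter :=
  [Letter.a, .b, .c, .x, .y].find? fun z => letterArc s z = d

/-- `F` is the face tracing permutation of an index 1 current graph with the required properties,
up to its ladder. -/
structure IsLog (F : Perm (ZMod (12 * s + 6))) : Prop where
  apply_half : F (half s) = 0
  apply_letterArc : ∀ z, F (letterArc s z) = letterNext s z
  /-- The head of every other arc has degree 3 and satisfies Kirchhoff's current law. -/
  vertex : ∀ d, d ≠ half s → arcLabel s d = none →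
    F d ≠ arcRev s d ∧ F (arcRev s (F (arcRev s (F d)))) = arcRev s d ∧
      arcCurr s (F d) + arcCurr s (F (arcRev s (F d))) = arcCurr s d
  apply_neg_two : F (-2) = 6 * s - 3
  apply_two : F 2 = -6
  /-- There is one face, and the letters are in the right order. -/
  exists_pos : ∃ pos : ZMod (12 * s + 6) → ℕ, pos 4 = 0 ∧ (∀ d, pos d < 12 * s + 6) ∧
    (∀ d, F d ≠ 4 → pos (F d) = pos d + 1) ∧ pos (6 * s - 2) < pos 1

variable {s}

theorem arcRev_zero : arcRev s 0 = half s := if_pos rfl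

theorem arcRev_half : arcRev s (half s) = 0 := by simp [arcRev, half_ne_zero]

theorem arcRev_of_ne {d : ZMod (12 * s + 6)} (h0 : d ≠ 0) (h : d ≠ half s) : arcRev s d = -d := by
  simp [arcRev, h0, h]

theorem arcCurr_of_ne {d : ZMod (12 * s + 6)} (h0 : d ≠ 0) : arcCurr s d = d := if_neg h0

theorem arcCurr_zero : arcCurr s 0 = half s := if_pos rfl

theorem arcRev_arcRev (d : ZMod (12 * s + 6)) : arcRev s (arcRev s d) = d := by
  by_cases h0 : d = 0
  · rw [h0, arcRev_zero, arcRev_half]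
  by_cases h : d = half s
  · rw [h, arcRev_half, arcRev_zero]
  · rw [arcRev_of_ne h0 h, arcRev_of_ne (neg_ne_zero.2 h0) (by
      rw [ne_eq, neg_eq_iff_eq_neg, neg_half]; exact h), neg_neg]

theorem arcRev_ne (d : ZMod (12 * s + 6)) : arcRev s d ≠ d := by
  by_cases h0 : d = 0
  · rw [h0, arcRev_zero]; exact half_ne_zero s
  by_cases h : d = half s
  · rw [h, arcRev_half]; exact (half_ne_zero s).symm
  · rw [arcRev_of_ne h0 h]
    intro e
    have := eq_zero_or_half s (d := d) (by nth_rewrite 1 [← e]; simp)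
    tauto

theorem arcCurr_arcRev (d : ZMod (12 * s + 6)) : arcCurr s (arcRev s d) = -arcCurr s d := by
  by_cases h0 : d = 0
  · rw [h0, arcRev_zero, arcCurr_zero, arcCurr_of_ne (half_ne_zero s), neg_half]
  by_cases h : d = half s
  · rw [h, arcRev_half, arcCurr_zero, arcCurr_of_ne (half_ne_zero s), neg_half]
  · rw [arcRev_of_ne h0 h, arcCurr_of_ne (neg_ne_zero.2 h0), arcCurr_of_ne h0]

theorem letterArc_eq_intCast (z : Letter) : ∃ k : ℤ, letterArc s z = k ∧
    k = match z with
      | .a => 4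
      | .y => 6 * s + 5
      | .b => 6 * s + 1
      | .c => 6 * s - 2
      | .x => 1 := by
  refine ⟨_, ?_, rfl⟩
  have hn := natCast_card_eq_zero s
  cases z <;> simp only [letterArc] <;> push_cast
  case b => linear_combination -hn
  all_goals rfl

theorem letterArc_injective (hs : 2 ≤ s) : Function.Injective (letterArc s) := by
  intro z z' h
  obtain ⟨k, hk, hk'⟩ := letterArc_eq_intCast (s := s) z
  obtain ⟨l, hl, hl'⟩ := letterArc_eq_intCast (s := s) z'
  rw [hk, hl] at h
  by_contra hne
  cases z <;> cases z' <;> first | exact hne rfl | skip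
  all_goals
    simp only at hk' hl'
    have := intCast_inj_of_lt (by omega) (by omega) h
    omega

theorem letterArc_ne_half (hs : 2 ≤ s) (z : Letter) : letterArc s z ≠ half s := by
  obtain ⟨k, hk, hk'⟩ := letterArc_eq_intCast (s := s) z
  rw [hk, half_eq_intCast]
  intro h
  cases z <;> simp only at hk' <;> have := intCast_inj_of_lt (by omega) (by omega) h <;> omega

theorem letterArc_ne_zero (hs : 2 ≤ s) (z : Letter) : letterArc s z ≠ 0 := by
  obtain ⟨k, hk, hk'⟩ := letterArc_eq_intCast (s := s) z
  rw [hk, ← Int.cast_zero]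
  intro h
  cases z <;> simp only at hk' <;> have := intCast_inj_of_lt (by omega) (by omega) h <;> omega

theorem arcLabel_eq_some_iff (hs : 2 ≤ s) {d : ZMod (12 * s + 6)} {z : Letter} :
    arcLabel s d = some z ↔ letterArc s z = d := by
  constructor
  · intro h
    simpa using List.find?_some h
  · rintro rfl
    have h : (arcLabel s (letterArc s z)).isSome := by
      rw [arcLabel, List.find?_isSome]
      exact ⟨z, by cases z <;> simp, by simp⟩
    obtain ⟨z', hz'⟩ := Option.isSome_iff_exists.1 h
    have := List.find?_some hz'
    simp only [decide_eq_true_eq] at this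
    rw [hz', letterArc_injective hs this]

theorem letterArc_cases {d : ZMod (12 * s + 6)} (hs : 2 ≤ s) :
    (∃ z, d = letterArc s z) ∨ arcLabel s d = none := by
  cases h : arcLabel s d with
  | none => exact Or.inr rfl
  | some z => exact Or.inl ⟨z, ((arcLabel_eq_some_iff hs).1 h).symm⟩

/-- The letter across the edge that leaves a labeled corner. -/
def letterSucc : Letter → Letter
  | .a => .b
  | .b => .c
  | .c => .a
  | .x => .x
  | .y => .y

theorem letterNext_eq_neg (z : Letter) : letterNext s z = -letterArc s (letterSucc z) := by
  cases z <;> simp [letterNext, letterSucc, letterArc]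

theorem arcRev_letterArc (hs : 2 ≤ s) (z : Letter) : arcRev s (letterArc s z) = -letterArc s z :=
  arcRev_of_ne (letterArc_ne_zero hs z) (letterArc_ne_half hs z)

theorem arcRev_letterNext (hs : 2 ≤ s) (z : Letter) :
    arcRev s (letterNext s z) = letterArc s (letterSucc z) := by
  rw [letterNext_eq_neg, ← arcRev_letterArc hs, arcRev_arcRev]

theorem letterNext_ne_zero (hs : 2 ≤ s) (z : Letter) : letterNext s z ≠ 0 := by
  rw [letterNext_eq_neg, neg_ne_zero]
  exact letterArc_ne_zero hs _

end


/-! ### The current graph with a given log -/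

theorem Equiv.Perm.sameCycle_iff_of_three {α : Type*} [Finite α] {σ : Perm α} {a b c : α}
    (h1 : σ a = b) (h2 : σ b = c) (h3 : σ c = a) {z : α} :
    σ.SameCycle a z ↔ z = a ∨ z = b ∨ z = c := by
  constructor
  · intro h
    obtain ⟨k, rfl⟩ := h.exists_nat_pow_eq
    induction k with
    | zero => exact Or.inl rfl
    | succ k ih =>
      rw [pow_succ', mul_apply]
      rcases ih ⟨k, by simp⟩ with h | h | h <;> rw [h] <;> simp [h1, h2, h3]
  · rintro (rfl | rfl | rfl)
    · exact SameCycle.refl _ _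
    · exact ⟨1, by simpa using h1⟩
    · exact ⟨2, by rw [show (2 : ℤ) = 1 + 1 by norm_num, zpow_one_add, mul_apply, zpow_one, h1, h2]⟩

theorem Equiv.Perm.sameCycle_iff_of_fixed {α : Type*} {σ : Perm α} {a : α} (h : σ a = a) {z : α} :
    σ.SameCycle a z ↔ z = a := by
  constructor
  · rintro ⟨k, rfl⟩
    exact zpow_apply_eq_self_of_apply_eq_self h k
  · rintro rfl
    exact SameCycle.refl _ _

theorem CurrentGraph.sum_head {Γ L W D M : Type*} [AddCommGroup Γ] [AddCommMonoid M] [Fintype D]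
    [DecidableEq W] (G : CurrentGraph Γ L W D) (v : W) (f : D → M) :
    ∑ d ∈ Finset.univ.filter (fun d => G.head d = v), f d
      = ∑ d ∈ Finset.univ.filter (fun d => G.tail d = v), f (G.rev d) := by
  refine Finset.sum_nbij' G.rev G.rev (fun d hd => ?_) (fun d hd => ?_) (fun d _ => G.rev_rev d)
    (fun d _ => G.rev_rev d) (fun d _ => by rw [G.rev_rev])
  · exact Finset.mem_filter.2 ⟨Finset.mem_univ _, (Finset.mem_filter.1 hd).2⟩
  · refine Finset.mem_filter.2 ⟨Finset.mem_univ _, ?_⟩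
    rw [CurrentGraph.head, G.rev_rev]
    exact (Finset.mem_filter.1 hd).2

section

variable {s : ℕ}

/-- The rotation of the arcs leaving the vertices. -/
def vertexRot (F : Perm (ZMod (12 * s + 6))) : Perm (ZMod (12 * s + 6)) :=
  F * Function.Involutive.toPerm (arcRev s) arcRev_arcRev

theorem vertexRot_apply (F : Perm (ZMod (12 * s + 6))) (d : ZMod (12 * s + 6)) :
    vertexRot F d = F (arcRev s d) := rfl

/-- The vertices of the current graph are the cycles of its rotation. -/
def LogVertex (F : Perm (ZMod (12 * s + 6))) : Type :=
  Quotient (Perm.SameCycle.setoid (vertexRot F))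

instance (F : Perm (ZMod (12 * s + 6))) : Finite (LogVertex F) := Quotient.finite _

noncomputable instance (F : Perm (ZMod (12 * s + 6))) : Fintype (LogVertex F) := Fintype.ofFinite _

noncomputable instance (F : Perm (ZMod (12 * s + 6))) : DecidableEq (LogVertex F) :=
  Classical.decEq _

/-- The vertex that an arc leaves. -/
def arcTail (F : Perm (ZMod (12 * s + 6))) (d : ZMod (12 * s + 6)) : LogVertex F :=
  Quotient.mk _ d

theorem arcTail_eq_iff {F : Perm (ZMod (12 * s + 6))} {d e : ZMod (12 * s + 6)} :
    arcTail F d = arcTail F e ↔ (vertexRot F).SameCycle d e :=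
  Quotient.eq

/-- The current graph with log `F`. -/
def logGraph (F : Perm (ZMod (12 * s + 6))) :
    CurrentGraph (ZMod (12 * s + 6)) Letter (LogVertex F) (ZMod (12 * s + 6)) where
  tail := arcTail F
  rev := arcRev s
  rev_rev := arcRev_arcRev
  rev_ne := arcRev_ne
  rot := vertexRot F
  rot_cyclic v := by
    obtain ⟨e, rfl⟩ := Quotient.exists_rep v
    refine Perm.isCycleOn_of (fun d => ?_) fun d hd d' hd' => ?_
    · show arcTail F _ = arcTail F e ↔ arcTail F d = arcTail F e
      rw [arcTail_eq_iff, arcTail_eq_iff, Perm.sameCycle_apply_left]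
    · exact (arcTail_eq_iff.1 hd).trans (arcTail_eq_iff.1 hd').symm
  curr := arcCurr s
  curr_rev := arcCurr_arcRev
  label := arcLabel s

variable {F : Perm (ZMod (12 * s + 6))}

theorem logGraph_head (d : ZMod (12 * s + 6)) :
    (logGraph F).head d = arcTail F (arcRev s d) := rfl

theorem logGraph_face : (logGraph F).face = F := by
  ext1 d
  show F (arcRev s (arcRev s d)) = F d
  rw [arcRev_arcRev]

theorem filter_tail_of_fixed {e : ZMod (12 * s + 6)} (h : vertexRot F e = e) :
    Finset.univ.filter (fun d => (logGraph F).tail d = arcTail F e) = {e} := by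
  ext d
  simp only [Finset.mem_filter, Finset.mem_univ, true_and, Finset.mem_singleton]
  show arcTail F d = arcTail F e ↔ _
  rw [arcTail_eq_iff, Perm.sameCycle_comm, Perm.sameCycle_iff_of_fixed h]

theorem filter_tail_of_three {e f g : ZMod (12 * s + 6)} (h1 : vertexRot F e = f)
    (h2 : vertexRot F f = g) (h3 : vertexRot F g = e) :
    Finset.univ.filter (fun d => (logGraph F).tail d = arcTail F e) = {e, f, g} := by
  ext d
  simp only [Finset.mem_filter, Finset.mem_univ, true_and, Finset.mem_insert,
    Finset.mem_singleton]
  show arcTail F d = arcTail F e ↔ _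
  rw [arcTail_eq_iff, Perm.sameCycle_comm, Perm.sameCycle_iff_of_three h1 h2 h3]

/-- A sum over the arcs entering a vertex of degree 3. -/
theorem sum_head_of_three {M : Type*} [AddCommMonoid M] {e f g : ZMod (12 * s + 6)}
    (h1 : vertexRot F e = f) (h2 : vertexRot F f = g) (h3 : vertexRot F g = e) (hne : f ≠ e)
    (φ : ZMod (12 * s + 6) → M) :
    ∑ d ∈ Finset.univ.filter (fun d => (logGraph F).head d = arcTail F e),
      φ ((logGraph F).curr d) = φ (-arcCurr s e) + φ (-arcCurr s f) + φ (-arcCurr s g) := by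
  have hge : g ≠ e := fun h => by
    rw [h, h1] at h3; exact hne h3
  have hfg : f ≠ g := fun h => by
    rw [← h, h2] at h3; exact hge h3
  rw [CurrentGraph.sum_head, filter_tail_of_three h1 h2 h3,
    Finset.sum_insert (by simp [hne.symm, hge.symm]), Finset.sum_pair hfg, add_assoc]
  simp only [(logGraph F).curr_rev]
  rfl

theorem degree_of_three {e f g : ZMod (12 * s + 6)} (h1 : vertexRot F e = f)
    (h2 : vertexRot F f = g) (h3 : vertexRot F g = e) (hne : f ≠ e) :
    (logGraph F).degree (arcTail F e) = 3 := by
  have hge : g ≠ e := fun h => by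
    rw [h, h1] at h3; exact hne h3
  have hfg : f ≠ g := fun h => by
    rw [← h, h2] at h3; exact hge h3
  rw [CurrentGraph.degree, filter_tail_of_three h1 h2 h3,
    Finset.card_insert_of_notMem (by simp [hne.symm, hge.symm]), Finset.card_pair hfg]

theorem degree_of_fixed {e : ZMod (12 * s + 6)} (h : vertexRot F e = e) :
    (logGraph F).degree (arcTail F e) = 1 := by
  rw [CurrentGraph.degree, filter_tail_of_fixed h, Finset.card_singleton]

theorem excess_of_fixed {e : ZMod (12 * s + 6)} (h : vertexRot F e = e) :
    (logGraph F).excess (arcTail F e) = -arcCurr s e := by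
  rw [CurrentGraph.excess, CurrentGraph.sum_head, filter_tail_of_fixed h, Finset.sum_singleton]
  exact arcCurr_arcRev e

namespace IsLog

theorem vertexRot_neg_letterArc (hF : IsLog s F) (hs : 2 ≤ s) (z : Letter) :
    vertexRot F (-letterArc s z) = -letterArc s (letterSucc z) := by
  rw [vertexRot_apply, ← arcRev_letterArc hs, arcRev_arcRev, hF.apply_letterArc, letterNext_eq_neg]

theorem vertexRot_zero (hF : IsLog s F) : vertexRot F 0 = 0 := by
  rw [vertexRot_apply, arcRev_zero, hF.apply_half]

theorem head_half : (logGraph F).head (half s) = arcTail F 0 := by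
  rw [logGraph_head, arcRev_half]

theorem head_letterArc (hs : 2 ≤ s) (z : Letter) :
    (logGraph F).head (letterArc s z) = arcTail F (-letterArc s z) := by
  rw [logGraph_head, arcRev_letterArc hs]

theorem arcTail_letterSucc (hF : IsLog s F) (hs : 2 ≤ s) (z : Letter) :
    arcTail F (-letterArc s (letterSucc z)) = arcTail F (-letterArc s z) := by
  rw [arcTail_eq_iff, ← hF.vertexRot_neg_letterArc hs, Perm.sameCycle_apply_left]

theorem label_of_head_eq (hF : IsLog s F) (hs : 2 ≤ s) {d : ZMod (12 * s + 6)} {z : Letter}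
    (h : (logGraph F).head d = (logGraph F).head (letterArc s z)) :
    ∃ z', d = letterArc s z' := by
  rw [head_letterArc hs, logGraph_head, arcTail_eq_iff] at h
  have := h.eq_of_invariant (fun w => ∃ z, w = -letterArc s z) fun w => by
    refine propext ⟨?_, ?_⟩
    · rintro ⟨z, hz⟩
      obtain ⟨z', rfl⟩ : ∃ z', letterSucc z' = z := by
        cases z
        exacts [⟨.c, rfl⟩, ⟨.a, rfl⟩, ⟨.b, rfl⟩, ⟨.x, rfl⟩, ⟨.y, rfl⟩]
      rw [← hF.vertexRot_neg_letterArc hs] at hz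
      exact ⟨z', (vertexRot F).injective hz⟩
    · rintro ⟨z, rfl⟩
      exact ⟨letterSucc z, hF.vertexRot_neg_letterArc hs z⟩
  obtain ⟨z', hz'⟩ := this.mpr ⟨z, rfl⟩
  refine ⟨z', ?_⟩
  rw [← arcRev_letterArc hs] at hz'
  rw [← arcRev_arcRev d, hz', arcRev_arcRev]

theorem isSome_label_of_isVortex (hF : IsLog s F) (hs : 2 ≤ s) {d : ZMod (12 * s + 6)}
    (h : (logGraph F).IsVortex ((logGraph F).head d)) : ∃ z, d = letterArc s z := by
  obtain ⟨d', hd', hl⟩ := h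
  obtain ⟨z, hz⟩ := Option.isSome_iff_exists.1 hl
  have hz' : letterArc s z = d' := (arcLabel_eq_some_iff hs).1 hz
  exact hF.label_of_head_eq hs (z := z) (by rw [hz', hd'])

theorem isVortex_head_letterArc (hs : 2 ≤ s) (z : Letter) :
    (logGraph F).IsVortex ((logGraph F).head (letterArc s z)) :=
  ⟨letterArc s z, rfl, by
    show (arcLabel s _).isSome
    rw [(arcLabel_eq_some_iff hs).2 rfl]
    rfl⟩

theorem degree_head_half (hF : IsLog s F) :
    (logGraph F).degree ((logGraph F).head (half s)) = 1 := by
  rw [head_half, degree_of_fixed hF.vertexRot_zero]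

/-- Arcs that enter an unlabeled vertex of degree 3. -/
theorem sum_head_of_unlabeled (hF : IsLog s F) {d : ZMod (12 * s + 6)} (h : d ≠ half s)
    (hl : arcLabel s d = none) {M : Type*} [AddCommMonoid M] (φ : ZMod (12 * s + 6) → M) :
    ∑ e ∈ Finset.univ.filter (fun e => (logGraph F).head e = (logGraph F).head d),
      φ ((logGraph F).curr e) = φ (arcCurr s d) + φ (-arcCurr s (F d)) +
        φ (-arcCurr s (F (arcRev s (F d)))) := by
  obtain ⟨h1, h2, -⟩ := hF.vertex d h hl
  rw [logGraph_head, sum_head_of_three (e := arcRev s d) (f := F d) (g := F (arcRev s (F d)))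
    (by rw [vertexRot_apply, arcRev_arcRev]) (vertexRot_apply _ _)
    (by rw [vertexRot_apply, h2]) h1, arcCurr_arcRev, neg_neg]

theorem degree_head_of_unlabeled (hF : IsLog s F) {d : ZMod (12 * s + 6)} (h : d ≠ half s)
    (hl : arcLabel s d = none) : (logGraph F).degree ((logGraph F).head d) = 3 := by
  obtain ⟨h1, h2, -⟩ := hF.vertex d h hl
  exact degree_of_three (e := arcRev s d) (by rw [vertexRot_apply, arcRev_arcRev]) (vertexRot_apply _ _)
    (by rw [vertexRot_apply, h2]) h1

theorem not_isVortex_of_unlabeled (hF : IsLog s F) (hs : 2 ≤ s) {d : ZMod (12 * s + 6)}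
    (hl : arcLabel s d = none) : ¬ (logGraph F).IsVortex ((logGraph F).head d) := fun h => by
  obtain ⟨z, rfl⟩ := hF.isSome_label_of_isVortex hs h
  rw [(arcLabel_eq_some_iff hs).2 rfl] at hl
  exact absurd hl (by simp)

theorem excess_head_x (hF : IsLog s F) (hs : 2 ≤ s) :
    (logGraph F).excess ((logGraph F).head (letterArc s .x)) = 1 := by
  rw [head_letterArc hs, excess_of_fixed (hF.vertexRot_neg_letterArc hs .x),
    arcCurr_of_ne (neg_ne_zero.2 (letterArc_ne_zero hs _)), neg_neg, letterArc]

theorem excess_head_y (hF : IsLog s F) (hs : 2 ≤ s) :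
    (logGraph F).excess ((logGraph F).head (letterArc s .y)) = 6 * s + 5 := by
  rw [head_letterArc hs, excess_of_fixed (hF.vertexRot_neg_letterArc hs .y),
    arcCurr_of_ne (neg_ne_zero.2 (letterArc_ne_zero hs _)), neg_neg, letterArc]

theorem isV1_head_x (hF : IsLog s F) (hs : 2 ≤ s) :
    (logGraph F).IsV1 ((logGraph F).head (letterArc s .x)) :=
  ⟨by rw [head_letterArc hs, degree_of_fixed (hF.vertexRot_neg_letterArc hs .x)],
    by rw [hF.excess_head_x hs, zmultiples_one]⟩

theorem isV1_head_y (hF : IsLog s F) (hs : 2 ≤ s) :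
    (logGraph F).IsV1 ((logGraph F).head (letterArc s .y)) :=
  ⟨by rw [head_letterArc hs, degree_of_fixed (hF.vertexRot_neg_letterArc hs .y)],
    by rw [hF.excess_head_y hs, zmultiples_eps]⟩

theorem head_b (hF : IsLog s F) (hs : 2 ≤ s) :
    (logGraph F).head (letterArc s .b) = (logGraph F).head (letterArc s .a) := by
  rw [head_letterArc hs, head_letterArc hs, ← hF.arcTail_letterSucc hs .a]
  rfl

theorem head_c (hF : IsLog s F) (hs : 2 ≤ s) :
    (logGraph F).head (letterArc s .c) = (logGraph F).head (letterArc s .a) := by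
  rw [← hF.head_b hs, head_letterArc hs, head_letterArc hs, ← hF.arcTail_letterSucc hs .b]
  rfl

theorem isV3_head_a (hF : IsLog s F) (hs : 2 ≤ s) :
    (logGraph F).IsV3 ((logGraph F).head (letterArc s .a)) := by
  have h := hF.vertexRot_neg_letterArc hs
  have hne : -letterArc s .b ≠ -letterArc s .a := fun e => by
    have := letterArc_injective hs (neg_injective e)
    simp at this
  refine ⟨?_, ?_, 1, Or.inl rfl, fun d hd => ?_⟩
  · rw [head_letterArc hs, degree_of_three (h .a) (h .b) (h .c) hne]
  · have := sum_head_of_three (h .a) (h .b) (h .c) hne id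
    rw [CurrentGraph.excess, head_letterArc hs]
    refine (congrArg (fun e => (AddSubgroup.zmultiples e).index) (this.trans ?_)).trans
      (index_zmultiples_neg_three s)
    simp only [id, letterSucc]
    rw [arcCurr_of_ne (neg_ne_zero.2 (letterArc_ne_zero hs _)),
      arcCurr_of_ne (neg_ne_zero.2 (letterArc_ne_zero hs _)),
      arcCurr_of_ne (neg_ne_zero.2 (letterArc_ne_zero hs _))]
    simp only [letterArc]
    ring
  · obtain ⟨z, rfl⟩ := hF.label_of_head_eq hs hd
    show (arcCurr s (letterArc s z)).val % 3 = 1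
    rw [arcCurr_of_ne (letterArc_ne_zero hs _)]
    have key : ∀ k : ℕ, k < 12 * s + 6 → k % 3 = 1 → ∀ d : ZMod (12 * s + 6), d = k →
        d.val % 3 = 1 := by
      rintro k hk hk3 d rfl
      rw [ZMod.val_natCast_of_lt hk, hk3]
    have hn := natCast_card_eq_zero s
    have hy : z ≠ .y := by
      rintro rfl
      have h3 := degree_of_three (h .a) (h .b) (h .c) hne
      rw [← head_letterArc hs, ← hd, head_letterArc hs, degree_of_fixed (h .y)] at h3
      omega
    cases z with
    | a => exact key 4 (by omega) (by omega) _ (by simp [letterArc])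
    | b => exact key (6 * s + 1) (by omega) (by omega) _ (by
        simp only [letterArc]; push_cast; linear_combination -hn)
    | c => exact key (6 * s - 2) (by omega) (by omega) _ (by
        simp only [letterArc]; rw [Nat.cast_sub (by omega)]; push_cast; ring)
    | x => exact key 1 (by omega) (by omega) _ (by simp [letterArc])
    | y => exact absurd rfl hy

/-- The position of an arc in the log, counted from the arc with current `4`, is the number of
steps of face tracing that lead to it. -/
theorem pow_pos_apply {pos : ZMod (12 * s + 6) → ℕ} (h4 : pos 4 = 0)
    (hpos : ∀ d, F d ≠ 4 → pos (F d) = pos d + 1) (d : ZMod (12 * s + 6)) :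
    (F ^ pos d) 4 = d := by
  have key : ∀ k, ∀ d, pos d = k → (F ^ k) 4 = d := by
    intro k
    induction k with
    | zero =>
      intro d hd
      by_contra hne
      obtain ⟨e, rfl⟩ := F.surjective d
      have := hpos e fun e => hne e.symm
      omega
    | succ k ih =>
      intro d hd
      have hne : d ≠ 4 := by rintro rfl; omega
      obtain ⟨e, rfl⟩ := F.surjective d
      have := hpos e hne
      rw [pow_succ', Perm.mul_apply, ih e (by omega)]
  exact key _ d rfl

theorem sameCycle (hF : IsLog s F) (d e : ZMod (12 * s + 6)) : F.SameCycle d e := by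
  obtain ⟨pos, h4, -, hpos, -⟩ := hF.exists_pos
  have key : ∀ d, F.SameCycle 4 d := fun d => ⟨pos d, by
    rw [zpow_natCast, pow_pos_apply h4 hpos]⟩
  exact (key d).symm.trans (key e)

theorem isStandard (hF : IsLog s F) (hs : 2 ≤ s) : (logGraph F).IsStandard := by
  have hcases : ∀ d, d = half s ∨ (∃ z, d = letterArc s z) ∨ d ≠ half s ∧ arcLabel s d = none :=
    fun d => by
      by_cases h : d = half s
      · exact Or.inl h
      · exact Or.inr ((letterArc_cases hs).imp_right fun h' => ⟨h, h'⟩)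
  have hhead : ∀ v, ∃ d, v = (logGraph F).head d := fun v => by
    obtain ⟨e, rfl⟩ := Quotient.exists_rep v
    exact ⟨arcRev s e, by rw [logGraph_head, arcRev_arcRev]; rfl⟩
  have hV3 : ∀ z, z = Letter.a ∨ z = .b ∨ z = .c →
      (logGraph F).IsV3 ((logGraph F).head (letterArc s z)) := by
    rintro z (rfl | rfl | rfl)
    · exact hF.isV3_head_a hs
    · rw [hF.head_b hs]; exact hF.isV3_head_a hs
    · rw [hF.head_c hs]; exact hF.isV3_head_a hs
  have htype : ∀ z, (logGraph F).IsV1 ((logGraph F).head (letterArc s z)) ∨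
      (logGraph F).IsV3 ((logGraph F).head (letterArc s z)) := fun z => by
    cases z
    · exact Or.inr (hV3 _ (by simp))
    · exact Or.inr (hV3 _ (by simp))
    · exact Or.inr (hV3 _ (by simp))
    · exact Or.inl (hF.isV1_head_x hs)
    · exact Or.inl (hF.isV1_head_y hs)
  have hcurr0 : ∀ d, arcCurr s d ≠ 0 := fun d => by
    unfold arcCurr
    split_ifs with h
    · exact half_ne_zero s
    · exact h
  constructor
  · rw [CurrentGraph.index, logGraph_face, Nat.card_eq_one_iff_unique]
    refine ⟨⟨fun a b => ?_⟩, ⟨Quotient.mk _ 0⟩⟩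
    obtain ⟨d, rfl⟩ := Quotient.exists_rep a
    obtain ⟨e, rfl⟩ := Quotient.exists_rep b
    exact Quotient.sound (hF.sameCycle d e)
  · intro v
    obtain ⟨d, rfl⟩ := hhead v
    rcases hcases d with rfl | ⟨z, rfl⟩ | ⟨h, hl⟩
    · exact Or.inl hF.degree_head_half
    · exact (htype z).imp (fun h => h.1) fun h => h.1
    · exact Or.inr (hF.degree_head_of_unlabeled h hl)
  · exact hcurr0
  · intro g hg
    exact ⟨g, arcCurr_of_ne hg⟩
  · intro d d' h
    replace h : arcCurr s d = arcCurr s d' := h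
    show d' = d ∨ d' = arcRev s d
    unfold arcCurr at h
    split_ifs at h with h1 h2 h2
    · left; rw [h1, h2]
    · right; rw [h1, arcRev_zero, h]
    · right; rw [h2, h, arcRev_half]
    · left; exact h.symm
  · intro d hd
    replace hd : arcCurr s d + arcCurr s d = 0 := hd
    rcases eq_zero_or_half s hd with h | h
    · exact absurd h (hcurr0 d)
    · unfold arcCurr at h
      split_ifs at h with h0
      · left
        subst h0
        exact degree_of_fixed hF.vertexRot_zero
      · right
        rw [h]
        exact hF.degree_head_half
  · intro v hv h3
    obtain ⟨d, rfl⟩ := hhead v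
    rcases hcases d with rfl | ⟨z, rfl⟩ | ⟨h, hl⟩
    · rw [hF.degree_head_half] at h3; omega
    · exact absurd (isVortex_head_letterArc hs z) hv
    · rw [CurrentGraph.excess]
      refine (hF.sum_head_of_unlabeled h hl id).trans ?_
      simp only [id]
      rw [← (hF.vertex d h hl).2.2]
      ring
  · intro d hv h1
    rcases hcases d with rfl | ⟨z, rfl⟩ | ⟨h, hl⟩
    · show arcCurr s _ + arcCurr s _ = 0
      rw [arcCurr_of_ne (half_ne_zero s), half_add_half]
    · exact absurd (isVortex_head_letterArc hs z) hv
    · rw [hF.degree_head_of_unlabeled h hl] at h1; omega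
  · intro v hv
    obtain ⟨d, rfl⟩ := hhead v
    obtain ⟨z, rfl⟩ := hF.isSome_label_of_isVortex hs hv
    exact htype z
  · intro d hv
    obtain ⟨z, rfl⟩ := hF.isSome_label_of_isVortex hs hv
    show (arcLabel s _).isSome
    rw [(arcLabel_eq_some_iff hs).2 rfl]
    rfl
  · intro d d' z h h'
    rw [← (arcLabel_eq_some_iff hs).1 h, ← (arcLabel_eq_some_iff hs).1 h']

theorem two_mul_eps : 2 * (6 * s + 5 : ZMod (12 * s + 6)) = 4 := by
  linear_combination natCast_card_eq_zero s

theorem vortexConstraints (hF : IsLog s F) (hs : 2 ≤ s) :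
    VortexConstraints (logGraph F) (6 * s - 2) 1 (6 * s + 5) := by
  obtain ⟨pos, h4, hlt, hpos, hcx⟩ := hF.exists_pos
  have e1 : F 4 = 6 * s + 5 := hF.apply_letterArc .a
  have e2 : (F ^ 2) 4 = -(6 * s + 5) := by
    rw [pow_two, Perm.mul_apply, e1]
    exact hF.apply_letterArc .y
  have e3 : (F ^ 3) 4 = -(6 * s - 2) := by
    rw [pow_succ', Perm.mul_apply, e2]
    exact hF.apply_letterArc .b
  have hl : ∀ z, (logGraph F).label (letterArc s z) = some z := fun z =>
    (arcLabel_eq_some_iff hs).2 rfl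
  have hc : ∀ z, (logGraph F).curr (letterArc s z) = letterArc s z := fun z =>
    arcCurr_of_ne (letterArc_ne_zero hs z)
  have inj := letterArc_injective hs
  have ec := pow_pos_apply h4 hpos (6 * s - 2)
  have ex := pow_pos_apply h4 hpos 1
  refine ⟨?_, _, _, _, 4, hF.isV1_head_x hs, hF.excess_head_x hs, hF.isV1_head_y hs,
    hF.excess_head_y hs, hF.isV3_head_a hs, rfl, ?_, hl .a, ?_⟩
  · have : (6 * s + 5 : ZMod (12 * s + 6)) = ((6 * s + 5 : ℕ) : ZMod (12 * s + 6)) := by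
      push_cast; ring
    rw [this, ZMod.val_natCast_of_lt (by omega)]
    omega
  · rw [two_mul_eps]; exact hc .a
  rw [logGraph_face, e1, e2]
  refine ⟨rfl, hc .y, hl .y, hF.head_b hs, hc .b, hl .b, pos (6 * s - 2), pos 1, ?_, hcx, ?_,
    ?_, ?_, ?_, ?_, ?_⟩
  · -- the first three arcs of the log are not the arc with letter `c`
    by_contra hle
    have : pos (6 * s - 2 : ZMod (12 * s + 6)) = 0 ∨ pos (6 * s - 2 : ZMod (12 * s + 6)) = 1 ∨
      pos (6 * s - 2 : ZMod (12 * s + 6)) = 2 := by omega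
    rcases this with h | h | h <;> rw [h] at ec
    · exact absurd (inj (a₁ := .a) (a₂ := .c) ec) (by simp)
    · rw [pow_one, e1] at ec
      exact absurd (inj (a₁ := .y) (a₂ := .c) ec) (by simp)
    · rw [e2] at ec
      exact absurd (inj (a₁ := .b) (a₂ := .c) ec) (by simp)
  · rw [ZMod.card]; exact hlt 1
  · rw [ec]; exact hF.head_c hs
  · rw [ec]; exact hc .c
  · rw [ec]; exact hl .c
  · rw [ex]; rfl
  · rw [ex]; exact hl .x

end IsLog

end


/-! ### The derived embedding -/

/-- The letters `a`, `b`, `c`, indexed modulo 3. -/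
def cyclicLetter (u : ZMod 3) : Letter := if u = 0 then .a else if u = 1 then .b else .c

/-- Translation of the letters `a`, `b`, `c`. -/
def letterShift (u : ZMod 3) : Letter → Letter
  | .a => cyclicLetter u
  | .b => cyclicLetter (u + 1)
  | .c => cyclicLetter (u + 2)
  | .x => .x
  | .y => .y

theorem letterShift_zero (z : Letter) : letterShift 0 z = z := by
  revert z; decide

theorem letterShift_add (u v : ZMod 3) (z : Letter) :
    letterShift (u + v) z = letterShift u (letterShift v z) := by
  revert u v z; decide

theorem letterShift_succ (u : ZMod 3) (z : Letter) (hz : z = .a ∨ z = .b ∨ z = .c) :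
    letterShift (u + 2) (letterSucc z) = letterShift u z := by
  revert u z; decide

section

variable {s : ℕ}

/-- Translation by `i`, an automorphism of the derived embedding. -/
def vertTranslate (i : ZMod (12 * s + 6)) : Perm (Vert s) :=
  Equiv.sumCongr (Equiv.addRight i)
    { toFun := letterShift (mod3 s i)
      invFun := letterShift (-mod3 s i)
      left_inv := fun z => by rw [← letterShift_add, neg_add_cancel, letterShift_zero]
      right_inv := fun z => by rw [← letterShift_add, add_neg_cancel, letterShift_zero] }

theorem vertTranslate_num (i j : ZMod (12 * s + 6)) : vertTranslate i (num j) = num (j + i) := rfl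

theorem vertTranslate_letter (i : ZMod (12 * s + 6)) (z : Letter) :
    vertTranslate i (letter z) = letter (letterShift (mod3 s i) z) := rfl

theorem vertTranslate_inv_num (i j : ZMod (12 * s + 6)) : (vertTranslate i)⁻¹ (num j) = num (j - i) := by
  rw [Perm.inv_eq_iff_eq, vertTranslate_num, sub_add_cancel]

theorem mod3_eps : mod3 s (6 * s + 5) = 2 := by
  simp only [map_add, map_mul, map_natCast, map_ofNat]
  rw [show (6 : ZMod 3) = 0 from rfl, show (5 : ZMod 3) = 2 from rfl, zero_mul, zero_add]

theorem mod3_gam : mod3 s (6 * s - 2) = 1 := by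
  simp only [map_sub, map_mul, map_natCast, map_ofNat]
  rw [show (6 : ZMod 3) = 0 from rfl, zero_mul]
  rfl

theorem mod3_four : mod3 s 4 = 1 := by
  rw [map_ofNat]; rfl

/-- The rotation at the letters `a`, `b`, `c` adds `4`, `γ`, `-ε` in turn. -/
def vortexStep (u : ZMod 3) : ZMod (12 * s + 6) :=
  if u = 0 then 4 else if u = 1 then 6 * s - 2 else -(6 * s + 5)

theorem mod3_vortexStep (u : ZMod 3) : mod3 s (vortexStep u) = 1 := by
  unfold vortexStep
  split_ifs
  · exact mod3_four
  · exact mod3_gam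
  · rw [map_neg, mod3_eps]; rfl

/-- The rotation at the letter `cyclicLetter t`. -/
noncomputable def vortexRot (t : ZMod 3) : Perm (ZMod (12 * s + 6)) :=
  Equiv.ofBijective (fun j => j + vortexStep (mod3 s j - t)) <| Finite.injective_iff_bijective.1
    fun j j' h => by
      have := congrArg (mod3 s) h
      simp only [map_add, mod3_vortexStep, add_left_inj] at this
      simpa only [this, add_left_inj] using h

theorem vortexRot_apply (t : ZMod 3) (j : ZMod (12 * s + 6)) :
    vortexRot t j = j + vortexStep (mod3 s j - t) := rfl

theorem mod3_vortexRot (t : ZMod 3) (j : ZMod (12 * s + 6)) :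
    mod3 s (vortexRot t j) = mod3 s j + 1 := by
  rw [vortexRot_apply, map_add, mod3_vortexStep]

theorem vortexRot_three (t : ZMod 3) (j : ZMod (12 * s + 6)) :
    vortexRot t (vortexRot t (vortexRot t j)) = j - 3 := by
  have h : ∀ u : ZMod 3, (vortexStep u + vortexStep (u + 1) + vortexStep (u + 1 + 1) :
      ZMod (12 * s + 6)) = -3 := by
    intro u
    have hu : u = 0 ∨ u = 1 ∨ u = 2 := by revert u; decide
    have e1 : (1 + 1 : ZMod 3) ≠ 0 := by decide
    have e2 : (1 + 1 : ZMod 3) ≠ 1 := by decide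
    have e3 : (1 + 1 + 1 : ZMod 3) = 0 := by decide
    have e4 : (2 + 1 : ZMod 3) = 0 := by decide
    have e5 : (2 : ZMod 3) ≠ 0 := by decide
    have e6 : (2 : ZMod 3) ≠ 1 := by decide
    rcases hu with rfl | rfl | rfl <;> simp [vortexStep, e1, e2, e3, e4, e5, e6] <;> ring
  rw [vortexRot_apply t (vortexRot t (vortexRot t j)), mod3_vortexRot, mod3_vortexRot,
    vortexRot_apply t (vortexRot t j), mod3_vortexRot, vortexRot_apply t j]
  have := h (mod3 s j - t)
  rw [show mod3 s j - t + 1 + 1 = mod3 s j + 1 + 1 - t by ring,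
    show mod3 s j - t + 1 = mod3 s j + 1 - t by ring] at this
  linear_combination this

theorem vortexRot_sameCycle (t : ZMod 3) (j j' : ZMod (12 * s + 6)) :
    (vortexRot t).SameCycle j j' := by
  have three : ∀ k : ℤ, ∀ j : ZMod (12 * s + 6), (vortexRot t).SameCycle j (j + k * 3) := by
    have one : ∀ j : ZMod (12 * s + 6), (vortexRot t).SameCycle j (j - 3) := fun j =>
      ⟨3, by rw [← vortexRot_three t]; rfl⟩
    intro k
    induction k using Int.induction_on with
    | zero => intro j; simpa using Perm.SameCycle.refl _ _
    | succ k ih =>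
      intro j
      refine (ih j).trans ?_
      have := (one (j + ((k + 1 : ℤ) : ZMod (12 * s + 6)) * 3)).symm
      convert this using 1
      push_cast
      ring
    | pred k ih =>
      intro j
      refine (ih j).trans ?_
      convert one (j + ((-k : ℤ) : ZMod (12 * s + 6)) * 3) using 1
      push_cast
      ring
  have same : ∀ j j' : ZMod (12 * s + 6), mod3 s j = mod3 s j' →
      (vortexRot t).SameCycle j j' := fun j j' h => by
    obtain ⟨k, hk⟩ := exists_three_mul_of_mod3_eq_zero s (d := j' - j) (by rw [map_sub, h, sub_self])
    have := three k j
    rwa [← hk, add_sub_cancel] at this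
  have shift : ∀ j : ZMod (12 * s + 6), (vortexRot t).SameCycle j (vortexRot t j) := fun j => ⟨1, rfl⟩
  have hu : ∀ u v : ZMod 3, u = v ∨ u + 1 = v ∨ u + 1 + 1 = v := by decide
  rcases hu (mod3 s j) (mod3 s j') with h | h | h
  · exact same _ _ h
  · exact (shift j).trans (same _ _ (by rw [mod3_vortexRot, h]))
  · exact (shift j).trans ((shift _).trans (same _ _ (by rw [mod3_vortexRot, mod3_vortexRot, h])))

/-- The rotation at a letter. -/
noncomputable def letterRot : Letter → Perm (ZMod (12 * s + 6))
  | .a => vortexRot 0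
  | .b => vortexRot 1
  | .c => vortexRot 2
  | .x => Equiv.addRight 1
  | .y => Equiv.addRight (6 * s + 5)

theorem letterRot_cyclicLetter (u : ZMod 3) :
    letterRot (cyclicLetter u) = vortexRot (s := s) u := by
  have hu : u = 0 ∨ u = 1 ∨ u = 2 := by revert u; decide
  rcases hu with rfl | rfl | rfl <;> rfl

theorem addRight_sameCycle {e : ZMod (12 * s + 6)} (he : AddSubgroup.zmultiples e = ⊤)
    (j j' : ZMod (12 * s + 6)) : (Equiv.addRight e).SameCycle j j' := by
  have : j' - j ∈ AddSubgroup.zmultiples e := he ▸ AddSubgroup.mem_top _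
  obtain ⟨k, hk⟩ := this
  refine ⟨k, ?_⟩
  have hk' : ∀ k : ℤ, ((Equiv.addRight e : Perm (ZMod (12 * s + 6))) ^ k) j = j + k • e := by
    intro k
    induction k using Int.induction_on with
    | zero => simp
    | succ k ih =>
      rw [add_comm (k : ℤ) 1, zpow_add, zpow_one, Perm.mul_apply, ih, coe_addRight, add_smul, one_smul]
      ring
    | pred k ih =>
      rw [sub_eq_add_neg, add_comm (-(k : ℤ)), zpow_add, zpow_neg_one, Perm.mul_apply, ih,
        Perm.inv_eq_iff_eq, coe_addRight]
      show _ = j + _ + e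
      rw [add_smul, neg_smul 1 e, one_smul]
      ring
  rw [hk']
  rw [show k • e = j' - j from hk, add_sub_cancel]

theorem letterRot_sameCycle (z : Letter) (j j' : ZMod (12 * s + 6)) :
    (letterRot z).SameCycle j j' := by
  cases z
  · exact vortexRot_sameCycle _ _ _
  · exact vortexRot_sameCycle _ _ _
  · exact vortexRot_sameCycle _ _ _
  · exact addRight_sameCycle (zmultiples_one s) _ _
  · exact addRight_sameCycle (zmultiples_eps s) _ _

theorem letterRot_letterShift (i : ZMod (12 * s + 6)) (z : Letter) :
    letterRot (letterShift (mod3 s i) z) (i + letterNext s z) = i := by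
  have h0 : (2 - 2 : ZMod 3) = 0 := by decide
  have h1 : (2 - 1 : ZMod 3) = 1 := by decide
  have e1 : (1 : ZMod 3) ≠ 0 := by decide
  have e2 : (2 : ZMod 3) ≠ 0 := by decide
  have e3 : (2 : ZMod 3) ≠ 1 := by decide
  have e4 : (-1 : ZMod 3) = 2 := by decide
  cases z
  · rw [letterShift, letterRot_cyclicLetter, vortexRot_apply, letterNext, map_add, mod3_eps,
      add_sub_cancel_left, vortexStep, if_neg e2, if_neg e3]
    ring
  · rw [letterShift, letterRot_cyclicLetter, vortexRot_apply, letterNext, map_add, map_neg,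
      mod3_gam, e4, add_sub_add_left_eq_sub, h1, vortexStep, if_neg e1, if_pos rfl]
    ring
  · rw [letterShift, letterRot_cyclicLetter, vortexRot_apply, letterNext, map_add, map_neg,
      mod3_four, e4, add_sub_add_left_eq_sub, h0, vortexStep, if_pos rfl]
    ring
  · show i + -1 + 1 = i
    ring
  · show i + -(6 * s + 5) + (6 * s + 5) = i
    ring

/-- The log without the arc that leaves the dead end. -/
def nextArc (F : Perm (ZMod (12 * s + 6))) : Perm (ZMod (12 * s + 6)) := swap 0 (F 0) * F

/-- The rotation at vertex `0`: the log with its letters. -/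
def baseNext (F : Perm (ZMod (12 * s + 6))) : Vert s → Vert s
  | .inl d => match arcLabel s d with
    | some z => letter z
    | none => num (nextArc F d)
  | .inr z => num (letterNext s z)

theorem baseNext_letter (F : Perm (ZMod (12 * s + 6))) (z : Letter) :
    baseNext F (letter z) = num (letterNext s z) := rfl

theorem baseNext_of_none (F : Perm (ZMod (12 * s + 6))) {d : ZMod (12 * s + 6)}
    (h : arcLabel s d = none) : baseNext F (num d) = num (nextArc F d) := by
  simp only [baseNext, h]

theorem baseNext_letterArc (hs : 2 ≤ s) (F : Perm (ZMod (12 * s + 6))) (z : Letter) :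
    baseNext F (num (letterArc s z)) = letter z := by
  simp only [baseNext, (arcLabel_eq_some_iff hs).2 rfl]

namespace IsLog

variable {F : Perm (ZMod (12 * s + 6))}

theorem arcLabel_zero (hs : 2 ≤ s) : arcLabel s 0 = none := by
  rcases letterArc_cases (d := (0 : ZMod (12 * s + 6))) hs with ⟨z, hz⟩ | h
  · exact absurd hz.symm (letterArc_ne_zero hs z)
  · exact h

theorem arcLabel_half (hs : 2 ≤ s) : arcLabel s (half s) = none := by
  rcases letterArc_cases (d := half s) hs with ⟨z, hz⟩ | h
  · exact absurd hz.symm (letterArc_ne_half hs z)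
  · exact h

theorem apply_eq_zero_iff (hF : IsLog s F) {d : ZMod (12 * s + 6)} : F d = 0 ↔ d = half s :=
  ⟨fun h => F.injective (h.trans hF.apply_half.symm), fun h => h ▸ hF.apply_half⟩

theorem nextArc_zero (F : Perm (ZMod (12 * s + 6))) : nextArc F 0 = 0 := by simp [nextArc]

theorem nextArc_half (hF : IsLog s F) : nextArc F (half s) = F 0 := by
  simp [nextArc, hF.apply_half]

theorem nextArc_of_ne (hF : IsLog s F) {d : ZMod (12 * s + 6)} (h0 : d ≠ 0) (h : d ≠ half s) :
    nextArc F d = F d :=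
  swap_apply_of_ne_of_ne (fun e => h (hF.apply_eq_zero_iff.1 e)) fun e => h0 (F.injective e)

theorem nextArc_letterArc (hF : IsLog s F) (hs : 2 ≤ s) (z : Letter) :
    nextArc F (letterArc s z) = letterNext s z := by
  rw [hF.nextArc_of_ne (letterArc_ne_zero hs z) (letterArc_ne_half hs z), hF.apply_letterArc]

theorem baseNext_injective (hF : IsLog s F) (hs : 2 ≤ s) : Function.Injective (baseNext F) := by
  have mixed : ∀ d z, arcLabel s d = none → baseNext F (num d) ≠ baseNext F (letter z) := by
    intro d z h e
    rw [baseNext_of_none F h, baseNext_letter, ← hF.nextArc_letterArc hs] at e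
    have := (nextArc F).injective (Sum.inl.inj e)
    rw [this, (arcLabel_eq_some_iff hs).2 rfl] at h
    exact absurd h (by simp)
  rintro (d | z) (d' | z') e
  · rcases letterArc_cases (d := d) hs with ⟨z, rfl⟩ | h <;>
      rcases letterArc_cases (d := d') hs with ⟨z', rfl⟩ | h'
    · rw [baseNext_letterArc hs, baseNext_letterArc hs] at e
      rw [Sum.inr.inj e]
    · rw [baseNext_letterArc hs, baseNext_of_none F h'] at e
      simp at e
    · rw [baseNext_letterArc hs, baseNext_of_none F h] at e
      simp at e
    · rw [baseNext_of_none F h, baseNext_of_none F h'] at e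
      rw [(nextArc F).injective (Sum.inl.inj e)]
  · rcases letterArc_cases (d := d) hs with ⟨z, rfl⟩ | h
    · rw [baseNext_letterArc hs] at e
      simp [baseNext] at e
    · exact absurd e (mixed d z' h)
  · rcases letterArc_cases (d := d') hs with ⟨z', rfl⟩ | h
    · rw [baseNext_letterArc hs] at e
      simp [baseNext] at e
    · exact absurd e.symm (mixed d' z h)
  · have := Sum.inl.inj e
    rw [← hF.nextArc_letterArc hs, ← hF.nextArc_letterArc hs] at this
    rw [letterArc_injective hs ((nextArc F).injective this)]

/-- `baseNext` as a permutation. -/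
noncomputable def baseRot (hF : IsLog s F) (hs : 2 ≤ s) : Perm (Vert s) :=
  Equiv.ofBijective (baseNext F) (Finite.injective_iff_bijective.1 (hF.baseNext_injective hs))

theorem baseRot_apply (hF : IsLog s F) (hs : 2 ≤ s) (v : Vert s) :
    hF.baseRot hs v = baseNext F v := rfl

theorem baseRot_isCycleOn (hF : IsLog s F) (hs : 2 ≤ s) :
    (hF.baseRot hs).IsCycleOn {v | v ≠ num 0} := by
  have hnext : (nextArc F).IsCycleOn (Set.univ \ {0}) :=
    Perm.IsCycleOn.erase_swap (Perm.isCycleOn_of (by simp) fun d _ e _ => hF.sameCycle d e)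
      (Set.mem_univ 0)
  have h0 : hF.baseRot hs (num 0) = num 0 := by
    rw [baseRot_apply, baseNext_of_none F (arcLabel_zero hs), nextArc_zero]
  have hz : ∀ z, (hF.baseRot hs).SameCycle (letter z) (num (letterNext s z)) := fun z => ⟨1, rfl⟩
  have step : ∀ d, (hF.baseRot hs).SameCycle (num d) (num (nextArc F d)) := fun d => by
    rcases letterArc_cases (d := d) hs with ⟨z, rfl⟩ | h
    · rw [hF.nextArc_letterArc hs]
      exact Perm.SameCycle.trans ⟨1, baseNext_letterArc hs F z⟩ (hz z)
    · exact ⟨1, baseNext_of_none F h⟩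
  have num_num : ∀ d e : ZMod (12 * s + 6), d ≠ 0 → e ≠ 0 →
      (hF.baseRot hs).SameCycle (num d) (num e) := fun d e hd he =>
    (hnext.2 ⟨Set.mem_univ _, hd⟩ ⟨Set.mem_univ _, he⟩).map_of_forall num step
  refine Perm.isCycleOn_of (fun v => not_congr ?_) ?_
  · conv_lhs => rw [← h0]
    exact (hF.baseRot hs).injective.eq_iff
  · have main : ∀ v : Vert s, v ≠ num 0 → (hF.baseRot hs).SameCycle v (num (half s)) := by
      rintro (d | z) hv
      · exact num_num _ _ (fun h => hv (congrArg num h)) (half_ne_zero s)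
      · exact (hz z).trans (num_num _ _ (letterNext_ne_zero hs z) (half_ne_zero s))
    exact fun v hv w hw => (main v hv).trans (main w hw).symm

/-- The derived embedding. -/
noncomputable def derived (hF : IsLog s F) (hs : 2 ≤ s) : RotationSystem (Vert s) where
  graph := completeMinusLetters s
  rot
    | .inl i => vertTranslate i * hF.baseRot hs * (vertTranslate i)⁻¹
    | .inr z => Equiv.sumCongr (letterRot z) (Equiv.refl _)
  rot_cyclic v := by
    rcases v with i | z
    · have := (hF.baseRot_isCycleOn hs).conj (g := vertTranslate i)
      convert this using 1
      ext v
      rw [show (⇑(vertTranslate i) '' {v | v ≠ num 0}) = {v | (vertTranslate i)⁻¹ v ≠ num 0} from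
        (vertTranslate i).image_eq_preimage_symm _, Set.mem_ofPred_eq, SimpleGraph.mem_neighborSet]
      show (num i ≠ v ∧ ¬ (_ ∧ _)) ↔ (vertTranslate i)⁻¹ v ≠ num 0
      rw [ne_eq ((vertTranslate i)⁻¹ v), Perm.inv_eq_iff_eq, vertTranslate_num, zero_add]
      exact ⟨fun h e => h.1 e.symm, fun h => ⟨fun e => h e.symm, by simp⟩⟩
    · have hn : ∀ v, v ∈ (completeMinusLetters s).neighborSet (letter z) ↔ ∃ j, v = num j := by
        rintro (j | z') <;> simp [completeMinusLetters]
      refine Perm.isCycleOn_of ?_ ?_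
      · rintro (j | z') <;> rw [hn, hn] <;> simp
      · intro v hv w hw
        obtain ⟨j, rfl⟩ := (hn v).1 hv
        obtain ⟨j', rfl⟩ := (hn w).1 hw
        exact (letterRot_sameCycle z j j').map_of_forall num fun w => ⟨1, rfl⟩
  rot_fixed v w h := by
    rcases v with i | z
    · obtain rfl : w = num i := by
        by_contra hw
        exact h ⟨fun e => hw e.symm, by simp⟩
      rw [Perm.mul_apply, Perm.mul_apply, vertTranslate_inv_num, sub_self, baseRot_apply,
        baseNext_of_none F (arcLabel_zero hs), nextArc_zero, vertTranslate_num, zero_add]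
    · rcases w with j | z'
      · exact absurd ⟨by simp, by simp⟩ h
      · rfl

theorem derived_num (hF : IsLog s F) (hs : 2 ≤ s) (i d : ZMod (12 * s + 6)) :
    (hF.derived hs).rot (num i) (num (i + d)) = vertTranslate i (baseNext F (num d)) := by
  show vertTranslate i (hF.baseRot hs ((vertTranslate i)⁻¹ (num (i + d)))) = _
  rw [vertTranslate_inv_num, add_sub_cancel_left, baseRot_apply]

/-- At the vertex `i` the arc that precedes a corner with a letter is followed by that letter; the
letters of the vortex of degree 3 are permuted according to `i` modulo 3. -/
theorem derived_letterArc (hF : IsLog s F) (hs : 2 ≤ s) (i : ZMod (12 * s + 6)) (z : Letter) :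
    (hF.derived hs).rot (num i) (num (i + letterArc s z)) = letter (letterShift (mod3 s i) z) := by
  rw [derived_num, baseNext_letterArc hs, vertTranslate_letter]

theorem derived_letterShift (hF : IsLog s F) (hs : 2 ≤ s) (i : ZMod (12 * s + 6)) (z : Letter) :
    (hF.derived hs).rot (num i) (letter (letterShift (mod3 s i) z)) = num (i + letterNext s z) := by
  show vertTranslate i (hF.baseRot hs ((vertTranslate i)⁻¹ (letter (letterShift (mod3 s i) z)))) = _
  rw [← vertTranslate_letter, show (vertTranslate i)⁻¹ (vertTranslate i (letter z)) = letter z from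
    (vertTranslate i).symm_apply_apply _, baseRot_apply, baseNext_letter, vertTranslate_num,
    add_comm]

theorem derived_letter (hF : IsLog s F) (hs : 2 ≤ s) (i : ZMod (12 * s + 6)) (z : Letter) :
    (hF.derived hs).rot (letter (letterShift (mod3 s i) z)) (num (i + letterNext s z)) = num i :=
  congrArg num (letterRot_letterShift i z)

theorem derived_of_unlabeled (hF : IsLog s F) (hs : 2 ≤ s) (i : ZMod (12 * s + 6))
    {d : ZMod (12 * s + 6)} (h : d ≠ half s) (hl : arcLabel s d = none) :
    (hF.derived hs).rot (num i) (num (i + arcCurr s d)) = num (i + arcCurr s (F d)) := by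
  have hne : F d ≠ 0 := fun e => h (hF.apply_eq_zero_iff.1 e)
  rw [derived_num, arcCurr_of_ne hne]
  by_cases h0 : d = 0
  · rw [h0, arcCurr_zero, baseNext_of_none F (arcLabel_half hs), hF.nextArc_half, vertTranslate_num,
      add_comm]
  · rw [arcCurr_of_ne h0, baseNext_of_none F hl, hF.nextArc_of_ne h0 h, vertTranslate_num, add_comm]

/-- An arc that enters a vertex at a corner without a letter is followed, in the rotation of that
vertex, by another such arc. -/
theorem arcLabel_arcRev_apply (hF : IsLog s F) (hs : 2 ≤ s) {d : ZMod (12 * s + 6)}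
    (hl : arcLabel s d = none) : arcLabel s (arcRev s (F d)) = none := by
  rcases letterArc_cases (d := arcRev s (F d)) hs with ⟨z, hz⟩ | h
  · obtain ⟨z', rfl⟩ : ∃ z', letterSucc z' = z := by
      cases z
      exacts [⟨.c, rfl⟩, ⟨.a, rfl⟩, ⟨.b, rfl⟩, ⟨.x, rfl⟩, ⟨.y, rfl⟩]
    rw [← arcRev_letterNext hs] at hz
    have h1 : F d = letterNext s z' := by
      rw [← arcRev_arcRev (F d), hz, arcRev_arcRev]
    rw [← hF.apply_letterArc] at h1
    rw [F.injective h1, (arcLabel_eq_some_iff hs).2 rfl] at hl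
    exact absurd hl (by simp)
  · exact h

/-- The end of an arc that leaves a corner at the vertex `i` sees, at the next corner of the vortex,
the letter that `i` sees at this corner. So the corners of one face receive the same letter. -/
theorem letterShift_add_letterNext (i : ZMod (12 * s + 6)) (z : Letter) :
    letterShift (mod3 s (i + letterNext s z)) (letterSucc z) = letterShift (mod3 s i) z := by
  have e : (-1 : ZMod 3) = 2 := by decide
  rw [map_add]
  cases z
  · rw [letterNext, mod3_eps, letterShift_succ _ _ (by simp)]
  · rw [letterNext, map_neg, mod3_gam, e, letterShift_succ _ _ (by simp)]
  · rw [letterNext, map_neg, mod3_four, e, letterShift_succ _ _ (by simp)]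
  · rfl
  · rfl

theorem isDerived (hF : IsLog s F) (hs : 2 ≤ s) : (logGraph F).IsDerived (hF.derived hs) := by
  have hlab : ∀ z, arcLabel s (letterArc s z) = some z := fun z => (arcLabel_eq_some_iff hs).2 rfl
  have hcn : ∀ z, arcCurr s (letterNext s z) = letterNext s z := fun z =>
    arcCurr_of_ne (letterNext_ne_zero hs z)
  refine ⟨fun i d => (arcLabel s d).map (letterShift (mod3 s i)), fun d => ?_, fun i d => ?_,
    fun i d => ?_, fun i d h hne => ?_, fun i d z h => ?_⟩
  · show (arcLabel s d).map _ = arcLabel s d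
    rw [map_zero, show letterShift 0 = id from funext letterShift_zero, Option.map_id_fun, id]
  · exact Option.isSome_map
  · rw [logGraph_face]
    show (arcLabel s (arcRev s (F d))).map (letterShift (mod3 s (i + arcCurr s (F d)))) =
      (arcLabel s d).map (letterShift (mod3 s i))
    rcases letterArc_cases (d := d) hs with ⟨z, rfl⟩ | hl
    · rw [hF.apply_letterArc, arcRev_letterNext hs, hcn, hlab, hlab, Option.map_some,
        Option.map_some, letterShift_add_letterNext]
    · rw [hF.arcLabel_arcRev_apply hs hl, hl, Option.map_none, Option.map_none]
  · rw [logGraph_face] at hne ⊢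
    have hl : arcLabel s d = none := Option.map_eq_none_iff.1 h
    refine hF.derived_of_unlabeled hs i ?_ hl
    rintro rfl
    apply hne
    show arcCurr s (F (half s)) = arcCurr s (half s)
    rw [hF.apply_half, arcCurr_zero, arcCurr_of_ne (half_ne_zero s)]
  · rw [logGraph_face]
    obtain ⟨z', hz', rfl⟩ := Option.map_eq_some_iff.1 h
    obtain rfl := (arcLabel_eq_some_iff hs).1 hz'
    show (hF.derived hs).rot (num i) (num (i + arcCurr s (letterArc s z'))) = _ ∧
      (hF.derived hs).rot (num i) _ = num (i + arcCurr s (F (letterArc s z'))) ∧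
      (hF.derived hs).rot _ (num (i + arcCurr s (F (letterArc s z')))) = num i
    rw [arcCurr_of_ne (letterArc_ne_zero hs z'), hF.apply_letterArc, hcn]
    exact ⟨hF.derived_letterArc hs i z', hF.derived_letterShift hs i z',
      hF.derived_letter hs i z'⟩

/-- Each corner of the derived embedding belongs to a triangle: a corner with a letter to one that
comes from an edge of the face subdivided by this letter, every other corner to one that comes
from a vertex where Kirchhoff's current law holds. -/
theorem derived_pairPerm_pow_three (hF : IsLog s F) (hs : 2 ≤ s) {u v : Vert s}
    (h : (completeMinusLetters s).Adj u v) :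
    ((hF.derived hs).pairPerm ^ 3) (u, v) = (u, v) := by
  set P := (hF.derived hs).pairPerm with hP
  have happ : ∀ u v, P (u, v) = (v, (hF.derived hs).rot v u) := fun _ _ => rfl
  have hthree : ∀ p, (P ^ 3) p = P (P (P p)) := fun p => rfl
  have back : ∀ p, (P ^ 3) (P p) = P p → (P ^ 3) p = p := fun p hp => by
    apply P.injective
    rw [← Perm.mul_apply, ← pow_succ', pow_succ, Perm.mul_apply, hp]
  have case1 : ∀ z i, (P ^ 3) (letter (letterShift (mod3 s i) z), num i) =
      (letter (letterShift (mod3 s i) z), num i) := fun z i => by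
    have e : num i = (num (i + letterNext s z + letterArc s (letterSucc z)) : Vert s) := by
      rw [letterNext_eq_neg]; congr 1; ring
    have a1 : P (letter (letterShift (mod3 s i) z), num i) =
        (num i, num (i + letterNext s z)) := by
      rw [happ, derived_letterShift]
    have a2 : P (num i, num (i + letterNext s z)) =
        (num (i + letterNext s z), letter (letterShift (mod3 s i) z)) := by
      rw [happ]
      conv_lhs => rw [e]
      rw [derived_letterArc, letterShift_add_letterNext]
    have a3 : P (num (i + letterNext s z), letter (letterShift (mod3 s i) z)) =
        (letter (letterShift (mod3 s i) z), num i) := by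
      rw [happ, derived_letter]
    rw [hthree, a1, a2, a3]
  have case1' : ∀ z i, (P ^ 3) (letter z, num i) = (letter z, num i) := fun z i => by
    have := case1 (letterShift (-mod3 s i) z) i
    rwa [← letterShift_add, add_neg_cancel, letterShift_zero] at this
  have case2 : ∀ z i, (P ^ 3) (num i, letter z) = (num i, letter z) := fun z i => by
    apply back
    obtain ⟨j, hj⟩ : ∃ j, (hF.derived hs).rot (letter z) (num i) = num j := ⟨letterRot z i, rfl⟩
    rw [happ, hj]
    exact case1' z j
  have case3 : ∀ i d, d ≠ half s → arcLabel s d = none →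
      (P ^ 3) (num (i + arcCurr s d), num i) = (num (i + arcCurr s d), num i) := by
    intro i d hd hl
    obtain ⟨-, h2, h3⟩ := hF.vertex d hd hl
    have hrev : ∀ e, e ≠ half s → arcRev s (F e) ≠ half s := fun e he h => he <| by
      rw [← hF.apply_eq_zero_iff, ← arcRev_arcRev (F e), h, arcRev_half]
    have hl2 := hF.arcLabel_arcRev_apply hs hl
    have hd2 := hrev d hd
    have hl3 := hF.arcLabel_arcRev_apply hs hl2
    have hd3 := hrev _ hd2
    have e1 : num i = (num (i + arcCurr s (F d) + arcCurr s (arcRev s (F d))) : Vert s) := by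
      rw [arcCurr_arcRev]; congr 1; ring
    have e2 : num (i + arcCurr s (F d)) = (num (i + arcCurr s d +
        arcCurr s (arcRev s (F (arcRev s (F d))))) : Vert s) := by
      rw [arcCurr_arcRev, ← h3]; congr 1; ring
    have e3 : i + arcCurr s (F d) + arcCurr s (F (arcRev s (F d))) = i + arcCurr s d := by
      rw [← h3]; ring
    have r1 : P (num (i + arcCurr s d), num i) = (num i, num (i + arcCurr s (F d))) := by
      rw [happ, hF.derived_of_unlabeled hs i hd hl]
    have r2 : P (num i, num (i + arcCurr s (F d))) =
        (num (i + arcCurr s (F d)), num (i + arcCurr s d)) := by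
      rw [happ]
      conv_lhs => rw [e1]
      rw [hF.derived_of_unlabeled hs _ hd2 hl2, e3]
    have r3 : P (num (i + arcCurr s (F d)), num (i + arcCurr s d)) =
        (num (i + arcCurr s d), num i) := by
      rw [happ]
      conv_lhs => rw [e2]
      rw [hF.derived_of_unlabeled hs _ hd3 hl3, h2, arcCurr_arcRev]
      congr 2
      ring
    rw [hthree, r1, r2, r3]
  rcases u with j | z <;> rcases v with i | z'
  · obtain ⟨d, rfl⟩ : ∃ d, j = i + d := ⟨j - i, by ring⟩
    have hd0 : d ≠ 0 := by
      rintro rfl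
      exact h.1 (by rw [add_zero])
    rcases letterArc_cases (d := d) hs with ⟨z, rfl⟩ | hl
    · apply back
      show (P ^ 3) (P (num _, num i)) = P (num _, num i)
      rw [happ, derived_letterArc]
      exact case2 _ _
    · by_cases hd : d = half s
      · have := case3 i 0 (half_ne_zero s).symm (arcLabel_zero hs)
        rw [arcCurr_zero, ← hd] at this
        exact this
      · have := case3 i d hd hl
        rw [arcCurr_of_ne hd0] at this
        exact this
  · exact case2 _ _
  · exact case1' _ _
  · exact absurd ⟨rfl, rfl⟩ h.2

theorem derived_isTriangular (hF : IsLog s F) (hs : 2 ≤ s) : (hF.derived hs).IsTriangular := by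
  intro d
  apply SimpleGraph.Dart.ext
  have := (hF.derived hs).facePerm_zpow_toProd 3 d
  exact this.trans (hF.derived_pairPerm_pow_three hs d.adj)

end IsLog

end


/-! ### The completion of the derived embedding -/

namespace Pt

instance : Fintype Pt :=
  ⟨{.o, .g, .mg, .e2, .md, .me, .ge, .ge2, .p, .q, .a, .b, .c, .x, .y},
    fun z => by cases z <;> decide⟩

/-- The triangles `[u, v, w]` that make up `derivedTable`. -/
def derivedTriangles : List (Pt × Pt × Pt) :=
  [(g, o, c), (e2, o, a), (me, o, b), (b, o, mg), (x, o, md), (y, o, me), (ge2, g, b), (b, g, ge),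
    (q, mg, x), (x, mg, p), (ge2, ge, y), (a, ge, ge2), (q, p, me), (p, q, o)]

theorem mem_derivedTriangles : ∀ v u w, derivedTable v u = some w →
    (v.isLetter ∧ u.isLetter ∧ w = u) ∨ (u, v, w) ∈ derivedTriangles ∨
      (v, w, u) ∈ derivedTriangles ∨ (w, u, v) ∈ derivedTriangles := by
  decide +kernel

/-- Integers that represent the numbered vertices. -/
def toInt (s : ℤ) : Pt → ℤ
  | o => 0
  | g => 6 * s - 2
  | mg => 6 * s + 8
  | e2 => 4
  | md => 12 * s + 5
  | me => 6 * s + 1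
  | ge => 12 * s + 3
  | ge2 => 6 * s + 2
  | p => 6 * s + 7
  | q => 6 * s + 9
  | _ => 0

section

variable {s : ℕ}

local notation "ι" => Pt.toVert (s := s) (6 * s - 2) 1 (6 * s + 5)

theorem toVert_eq_num {u : Pt} (h : u.isLetter = false) :
    ι u = num ((u.toInt s : ℤ) : ZMod (12 * s + 6)) := by
  have hn := natCast_card_eq_zero s
  cases u <;> simp only [isLetter, reduceCtorEq] at h <;>
    refine congrArg Sum.inl ?_ <;> simp only [toInt] <;> push_cast
  case e2 => linear_combination hn
  case mg => linear_combination -hn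
  case md => linear_combination -hn
  case me => linear_combination -hn
  case ge2 => linear_combination hn
  case p => linear_combination -hn
  case q => linear_combination -hn
  all_goals ring

theorem toVert_injective (hs : 2 ≤ s) : Function.Injective ι := by
  have hnum : ∀ u v : Pt, u.isLetter = false → v.isLetter = false → u.toInt s = v.toInt s →
      u = v := fun u v hu hv h => by
    cases u <;> simp only [isLetter, reduceCtorEq] at hu <;>
      cases v <;> first | rfl | exact absurd hv (by decide) |
        (simp only [toInt] at h; omega)
  have hrange : ∀ u : Pt, 0 ≤ u.toInt s ∧ u.toInt s < 12 * s + 6 := fun u => by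
    cases u <;> simp only [toInt] <;> omega
  have hletter : ∀ u : Pt, u.isLetter = true → ∃ z, ι u = letter z := fun u hu => by
    cases u <;> simp only [isLetter, reduceCtorEq] at hu <;> exact ⟨_, rfl⟩
  intro u v h
  cases hu : u.isLetter <;> cases hv : v.isLetter
  · rw [toVert_eq_num hu, toVert_eq_num hv] at h
    have h1 := hrange u
    have h2 := hrange v
    exact hnum u v hu hv (intCast_inj_of_lt (by omega) (by omega) (Sum.inl.inj h))
  · obtain ⟨z, hz⟩ := hletter v hv
    rw [toVert_eq_num hu, hz] at h
    simp at h
  · obtain ⟨z, hz⟩ := hletter u hu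
    rw [toVert_eq_num hv, hz] at h
    simp at h
  · cases u <;> simp only [isLetter, reduceCtorEq] at hu <;>
      cases v <;> first | rfl | exact absurd hv (by decide) |
        exact absurd (Sum.inr.inj h) (by decide)

end

end Pt

namespace IsLog

variable {s : ℕ} {F : Perm (ZMod (12 * s + 6))}

/-- The triangles of the derived embedding may be read from any of their corners. -/
theorem derived_rotate (hF : IsLog s F) (hs : 2 ≤ s) {u v w : Vert s}
    (h : (completeMinusLetters s).Adj u v) (hw : (hF.derived hs).rot v u = w) :
    (hF.derived hs).rot w v = u ∧ (hF.derived hs).rot u w = v := by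
  have h3 := hF.derived_pairPerm_pow_three hs h
  change ((hF.derived hs).rot ((hF.derived hs).rot v u) v,
    (hF.derived hs).rot ((hF.derived hs).rot ((hF.derived hs).rot v u) v)
      ((hF.derived hs).rot v u)) = (u, v) at h3
  rw [hw] at h3
  obtain ⟨h1, h2⟩ := Prod.mk.inj h3
  rw [h1] at h2
  exact ⟨h1, h2⟩

theorem arcLabel_two (hs : 2 ≤ s) : arcLabel s 2 = none ∧ (2 : ZMod (12 * s + 6)) ≠ half s ∧
    (2 : ZMod (12 * s + 6)) ≠ 0 := by
  have e : (2 : ZMod (12 * s + 6)) = ((2 : ℤ) : ZMod (12 * s + 6)) := by simp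
  refine ⟨?_, ?_, ?_⟩
  · rcases letterArc_cases (d := (2 : ZMod (12 * s + 6))) hs with ⟨z, hz⟩ | h
    · obtain ⟨k, hk, hk'⟩ := letterArc_eq_intCast (s := s) z
      rw [hk, e] at hz
      cases z <;> simp only at hk' <;> have := intCast_inj_of_lt (by omega) (by omega) hz <;> omega
    · exact h
  · rw [half_eq_intCast, e]
    exact intCast_ne_of_lt (by omega) (by omega)
  · have := intCast_ne_of_lt (s := s) (a := 0) (b := 2) (by omega) (by omega)
    simpa using this.symm

theorem arcLabel_neg_two (hs : 2 ≤ s) : arcLabel s (-2) = none ∧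
    (-2 : ZMod (12 * s + 6)) ≠ half s ∧ (-2 : ZMod (12 * s + 6)) ≠ 0 := by
  have e : (-2 : ZMod (12 * s + 6)) = ((12 * s + 4 : ℤ) : ZMod (12 * s + 6)) := by
    push_cast
    linear_combination -natCast_card_eq_zero s
  refine ⟨?_, ?_, ?_⟩
  · rcases letterArc_cases (d := (-2 : ZMod (12 * s + 6))) hs with ⟨z, hz⟩ | h
    · obtain ⟨k, hk, hk'⟩ := letterArc_eq_intCast (s := s) z
      rw [hk, e] at hz
      cases z <;> simp only at hk' <;> have := intCast_inj_of_lt (by omega) (by omega) hz <;> omega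
    · exact h
  · rw [half_eq_intCast, e]
    exact (intCast_ne_of_lt (by omega) (by omega)).symm
  · exact neg_ne_zero.2 (arcLabel_two hs).2.2

/-- The derived embedding has the 42 corners which the completion relies on. -/
theorem derivedTable_agrees (hF : IsLog s F) (hs : 2 ≤ s) :
    Pt.derivedTable.Agrees (Pt.toVert (6 * s - 2) 1 (6 * s + 5)) (hF.derived hs) := by
  set ι : Pt → Vert s := Pt.toVert (6 * s - 2) 1 (6 * s + 5)
  set R := hF.derived hs with hR
  have hn := natCast_card_eq_zero s
  have arc : ∀ (i j : ZMod (12 * s + 6)) (z z' : Letter), j = i + letterArc s z →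
      letterShift (mod3 s i) z = z' → R.rot (num i) (num j) = letter z' := by
    rintro i j z z' rfl rfl
    exact hF.derived_letterArc hs i z
  have next : ∀ (i j : ZMod (12 * s + 6)) (z z' : Letter), letterShift (mod3 s i) z = z' →
      j = i + letterNext s z → R.rot (num i) (letter z') = num j := by
    rintro i j z z' rfl rfl
    exact hF.derived_letterShift hs i z
  have l0 : ∀ z, letterShift (mod3 s 0) z = z := fun z => by rw [map_zero, letterShift_zero]
  have lx : ∀ i, letterShift (mod3 s i) .x = .x := fun i => rfl
  have ly : ∀ i, letterShift (mod3 s i) .y = .y := fun i => rfl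
  have lg : letterShift (mod3 s (6 * s - 2)) .a = .b := by rw [mod3_gam]; rfl
  have lge : letterShift (mod3 s (6 * s - 2 + (6 * s + 5))) .a = .a := by
    rw [map_add, mod3_gam, mod3_eps]; rfl
  have key : ∀ t ∈ Pt.derivedTriangles, R.rot (ι t.2.1) (ι t.1) = ι t.2.2 := by
    simp only [Pt.derivedTriangles, List.forall_mem_cons]
    refine ⟨arc _ _ .c _ ?_ (l0 _), arc _ _ .a _ ?_ (l0 _), arc _ _ .b _ ?_ (l0 _),
      next _ _ .b _ (l0 _) ?_, next _ _ .x _ (l0 _) ?_, next _ _ .y _ (l0 _) ?_,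
      arc _ _ .a _ ?_ lg, next _ _ .a _ lg ?_, arc _ _ .x _ ?_ (lx _), next _ _ .x _ (lx _) ?_,
      arc _ _ .y _ ?_ (ly _), next _ _ .a _ lge ?_, ?_, ?_, by simp⟩
    case refine_13 =>
      obtain ⟨h1, h2, h3⟩ := arcLabel_two hs
      have := hF.derived_of_unlabeled hs (-(6 * s - 2) - 1) h2 h1
      rw [hF.apply_two, arcCurr_of_ne h3, arcCurr_of_ne] at this
      · show R.rot (num (-(6 * s - 2) - 1)) (num (-(6 * s - 2) + 1)) = num (-(6 * s + 5))
        rw [show (-(6 * s - 2) + 1 : ZMod (12 * s + 6)) = -(6 * s - 2) - 1 + 2 by ring, this]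
        refine congrArg Sum.inl ?_
        ring
      · have := intCast_ne_of_lt (s := s) (a := -6) (b := 0) (by omega) (by omega)
        simpa using this
    case refine_14 =>
      obtain ⟨h1, h2, h3⟩ := arcLabel_neg_two hs
      have := hF.derived_of_unlabeled hs (-(6 * s - 2) + 1) h2 h1
      rw [hF.apply_neg_two, arcCurr_of_ne h3, arcCurr_of_ne] at this
      · show R.rot (num (-(6 * s - 2) + 1)) (num (-(6 * s - 2) - 1)) = num 0
        rw [show (-(6 * s - 2) - 1 : ZMod (12 * s + 6)) = -(6 * s - 2) + 1 + -2 by ring, this]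
        refine congrArg Sum.inl ?_
        ring
      · have := intCast_ne_of_lt (s := s) (a := 0) (b := 6 * s - 3) (by omega) (by omega)
        simpa using this.symm
    all_goals simp only [letterArc, letterNext]
    case refine_2 => linear_combination hn
    case refine_7 => linear_combination hn
    all_goals ring
  have hadj : ∀ t ∈ Pt.derivedTriangles, (completeMinusLetters s).Adj (ι t.1) (ι t.2.1) := by
    have hl : ∀ u, (ι u).isRight = u.isLetter := fun u => by cases u <;> rfl
    have h : ∀ t ∈ Pt.derivedTriangles, t.1 ≠ t.2.1 ∧ ¬(t.1.isLetter ∧ t.2.1.isLetter) := by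
      decide +kernel
    intro t ht
    refine ⟨(Pt.toVert_injective hs).ne (h t ht).1, ?_⟩
    rw [hl, hl]
    exact (h t ht).2
  intro v u w h
  rcases Pt.mem_derivedTriangles v u w h with ⟨hv, hu, rfl⟩ | h | h | h
  · have hl : ∀ u : Pt, u.isLetter → ∃ z, ι u = letter z := fun u hu => by
      cases u <;> simp only [Pt.isLetter, reduceCtorEq] at hu <;> exact ⟨_, rfl⟩
    obtain ⟨z, hz⟩ := hl v hv
    obtain ⟨z', hz'⟩ := hl _ hu
    rw [hz, hz']
    rfl
  · exact key _ h
  · exact (hF.derived_rotate hs (hadj _ h) (key _ h)).2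
  · exact (hF.derived_rotate hs (hadj _ h) (key _ h)).1

end IsLog


namespace IsLog

variable {s : ℕ} {F : Perm (ZMod (12 * s + 6))}

/-- The rotation at vertex `0` is cut after `b`, `γ`, `x`, `2ε`, `y` into segments. There is a
labeling of the vertices by their segments; `b` and `-ε`, which are exchanged when the edge
`(0, -ε)` is flipped to `(b, y)`, get the same label. -/
theorem exists_segments (hF : IsLog s F) (hs : 2 ≤ s) : ∃ f : Vert s → Fin 5,
    (∀ v, v ≠ letter .b → v ≠ num (6 * s - 2) → v ≠ letter .x → v ≠ num 4 → v ≠ letter .y →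
      f ((hF.derived hs).rot (num 0) v) = f v) ∧
    f (num (-(6 * s - 2))) = 0 ∧ f (num (6 * s - 2)) = 0 ∧ f (letter .c) = 1 ∧
    f (letter .x) = 1 ∧ f (num (-1)) = 2 ∧ f (num 4) = 2 ∧ f (letter .y) = 3 ∧
    f (letter .b) = 3 ∧ f (num (-(6 * s + 5))) = 3 := by
  obtain ⟨pos, p4, plt, pnext, plast⟩ := hF.exists_pos
  have hinj : Function.Injective pos := fun d e h => by
    rw [← pow_pos_apply p4 pnext d, h, pow_pos_apply p4 pnext e]
  have hsurj : ∀ k < 12 * s + 6, ∃ d, pos d = k := by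
    have hb : Function.Bijective (fun d => (⟨pos d, plt d⟩ : Fin (12 * s + 6))) := by
      rw [Fintype.bijective_iff_injective_and_card]
      exact ⟨fun d e h => hinj (Fin.mk.inj h), by rw [ZMod.card, Fintype.card_fin]⟩
    intro k hk
    obtain ⟨d, hd⟩ := hb.2 ⟨k, hk⟩
    exact ⟨d, Fin.mk.inj hd⟩
  -- Only the last arc of the log is followed by `4`.
  have hlast : ∀ d, F d = 4 → ∀ e, pos e ≤ pos d := fun d hd e => by
    by_contra! he
    obtain ⟨e', he'⟩ := hsurj (pos d + 1) (by have := plt e; omega)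
    have h1 := pow_pos_apply p4 pnext e'
    rw [he', pow_succ', Perm.mul_apply, pow_pos_apply p4 pnext, hd] at h1
    rw [← h1, p4] at he'
    omega
  have lne : ∀ z z', z ≠ z' → letterArc s z ≠ letterArc s z' := fun z z' h =>
    (letterArc_injective hs).ne h
  have e4 : (-(6 * s - 2) : ZMod (12 * s + 6)) ≠ 4 := by
    have := intCast_ne_of_lt (s := s) (a := 4) (b := 6 * s + 8) (by omega) (by omega)
    push_cast at this
    rw [show (-(6 * s - 2) : ZMod (12 * s + 6)) = 6 * s + 8 by
      linear_combination -natCast_card_eq_zero s]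
    exact this.symm
  have step : ∀ z, letterNext s z ≠ 4 → pos (letterNext s z) = pos (letterArc s z) + 1 :=
    fun z h => by rw [← hF.apply_letterArc] at h ⊢; exact pnext _ h
  have pa : pos (6 * s + 5) = 1 := (step .a (lne .y .a (by simp))).trans (congrArg (· + 1) p4)
  have pb : pos (-(6 * s + 5)) = 2 := (step .y (lne .b .a (by simp))).trans (congrArg (· + 1) pa)
  have pmg : pos (-(6 * s - 2)) = 3 := (step .b e4).trans (congrArg (· + 1) pb)
  have pc : pos (-4) = pos (6 * s - 2) + 1 := step .c (by
    have := intCast_ne_of_lt (s := s) (a := -4) (b := 4) (by omega) (by omega)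
    simpa [letterNext] using this)
  have px : pos (-1) = pos 1 + 1 := step .x (by
    have := intCast_ne_of_lt (s := s) (a := -1) (b := 4) (by omega) (by omega)
    simpa [letterNext] using this)
  have pg : 3 ≤ pos (6 * s - 2) := by
    have h : ∀ z z', z ≠ z' → pos (letterArc s z) ≠ pos (letterArc s z') := fun z z' h =>
      hinj.ne (lne z z' h)
    have h1 := h .c .a (by simp)
    have h2 := h .c .y (by simp)
    have h3 := h .c .b (by simp)
    simp only [letterArc, p4, pa, pb] at h1 h2 h3
    omega
  let seg : ZMod (12 * s + 6) → Fin 5 := fun d =>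
    if pos d = 0 then 2 else if pos d ≤ 2 then 3 else if pos d ≤ pos (6 * s - 2) then 0 else
      if pos d ≤ pos 1 then 1 else 2
  have seg_next : ∀ d, arcLabel s d = none → seg (F d) = seg d := fun d hd => by
    have hne : ∀ z, pos d ≠ pos (letterArc s z) := fun z h => by
      rw [hinj h, (arcLabel_eq_some_iff hs).2 rfl] at hd
      exact absurd hd (by simp)
    have h1 := hne .a
    have h2 := hne .y
    have h3 := hne .b
    have h4 := hne .c
    have h5 := hne .x
    simp only [letterArc, p4, pa, pb] at h1 h2 h3 h4 h5
    by_cases hd4 : F d = 4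
    · have := hlast d hd4 1
      simp only [seg, hd4, p4, if_true]
      rw [if_neg h1, if_neg (by omega), if_neg (by omega), if_neg (by omega)]
    · have := pnext d hd4
      simp only [seg, this]
      split_ifs <;> first | rfl | omega | contradiction
  refine ⟨fun v => match v with
    | .inl d => seg d
    | .inr .a => 3
    | .inr .b => 3
    | .inr .c => 1
    | .inr .x => 1
    | .inr .y => 3, ?_, ?_, ?_, rfl, rfl, ?_, ?_, rfl, rfl, ?_⟩
  · have hl0 : ∀ z, letterShift (mod3 s 0) z = z := fun z => by rw [map_zero, letterShift_zero]
    rintro (d | z) hb hg hx h4 hy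
    · show _ = seg d
      rcases letterArc_cases (d := d) hs with ⟨z, rfl⟩ | hl
      · have := hF.derived_letterArc hs 0 z
        rw [zero_add, hl0] at this
        rw [show (Sum.inl (letterArc s z) : Vert s) = num (letterArc s z) from rfl, this]
        cases z
        · exact absurd rfl h4
        · show (3 : Fin 5) = seg (-(6 * s + 5))
          simp only [seg, pb]
          rfl
        · exact absurd rfl hg
        · simp only [seg, letterArc]
          rw [if_neg (by omega), if_neg (by omega), if_neg (by omega), if_pos le_rfl]
        · show (3 : Fin 5) = seg (6 * s + 5)
          simp only [seg, pa]
          rfl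
      · have h := hF.derived_num hs 0 d
        rw [zero_add, baseNext_of_none F hl, vertTranslate_num, add_zero] at h
        rw [show (Sum.inl d : Vert s) = num d from rfl, h]
        show seg (nextArc F d) = seg d
        by_cases h0 : d = 0
        · rw [h0, nextArc_zero]
        by_cases hh : d = half s
        · rw [hh, hF.nextArc_half, seg_next 0 (arcLabel_zero hs), ← hF.apply_half,
            seg_next _ (arcLabel_half hs)]
        · rw [hF.nextArc_of_ne h0 hh, seg_next d hl]
    · have := hF.derived_letterShift hs 0 z
      rw [zero_add, hl0] at this
      rw [show (Sum.inr z : Vert s) = letter z from rfl, this]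
      cases z
      · show seg (6 * s + 5) = 3
        simp only [seg, pa]
        rfl
      · exact absurd rfl hb
      · simp only [seg, letterNext, pc]
        rw [if_neg (by omega), if_neg (by omega), if_neg (by omega), if_pos (by omega)]
      · exact absurd rfl hx
      · exact absurd rfl hy
  · simp only [seg, pmg]
    rw [if_neg (by omega), if_neg (by omega), if_pos pg]
  · simp only [seg]
    rw [if_neg (by omega), if_neg (by omega), if_pos le_rfl]
  · simp only [seg, px]
    rw [if_neg (by omega), if_neg (by omega), if_neg (by omega), if_neg (by omega)]
  · simp [seg, p4]
  · simp only [seg, pb]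
    rfl

end IsLog

/-! ### The genus -/

theorem SimpleGraph.connected_of_forall_adj {V : Type*} {G : SimpleGraph V} (c : V)
    (h : ∀ v, v ≠ c → G.Adj c v) : G.Connected := by
  have hc : ∀ v, G.Reachable c v := fun v => by
    by_cases hv : v = c
    · rw [hv]
    · exact (h v hv).reachable
  have : Nonempty V := ⟨c⟩
  exact ⟨fun u v => (hc u).symm.trans (hc v)⟩

section

variable (s : ℕ)

theorem card_vert : Nat.card (Vert s) = 12 * s + 11 := by
  rw [Nat.card_sum, Nat.card_zmod, Nat.card_eq_fintype_card]
  rfl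

theorem card_edgeSet_completeMinusLetters :
    Nat.card (completeMinusLetters s).edgeSet = 72 * s ^ 2 + 126 * s + 45 := by
  classical
  have h := (completeMinusLetters s).sum_degrees_eq_twice_card_edges
  have hcard := card_vert s
  rw [Nat.card_eq_fintype_card] at hcard
  have d1 : ∀ i, (completeMinusLetters s).degree (num i) = 12 * s + 10 := fun i => by
    rw [SimpleGraph.degree, show (completeMinusLetters s).neighborFinset (num i) =
      Finset.univ.erase (num i) by
        ext v
        rw [SimpleGraph.mem_neighborFinset, Finset.mem_erase]
        exact ⟨fun h => ⟨h.1.symm, Finset.mem_univ _⟩, fun h => ⟨h.1.symm, by simp⟩⟩, Finset.card_erase_of_mem (Finset.mem_univ _),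
      Finset.card_univ, hcard]
    omega
  have d2 : ∀ z, (completeMinusLetters s).degree (letter z) = 12 * s + 6 := fun z => by
    rw [SimpleGraph.degree, show (completeMinusLetters s).neighborFinset (letter z) =
      Finset.univ.map ⟨Sum.inl, Sum.inl_injective⟩ by
        ext (v | v) <;> rw [SimpleGraph.mem_neighborFinset] <;> simp [completeMinusLetters], Finset.card_map, Finset.card_univ, ZMod.card]
  rw [Fintype.sum_sum_type, Finset.sum_congr rfl fun i _ => d1 i,
    Finset.sum_congr rfl fun z _ => d2 z, Finset.sum_const, Finset.sum_const, Finset.card_univ,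
    Finset.card_univ, ZMod.card, show Fintype.card Letter = 5 from rfl,
    SimpleGraph.edgeFinset_card] at h
  rw [Nat.card_eq_fintype_card]
  simp only [smul_eq_mul] at h
  nlinarith

theorem card_edgeSet_top :
    Nat.card (⊤ : SimpleGraph (Vert s)).edgeSet = (12 * s + 11) * (6 * s + 5) := by
  classical
  rw [Nat.card_eq_fintype_card, ← SimpleGraph.edgeFinset_card,
    SimpleGraph.card_edgeFinset_top_eq_card_choose_two, ← Nat.card_eq_fintype_card, card_vert,
    Nat.choose_two_right, show 12 * s + 11 - 1 = (6 * s + 5) * 2 by omega, ← mul_assoc,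
    Nat.mul_div_cancel _ two_pos]

variable {s}

/-- By Euler's formula, as every face has at least three sides. -/
theorem genus_complete_ge {R : RotationSystem (Vert s)} (hR : R.graph = ⊤) {g : ℕ}
    (h : R.HasGenus g) : 12 * s ^ 2 + 15 * s + 5 ≤ g := by
  have h1 := h.2
  have h2 := R.three_mul_card_face_le fun u v _ => by
    classical
    have hc : 2 < Fintype.card (Vert s) := by
      rw [← Nat.card_eq_fintype_card, card_vert]
      omega
    obtain ⟨u', hu'⟩ : ∃ u' : Vert s, u' ∉ ({u, v} : Finset (Vert s)) := by
      by_contra! hall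
      have := Finset.card_le_card (fun x _ => hall x : (Finset.univ : Finset (Vert s)) ⊆ {u, v})
      rw [Finset.card_univ] at this
      have := Finset.card_le_two (a := u) (b := v)
      omega
    simp only [Finset.mem_insert, Finset.mem_singleton, not_or] at hu'
    exact ⟨u', hu'.1, by rw [hR]; exact Ne.symm hu'.2⟩
  rw [card_vert] at h1
  rw [hR, card_edgeSet_top] at h1 h2
  push_cast at h1
  zify at h2 ⊢
  nlinarith

theorem ceil_genus_complete : 12 * s ^ 2 + 15 * s + 5 =
    ⌈((12 * s + 11 - 3) * (12 * s + 11 - 4) : ℚ) / 12⌉₊ := by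
  symm
  rw [Nat.ceil_eq_iff (by omega)]
  constructor
  · rw [Nat.cast_sub (by omega)]
    push_cast
    linarith
  · push_cast
    linarith

end

namespace IsLog

variable {s : ℕ} {F : Perm (ZMod (12 * s + 6))}

theorem derived_hasGenus (hF : IsLog s F) (hs : 2 ≤ s) :
    (hF.derived hs).HasGenus (12 * s ^ 2 + 15 * s + 3) := by
  have h := (hF.derived_isTriangular hs).three_mul_card_face
  have hE : Nat.card (hF.derived hs).graph.edgeSet = 72 * s ^ 2 + 126 * s + 45 :=
    card_edgeSet_completeMinusLetters s
  refine ⟨SimpleGraph.connected_of_forall_adj (num 0) fun v hv => ⟨hv.symm, by simp⟩, ?_⟩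
  rw [hE] at h ⊢
  rw [card_vert]
  zify at h
  push_cast
  linarith

/-- The completion of the derived embedding. Only the handle modification changes the genus, and
the edges of the final graph are those of the derived embedding and the ten edges between letters. -/
theorem exists_completion (hF : IsLog s F) (hs : 2 ≤ s) :
    ∃ R₁ R₂ R₃ R₄ R₅ : RotationSystem (Vert s),
      IsCompletion (6 * s - 2) 1 (6 * s + 5) (hF.derived hs) R₁ R₂ R₃ R₄ R₅ ∧
      R₂.HasGenus (12 * s ^ 2 + 15 * s + 5) ∧ R₅.graph = ⊤ ∧
      R₅.HasGenus (12 * s ^ 2 + 15 * s + 5) := by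
  have hι := Pt.toVert_injective hs
  have h2ε : (2 * (6 * s + 5) : ZMod (12 * s + 6)) = 4 := two_mul_eps
  obtain ⟨M, R₁, i1, i2, t1, o1, r1, g1⟩ :=
    RotationSystem.exists_initial_flips hι (hF.derivedTable_agrees hs)
  obtain ⟨f, hf, fmg, fg, fc, fx, fmd, fe2, fy, fb, fme⟩ := hF.exists_segments hs
  have hswap : ∀ v, f (swap (num (-(6 * s + 5))) (letter .b) v) = f v := fun v => by
    by_cases h1 : v = num (-(6 * s + 5))
    · rw [h1, swap_apply_left, fb, fme]
    by_cases h2 : v = letter .b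
    · rw [h2, swap_apply_right, fb, fme]
    · rw [swap_apply_of_ne_of_ne h1 h2]
  obtain ⟨R₂, m2, t2, o2⟩ := RotationSystem.exists_handleModification hι t1 f
    (fun v hb hg hx he2 hy => by
      show f (R₁.rot (num 0) v) = f v
      rw [r1, Perm.mul_apply, hswap]
      exact hf v hb hg hx (by rw [← h2ε]; exact he2) hy)
    fmg fg fc fx fmd (by show f (num (2 * (6 * s + 5))) = 2; rw [h2ε]; exact fe2) fy
  obtain ⟨R₃, m3, t3, o3, g3⟩ := RotationSystem.exists_fillFace hι t2
  obtain ⟨R₄, R₅, m4, m5, o5, g5⟩ := RotationSystem.exists_final_flips hι t3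
  have hg2 : R₂.graph = R₁.graph := m2.2.2.2.2.2.1
  obtain ⟨hc0, e0⟩ := (RotationSystem.hasGenus_iff _ _).1 (hF.derived_hasGenus hs)
  have htop : R₅.graph = ⊤ := by
    ext u v
    by_cases huv : u = v
    · simp [huv]
    rw [g5, g3, hg2, g1, SimpleGraph.top_adj]
    by_cases hA : (hF.derived hs).graph.Adj u v
    · rw [Sym2.eq_swap (a := Pt.toVert _ _ _ Pt.ge2)]
      tauto
    · rcases u with i | z
      · rcases v with j | z'
        · exact absurd ⟨huv, by simp⟩ hA
        · exact absurd ⟨by simp, by simp⟩ hA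
      · rcases v with j | z'
        · exact absurd ⟨by simp, by simp⟩ hA
        · cases z <;> cases z' <;> simp [Pt.toVert, hA]
  have hc2 : R₂.graph.Connected := by
    rw [hg2]
    refine SimpleGraph.connected_of_forall_adj (Pt.toVert (6 * s - 2) 1 (6 * s + 5) .p)
      fun v hv => ?_
    have hne : ∀ u w : Pt, u ≠ .p → w ≠ .p → s(Pt.toVert (6 * s - 2) 1 (6 * s + 5) .p, v) ≠
        s(Pt.toVert (6 * s - 2) 1 (6 * s + 5) u, Pt.toVert (6 * s - 2) 1 (6 * s + 5) w) :=
      fun u w hu hw e => by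
        rcases Sym2.eq_iff.1 e with ⟨h, -⟩ | ⟨h, -⟩
        · exact hu (hι h).symm
        · exact hw (hι h).symm
    rw [g1]
    exact Or.inl ⟨Or.inl ⟨Or.inl ⟨⟨hv.symm, fun h => Bool.false_ne_true h.1⟩,
      hne _ _ (by decide) (by decide)⟩, hne _ _ (by decide) (by decide)⟩,
      hne _ _ (by decide) (by decide)⟩
  refine ⟨R₁, R₂, R₃, R₄, R₅, ⟨⟨M, i1, i2⟩, m2, m3, m4, m5⟩, ?_, htop, ?_⟩
  · refine (RotationSystem.hasGenus_iff _ _).2 ⟨hc2, ?_⟩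
    push_cast at e0 ⊢
    zify at o1 o2
    linarith
  · refine (RotationSystem.hasGenus_iff _ _).2 ⟨?_, ?_⟩
    · rw [htop]
      exact SimpleGraph.connected_of_forall_adj (num 0) fun v hv => hv.symm
    · push_cast at e0 ⊢
      zify at o1 o2 o3 o5
      linarith

end IsLog


/-! ### The logs with a ladder -/

namespace LadderLog

/-- The vertices of degree 3 of the current graph: 13 individual ones, of which `0` is the vortex,
and those of the ladder. The classes `0`, `1`, `2`, `3` of vertices of the ladder are: top, even
rung; top, odd rung; bottom, even rung; bottom, odd rung. -/
abbrev CubicVertex (s : ℕ) : Type := Fin 13 ⊕ Fin 4 × Fin (s - 3)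

/-- Each arc is named by its head and its place among the arcs that enter this vertex. The vertices
of degree 1 are `x`, `y` and the dead end. -/
abbrev EnteringArc (s : ℕ) : Type := CubicVertex s × Fin 3 ⊕ Fin 3

/-- Currents `p.1 * s + p.2` of the arcs that enter the individual vertices, in cyclic order. The
arc that leaves the dead end has the entry `0`. -/
def fixedCurr : Fin 13 → Fin 3 → ℤ × ℤ :=
  ![![(0, 4), (-6, -5), (6, -2)],
    ![(0, -2), (-6, 3), (6, -1)],
    ![(0, 2), (0, 6), (0, -8)],
    ![(-3, -5), (-6, 0), (-3, -1)],
    ![(3, 5), (3, 4), (6, -3)],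
    ![(-3, -4), (-3, 2), (6, 2)],
    ![(-3, -2), (0, 3), (3, -1)],
    ![(3, 2), (3, 1), (0, 0)],
    ![(-6, 9), (0, -3), (6, -6)],
    ![(6, -9), (-6, 2), (0, 7)],
    ![(-6, 6), (0, -6), (6, 0)],
    ![(0, -5), (-6, -2), (-6, 1)],
    ![(0, 5), (0, -4), (0, -1)]]

/-- Positions `p.1 * s + p.2` in the log. -/
def fixedPos : Fin 13 → Fin 3 → ℤ × ℤ :=
  ![![(0, 0), (0, 2), (12, -4)],
    ![(12, -10), (12, 3), (2, 0)],
    ![(2, 1), (2, 10), (12, -11)],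
    ![(12, -8), (2, 3), (4, 7)],
    ![(4, 8), (12, 2), (12, -9)],
    ![(4, 9), (2, -2), (12, 1)],
    ![(2, 7), (8, 0), (4, 5)],
    ![(4, 6), (2, 4), (2, 6)],
    ![(8, -1), (2, 8), (12, -6)],
    ![(12, -5), (0, 3), (8, -2)],
    ![(2, 9), (2, 2), (12, -7)],
    ![(12, 0), (2, -1), (12, 4)],
    ![(12, 5), (12, -3), (12, -1)]]

/-- Currents `p.1 * s + p.2.1 + p.2.2 * j` of the arcs that enter the `j`-th vertices of the four
classes of the ladder: from the left, from the right, along the rung. -/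
def ladderCurr : Fin 4 → Fin 3 → ℤ × ℤ × ℤ :=
  ![![(0, -7, -3), (6, -5, -3), (-6, 12, 6)],
    ![(-6, 5, 3), (0, 10, 3), (6, -15, -6)],
    ![(0, 8, 3), (-6, 4, 3), (6, -12, -6)],
    ![(6, -4, -3), (0, -11, -3), (-6, 15, 6)]]

/-- Positions `p.1 * s + p.2.1 + p.2.2 * j` in the log. -/
def ladderPos : Fin 4 → Fin 3 → ℤ × ℤ × ℤ :=
  ![![(0, 4, 2), (12, -13, -4), (8, -3, -4)],
    ![(0, 5, 2), (8, -6, -4), (12, -14, -4)],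
    ![(2, 11, 2), (8, -4, -4), (12, -12, -4)],
    ![(2, 12, 2), (12, -15, -4), (8, -5, -4)]]

/-- Currents `p.1 * s + p.2` of the arcs that enter the vertices of degree 1. -/
def leafCurr : Fin 3 → ℤ × ℤ := ![(0, 1), (6, 5), (6, 3)]

/-- Positions `p.1 * s + p.2` in the log. -/
def leafPos : Fin 3 → ℤ × ℤ := ![(12, -2), (0, 1), (2, 5)]

section

variable {s : ℕ}

/-- An integer that represents the name of an arc. -/
def val : EnteringArc s → ℤ
  | .inl (.inl v, i) => (fixedCurr v i).1 * s + (fixedCurr v i).2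
  | .inl (.inr (f, j), i) => (ladderCurr f i).1 * s + (ladderCurr f i).2.1 + (ladderCurr f i).2.2 * j
  | .inr i => (leafCurr i).1 * s + (leafCurr i).2

/-- The position of an arc in the log. -/
def pos : EnteringArc s → ℤ
  | .inl (.inl v, i) => (fixedPos v i).1 * s + (fixedPos v i).2
  | .inl (.inr (f, j), i) => (ladderPos f i).1 * s + (ladderPos f i).2.1 + (ladderPos f i).2.2 * j
  | .inr i => (leafPos i).1 * s + (leafPos i).2

/-- The next arc that enters the same vertex. -/
def next : Perm (EnteringArc s) :=
  Equiv.sumCongr (Equiv.prodCongr (Equiv.refl _) (Equiv.addRight 1)) (Equiv.refl _)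

theorem next_next_next (a : EnteringArc s) : next (next (next a)) = a := by
  rcases a with ⟨v, i⟩ | i
  · show Sum.inl (v, i + 1 + 1 + 1) = Sum.inl (v, i)
    rw [show i + 1 + 1 + 1 = i by revert i; decide]
  · rfl

/-- The name of an arc. -/
def name (a : EnteringArc s) : ZMod (12 * s + 6) := (val a : ℤ)

theorem name_surjective (hs : 4 ≤ s) : Function.Surjective (name (s := s)) := by
  intro z
  obtain ⟨k, h1, h2, rfl⟩ : ∃ k : ℤ, -6 * s - 3 < k ∧ k ≤ 6 * s + 3 ∧
      (k : ZMod (12 * s + 6)) = z := by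
    obtain ⟨k, h0, h1, rfl⟩ := exists_intCast_eq z
    by_cases h : k ≤ 6 * s + 3
    · exact ⟨k, by omega, h, rfl⟩
    · refine ⟨k - (12 * s + 6), by omega, by omega, ?_⟩
      push_cast
      linear_combination -natCast_card_eq_zero s
  have eq : ∀ (a : EnteringArc s) (n : ℤ), k = val a + (12 * s + 6) * n →
      ∃ a : EnteringArc s, name a = k := by
    rintro a n rfl
    refine ⟨a, ?_⟩
    push_cast
    rw [natCast_card_eq_zero, zero_mul, add_zero, name]
  have fx : ∀ (v : Fin 13) (i : Fin 3), k = (fixedCurr v i).1 * s + (fixedCurr v i).2 →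
      ∃ a : EnteringArc s, name a = k := fun v i h =>
    eq (.inl (.inl v, i)) 0 (by rw [mul_zero, add_zero]; exact h)
  have lad : ∀ (f : Fin 4) (i : Fin 3) (j : ℕ), j < s - 3 → k = (ladderCurr f i).1 * s +
      (ladderCurr f i).2.1 + (ladderCurr f i).2.2 * j → ∃ a : EnteringArc s, name a = k :=
    fun f i j hj h => eq (.inl (.inr (f, ⟨j, hj⟩), i)) 0 (by rw [mul_zero, add_zero]; exact h)
  have leaf : ∀ i : Fin 3, k = (leafCurr i).1 * s + (leafCurr i).2 →
      ∃ a : EnteringArc s, name a = k := fun i h =>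
    eq (.inr i) 0 (by rw [mul_zero, add_zero]; exact h)
  obtain ⟨q, hq | hq | hq⟩ : ∃ q : ℤ, k = 3 * q ∨ k = 3 * q + 1 ∨ k = 3 * q + 2 :=
    ⟨k / 3, by omega⟩
  · have h : k = -6 * s + 0 ∨ k = -6 * s + 3 ∨ k = -6 * s + 6 ∨ k = -6 * s + 9 ∨
      -6 * s + 12 ≤ k ∧ k ≤ -9 ∨ k = 0 * s + -6 ∨ k = 0 * s + -3 ∨ k = 0 * s + 0 ∨ k = 0 * s + 3 ∨
      k = 0 * s + 6 ∨ 9 ≤ k ∧ k ≤ 6 * s + -12 ∨ k = 6 * s + -9 ∨ k = 6 * s + -6 ∨ k = 6 * s + -3 ∨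
      k = 6 * s + 0 ∨ k = 6 * s + 3 := by omega
    rcases h with h | h | h | h | h | h | h | h | h | h | h | h | h | h | h | h
    · exact fx 3 1 h
    · exact fx 1 1 h
    · exact fx 10 0 h
    · exact fx 8 0 h
    · obtain ⟨u, rfl | rfl⟩ := q.even_or_odd'
      · exact lad 0 2 ((u + s - 2).toNat) (by omega) (by show (_ : ℤ) = -6 * s + 12 + 6 * _; omega)
      · exact lad 3 2 ((u + s - 2).toNat) (by omega) (by show (_ : ℤ) = -6 * s + 15 + 6 * _; omega)
    · exact fx 10 1 h
    · exact fx 8 1 h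
    · exact fx 7 2 h
    · exact fx 6 1 h
    · exact fx 2 1 h
    · obtain ⟨u, rfl | rfl⟩ := q.even_or_odd'
      · exact lad 2 2 ((s - 2 - u).toNat) (by omega) (by show (_ : ℤ) = 6 * s + -12 + -6 * _; omega)
      · exact lad 1 2 ((s - 3 - u).toNat) (by omega) (by show (_ : ℤ) = 6 * s + -15 + -6 * _; omega)
    · exact fx 9 0 h
    · exact fx 8 2 h
    · exact fx 4 2 h
    · exact fx 10 2 h
    · exact leaf 2 h
  · have h : k = -6 * s + -2 ∨ k = -6 * s + 1 ∨ -6 * s + 4 ≤ k ∧ k ≤ -3 * s + -8 ∨ k = -3 * s + -5 ∨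
      k = -3 * s + -2 ∨ -3 * s + 1 ≤ k ∧ k ≤ -11 ∨ k = 0 * s + -8 ∨ k = 0 * s + -5 ∨
      k = 0 * s + -2 ∨ k = 0 * s + 1 ∨ k = 0 * s + 4 ∨ k = 0 * s + 7 ∨ 10 ≤ k ∧ k ≤ 3 * s + -2 ∨
      k = 3 * s + 1 ∨ k = 3 * s + 4 ∨ 3 * s + 7 ≤ k ∧ k ≤ 6 * s + -5 ∨ k = 6 * s + -2 ∨
      k = 6 * s + 1 := by omega
    rcases h with h | h | h | h | h | h | h | h | h | h | h | h | h | h | h | h | h | h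
    · exact fx 11 1 h
    · exact fx 11 2 h
    · exact lad 2 1 ((k - (-6 * s + 4)) / 3).toNat (by omega)
        (by show (_ : ℤ) = -6 * s + 4 + 3 * _; omega)
    · exact fx 3 0 h
    · exact fx 6 0 h
    · exact lad 3 1 ((0 * s + -11 - k) / 3).toNat (by omega)
        (by show (_ : ℤ) = 0 * s + -11 + -3 * _; omega)
    · exact fx 2 2 h
    · exact fx 11 0 h
    · exact fx 1 0 h
    · exact leaf 0 h
    · exact fx 0 0 h
    · exact fx 9 2 h
    · exact lad 1 1 ((k - (0 * s + 10)) / 3).toNat (by omega)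
        (by show (_ : ℤ) = 0 * s + 10 + 3 * _; omega)
    · exact fx 7 1 h
    · exact fx 4 1 h
    · exact lad 0 1 ((6 * s + -5 - k) / 3).toNat (by omega)
        (by show (_ : ℤ) = 6 * s + -5 + -3 * _; omega)
    · exact fx 0 2 h
    · exact eq (.inl (.inl 0, 1)) 1 (by show _ = -6 * (s : ℤ) + -5 + _; omega)
  · have h : k = -6 * s + -1 ∨ k = -6 * s + 2 ∨ -6 * s + 5 ≤ k ∧ k ≤ -3 * s + -7 ∨ k = -3 * s + -4 ∨
      k = -3 * s + -1 ∨ k = -3 * s + 2 ∨ -3 * s + 5 ≤ k ∧ k ≤ -7 ∨ k = 0 * s + -4 ∨ k = 0 * s + -1 ∨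
      k = 0 * s + 2 ∨ k = 0 * s + 5 ∨ 8 ≤ k ∧ k ≤ 3 * s + -4 ∨ k = 3 * s + -1 ∨ k = 3 * s + 2 ∨
      k = 3 * s + 5 ∨ 3 * s + 8 ≤ k ∧ k ≤ 6 * s + -4 ∨ k = 6 * s + -1 ∨ k = 6 * s + 2 := by omega
    rcases h with h | h | h | h | h | h | h | h | h | h | h | h | h | h | h | h | h | h
    · exact eq (.inr 1) (-1) (by show _ = 6 * (s : ℤ) + 5 + _; omega)
    · exact fx 9 1 h
    · exact lad 1 0 ((k - (-6 * s + 5)) / 3).toNat (by omega)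
        (by show (_ : ℤ) = -6 * s + 5 + 3 * _; omega)
    · exact fx 5 0 h
    · exact fx 3 2 h
    · exact fx 5 1 h
    · exact lad 0 0 ((0 * s + -7 - k) / 3).toNat (by omega)
        (by show (_ : ℤ) = 0 * s + -7 + -3 * _; omega)
    · exact fx 12 1 h
    · exact fx 12 2 h
    · exact fx 2 0 h
    · exact fx 12 0 h
    · exact lad 2 0 ((k - (0 * s + 8)) / 3).toNat (by omega)
        (by show (_ : ℤ) = 0 * s + 8 + 3 * _; omega)
    · exact fx 6 2 h
    · exact fx 7 0 h
    · exact fx 4 0 h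
    · exact lad 3 0 ((6 * s + -4 - k) / 3).toNat (by omega)
        (by show (_ : ℤ) = 6 * s + -4 + -3 * _; omega)
    · exact fx 1 2 h
    · exact fx 5 2 h

theorem name_bijective (hs : 4 ≤ s) : Function.Bijective (name (s := s)) := by
  rw [Fintype.bijective_iff_surjective_and_card]
  refine ⟨name_surjective hs, ?_⟩
  rw [ZMod.card]
  simp only [Fintype.card_sum, Fintype.card_prod, Fintype.card_fin]
  omega

/-- The arcs, identified with their names. -/
noncomputable def arcEquiv (hs : 4 ≤ s) : EnteringArc s ≃ ZMod (12 * s + 6) :=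
  Equiv.ofBijective name (name_bijective hs)

/-- The face tracing permutation. -/
noncomputable def face (hs : 4 ≤ s) : Perm (ZMod (12 * s + 6)) :=
  (arcEquiv hs).symm.trans (next.trans ((arcEquiv hs).trans
    (Function.Involutive.toPerm (arcRev s) arcRev_arcRev)))

theorem face_name (hs : 4 ≤ s) (a : EnteringArc s) :
    face hs (name a) = arcRev s (name (next a)) := by
  show arcRev s (arcEquiv hs (next ((arcEquiv hs).symm (arcEquiv hs a)))) = _
  rw [symm_apply_apply]
  rfl

/-- The arc with a current of order 2 that enters the dead end. -/
def deadEnd : EnteringArc s := .inr 2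

/-- The arc with a current of order 2 that leaves the dead end. -/
def fromDeadEnd : EnteringArc s := .inl (.inl 7, 2)

theorem name_deadEnd : name (deadEnd (s := s)) = half s := by
  show ((6 * s + 3 : ℤ) : ZMod (12 * s + 6)) = _
  rw [half_eq_intCast]

theorem name_fromDeadEnd : name (fromDeadEnd (s := s)) = 0 := by
  show ((0 * s + 0 : ℤ) : ZMod (12 * s + 6)) = _
  simp

theorem arcRev_name (hs : 4 ≤ s) {a b : EnteringArc s} (h1 : a ≠ deadEnd) (h2 : a ≠ fromDeadEnd)
    (h : val a + val b = 0) : arcRev s (name a) = name b := by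
  rw [arcRev_of_ne]
  · rw [name, name, show val b = -val a by omega, Int.cast_neg]
  · rw [← name_fromDeadEnd]
    exact (name_bijective hs).1.ne h2
  · rw [← name_deadEnd]
    exact (name_bijective hs).1.ne h1

/-- The reverse of each arc, and its place in the log. -/
theorem exists_reverse (hs : 4 ≤ s) (a : EnteringArc s) (h1 : a ≠ deadEnd) (h2 : a ≠ fromDeadEnd) :
    ∃ b : EnteringArc s, val a + val b = 0 ∧
      (pos b = pos (next (next a)) + 1 ∨ b = .inl (.inl 0, 0)) := by
  have hfix : ∀ v i, (∃ v' i', fixedCurr v i + fixedCurr v' i' = 0 ∧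
      (fixedPos v' i' = fixedPos v (i + 1 + 1) + (0, 1) ∨ (v' = 0 ∧ i' = 0))) ∨
      (v, i) ∈ ([(0, 1), (2, 2), (5, 1), (6, 2), (7, 2), (9, 2), (12, 2)] :
        List (Fin 13 × Fin 3)) := by
    decide +kernel
  rcases a with ⟨v | ⟨f, j, hj⟩, i⟩ | i
  · rcases hfix v i with ⟨v', i', hc, hp⟩ | h
    · refine ⟨.inl (.inl v', i'), ?_, ?_⟩
      · have e1 := congrArg Prod.fst hc
        have e2 := congrArg Prod.snd hc
        simp only [Prod.fst_add, Prod.snd_add, Prod.fst_zero, Prod.snd_zero] at e1 e2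
        show (fixedCurr v i).1 * (s : ℤ) + (fixedCurr v i).2 +
          ((fixedCurr v' i').1 * s + (fixedCurr v' i').2) = 0
        linear_combination (s : ℤ) * e1 + e2
      · rcases hp with hp | ⟨rfl, rfl⟩
        · left
          show (fixedPos v' i').1 * (s : ℤ) + (fixedPos v' i').2 =
            (fixedPos v (i + 1 + 1)).1 * (s : ℤ) + (fixedPos v (i + 1 + 1)).2 + 1
          rw [hp]
          simp only [Prod.fst_add, Prod.snd_add, add_zero]
          ring
        · exact Or.inr rfl
    · simp only [List.mem_cons, Prod.mk.injEq, List.not_mem_nil, or_false] at h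
      rcases h with ⟨rfl, rfl⟩ | ⟨rfl, rfl⟩ | ⟨rfl, rfl⟩ | ⟨rfl, rfl⟩ | ⟨rfl, rfl⟩ | ⟨rfl, rfl⟩ |
        ⟨rfl, rfl⟩
      · exact ⟨.inr 1, by show (-6 * s + -5 : ℤ) + (6 * s + 5) = 0; omega,
          Or.inl (by show (0 * s + 1 : ℤ) = 0 * s + 0 + 1; omega)⟩
      · exact ⟨.inl (.inr (2, ⟨0, by omega⟩), 0),
          by show (0 * s + -8 : ℤ) + (0 * s + 8 + 3 * (0 : ℕ)) = 0; omega,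
          Or.inl (by show (2 * s + 11 + 2 * (0 : ℕ) : ℤ) = 2 * s + 10 + 1; omega)⟩
      · exact ⟨.inl (.inr (1, ⟨s - 4, by omega⟩), 1),
          by show (-3 * s + 2 : ℤ) + (0 * s + 10 + 3 * (s - 4 : ℕ)) = 0; omega,
          Or.inl (by show (8 * s + -6 + -4 * (s - 4 : ℕ) : ℤ) = 4 * s + 9 + 1; omega)⟩
      · exact ⟨.inl (.inr (3, ⟨s - 4, by omega⟩), 1),
          by show (3 * s + -1 : ℤ) + (0 * s + -11 + -3 * (s - 4 : ℕ)) = 0; omega,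
          Or.inl (by show (12 * s + -15 + -4 * (s - 4 : ℕ) : ℤ) = 8 * s + 0 + 1; omega)⟩
      · exact absurd rfl h2
      · exact ⟨.inl (.inr (0, ⟨0, by omega⟩), 0),
          by show (0 * s + 7 : ℤ) + (0 * s + -7 + -3 * (0 : ℕ)) = 0; omega,
          Or.inl (by show (0 * s + 4 + 2 * (0 : ℕ) : ℤ) = 0 * s + 3 + 1; omega)⟩
      · exact ⟨.inr 0, by show (0 * s + -1 : ℤ) + (0 * s + 1) = 0; omega,
          Or.inl (by show (12 * s + -2 : ℤ) = 12 * s + -3 + 1; omega)⟩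
  · have lad : ∀ (f' : Fin 4) (i' : Fin 3) (j' : ℕ), j' < s - 3 →
        (ladderCurr f i).1 * (s : ℤ) + (ladderCurr f i).2.1 + (ladderCurr f i).2.2 * j +
          ((ladderCurr f' i').1 * s + (ladderCurr f' i').2.1 + (ladderCurr f' i').2.2 * j') = 0 →
        (ladderPos f' i').1 * (s : ℤ) + (ladderPos f' i').2.1 + (ladderPos f' i').2.2 * j' =
          (ladderPos f (i + 1 + 1)).1 * s + (ladderPos f (i + 1 + 1)).2.1 +
            (ladderPos f (i + 1 + 1)).2.2 * j + 1 →
        ∃ b : EnteringArc s, val (.inl (.inr (f, ⟨j, hj⟩), i)) + val b = 0 ∧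
          (pos b = pos (next (next (.inl (.inr (f, ⟨j, hj⟩), i)))) + 1 ∨ b = .inl (.inl 0, 0)) :=
      fun f' i' j' hj' hc hp => ⟨.inl (.inr (f', ⟨j', hj'⟩), i'), hc, Or.inl hp⟩
    have fix : ∀ (v : Fin 13) (i' : Fin 3),
        (ladderCurr f i).1 * (s : ℤ) + (ladderCurr f i).2.1 + (ladderCurr f i).2.2 * j +
          ((fixedCurr v i').1 * s + (fixedCurr v i').2) = 0 →
        (fixedPos v i').1 * (s : ℤ) + (fixedPos v i').2 =
          (ladderPos f (i + 1 + 1)).1 * s + (ladderPos f (i + 1 + 1)).2.1 +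
            (ladderPos f (i + 1 + 1)).2.2 * j + 1 →
        ∃ b : EnteringArc s, val (.inl (.inr (f, ⟨j, hj⟩), i)) + val b = 0 ∧
          (pos b = pos (next (next (.inl (.inr (f, ⟨j, hj⟩), i)))) + 1 ∨ b = .inl (.inl 0, 0)) :=
      fun v i' hc hp => ⟨.inl (.inl v, i'), hc, Or.inl hp⟩
    have hfi : ∀ (f : Fin 4) (i : Fin 3), (f = 0 ∧ i = 0) ∨ (f = 0 ∧ i = 1) ∨ (f = 0 ∧ i = 2) ∨
        (f = 1 ∧ i = 0) ∨ (f = 1 ∧ i = 1) ∨ (f = 1 ∧ i = 2) ∨ (f = 2 ∧ i = 0) ∨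
        (f = 2 ∧ i = 1) ∨ (f = 2 ∧ i = 2) ∨ (f = 3 ∧ i = 0) ∨ (f = 3 ∧ i = 1) ∨
        (f = 3 ∧ i = 2) := by decide
    rcases hfi f i with ⟨rfl, rfl⟩ | ⟨rfl, rfl⟩ | ⟨rfl, rfl⟩ | ⟨rfl, rfl⟩ | ⟨rfl, rfl⟩ | ⟨rfl, rfl⟩ |
      ⟨rfl, rfl⟩ | ⟨rfl, rfl⟩ | ⟨rfl, rfl⟩ | ⟨rfl, rfl⟩ | ⟨rfl, rfl⟩ | ⟨rfl, rfl⟩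
    · by_cases h0 : j = 0
      · exact fix 9 2 (by show (0 * s + -7 + -3 * j + (0 * s + 7) : ℤ) = 0; omega)
          (by show (8 * s + -2 : ℤ) = 8 * s + -3 + -4 * j + 1; omega)
      · exact lad 1 1 (j - 1) (by omega)
          (by show (0 * s + -7 + -3 * j + (0 * s + 10 + 3 * (j - 1 : ℕ)) : ℤ) = 0; omega)
          (by show (8 * s + -6 + -4 * (j - 1 : ℕ) : ℤ) = 8 * s + -3 + -4 * j + 1; omega)
    · exact lad 1 0 j (by omega)
        (by show (6 * s + -5 + -3 * j + (-6 * s + 5 + 3 * (j : ℕ)) : ℤ) = 0; omega)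
        (by show (0 * s + 5 + 2 * (j : ℕ) : ℤ) = 0 * s + 4 + 2 * j + 1; omega)
    · exact lad 2 2 j (by omega)
        (by show (-6 * s + 12 + 6 * j + (6 * s + -12 + -6 * (j : ℕ)) : ℤ) = 0; omega)
        (by show (12 * s + -12 + -4 * (j : ℕ) : ℤ) = 12 * s + -13 + -4 * j + 1; omega)
    · exact lad 0 1 j (by omega)
        (by show (-6 * s + 5 + 3 * j + (6 * s + -5 + -3 * (j : ℕ)) : ℤ) = 0; omega)
        (by show (12 * s + -13 + -4 * (j : ℕ) : ℤ) = 12 * s + -14 + -4 * j + 1; omega)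
    · by_cases h0 : j = s - 4
      · exact fix 5 1 (by show (0 * s + 10 + 3 * j + (-3 * s + 2) : ℤ) = 0; omega)
          (by show (2 * s + -2 : ℤ) = 0 * s + 5 + 2 * j + 1; omega)
      · exact lad 0 0 (j + 1) (by omega)
          (by show (0 * s + 10 + 3 * j + (0 * s + -7 + -3 * (j + 1 : ℕ)) : ℤ) = 0; omega)
          (by show (0 * s + 4 + 2 * (j + 1 : ℕ) : ℤ) = 0 * s + 5 + 2 * j + 1; omega)
    · exact lad 3 2 j (by omega)
        (by show (6 * s + -15 + -6 * j + (-6 * s + 15 + 6 * (j : ℕ)) : ℤ) = 0; omega)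
        (by show (8 * s + -5 + -4 * (j : ℕ) : ℤ) = 8 * s + -6 + -4 * j + 1; omega)
    · by_cases h0 : j = 0
      · exact fix 2 2 (by show (0 * s + 8 + 3 * j + (0 * s + -8) : ℤ) = 0; omega)
          (by show (12 * s + -11 : ℤ) = 12 * s + -12 + -4 * j + 1; omega)
      · exact lad 3 1 (j - 1) (by omega)
          (by show (0 * s + 8 + 3 * j + (0 * s + -11 + -3 * (j - 1 : ℕ)) : ℤ) = 0; omega)
          (by show (12 * s + -15 + -4 * (j - 1 : ℕ) : ℤ) = 12 * s + -12 + -4 * j + 1; omega)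
    · exact lad 3 0 j (by omega)
        (by show (-6 * s + 4 + 3 * j + (6 * s + -4 + -3 * (j : ℕ)) : ℤ) = 0; omega)
        (by show (2 * s + 12 + 2 * (j : ℕ) : ℤ) = 2 * s + 11 + 2 * j + 1; omega)
    · exact lad 0 2 j (by omega)
        (by show (6 * s + -12 + -6 * j + (-6 * s + 12 + 6 * (j : ℕ)) : ℤ) = 0; omega)
        (by show (8 * s + -3 + -4 * (j : ℕ) : ℤ) = 8 * s + -4 + -4 * j + 1; omega)
    · exact lad 2 1 j (by omega)
        (by show (6 * s + -4 + -3 * j + (-6 * s + 4 + 3 * (j : ℕ)) : ℤ) = 0; omega)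
        (by show (8 * s + -4 + -4 * (j : ℕ) : ℤ) = 8 * s + -5 + -4 * j + 1; omega)
    · by_cases h0 : j = s - 4
      · exact fix 6 2 (by show (0 * s + -11 + -3 * j + (3 * s + -1) : ℤ) = 0; omega)
          (by show (4 * s + 5 : ℤ) = 2 * s + 12 + 2 * j + 1; omega)
      · exact lad 2 0 (j + 1) (by omega)
          (by show (0 * s + -11 + -3 * j + (0 * s + 8 + 3 * (j + 1 : ℕ)) : ℤ) = 0; omega)
          (by show (2 * s + 11 + 2 * (j + 1 : ℕ) : ℤ) = 2 * s + 12 + 2 * j + 1; omega)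
    · exact lad 1 2 j (by omega)
        (by show (-6 * s + 15 + 6 * j + (6 * s + -15 + -6 * (j : ℕ)) : ℤ) = 0; omega)
        (by show (12 * s + -14 + -4 * (j : ℕ) : ℤ) = 12 * s + -15 + -4 * j + 1; omega)
  · have hi : ∀ i : Fin 3, i = 0 ∨ i = 1 ∨ i = 2 := by decide
    rcases hi i with rfl | rfl | rfl
    · exact ⟨.inl (.inl 12, 2), by show (0 * s + 1 : ℤ) + (0 * s + -1) = 0; omega,
        Or.inl (by show (12 * s + -1 : ℤ) = 12 * s + -2 + 1; omega)⟩
    · exact ⟨.inl (.inl 0, 1), by show (6 * s + 5 : ℤ) + (-6 * s + -5) = 0; omega,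
        Or.inl (by show (0 * s + 2 : ℤ) = 0 * s + 1 + 1; omega)⟩
    · exact absurd rfl h1

end

end LadderLog


namespace LadderLog

section

variable {s : ℕ}

/-- The positions are representatives modulo `12s + 6`, so that arcs are at the same place in the log
only if their positions are equal. -/
theorem pos_bounds (hs : 4 ≤ s) (a : EnteringArc s) : 0 ≤ pos a ∧ pos a < 12 * s + 6 := by
  have hfix : ∀ v i, 0 ≤ (fixedPos v i).1 ∧ (fixedPos v i).1 ≤ 12 ∧ -12 ≤ (fixedPos v i).2 ∧
      (fixedPos v i).2 < 6 + 4 * (12 - (fixedPos v i).1) ∧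
      0 ≤ 4 * (fixedPos v i).1 + (fixedPos v i).2 := by decide +kernel
  rcases a with ⟨v | ⟨f, j, hj⟩, i⟩ | i
  · obtain ⟨h1, h2, h3, h4, h5⟩ := hfix v i
    have hs' : (4 : ℤ) ≤ s := by exact_mod_cast hs
    show 0 ≤ (fixedPos v i).1 * (s : ℤ) + (fixedPos v i).2 ∧
      (fixedPos v i).1 * (s : ℤ) + (fixedPos v i).2 < 12 * s + 6
    constructor <;> nlinarith
  · have hlad : ∀ f i, (ladderPos f i) ∈ ([(0, 4, 2), (12, -13, -4), (8, -3, -4), (0, 5, 2),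
        (8, -6, -4), (12, -14, -4), (2, 11, 2), (8, -4, -4), (12, -12, -4), (2, 12, 2),
        (12, -15, -4), (8, -5, -4)] : List (ℤ × ℤ × ℤ)) := by decide +kernel
    show 0 ≤ (ladderPos f i).1 * (s : ℤ) + (ladderPos f i).2.1 + (ladderPos f i).2.2 * (j : ℕ) ∧
      (ladderPos f i).1 * (s : ℤ) + (ladderPos f i).2.1 + (ladderPos f i).2.2 * (j : ℕ) < 12 * s + 6
    have h := hlad f i
    simp only [List.mem_cons, List.not_mem_nil, or_false] at h
    rcases h with h | h | h | h | h | h | h | h | h | h | h | h <;> rw [h] <;> dsimp only <;>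
      omega
  · have hi : ∀ i : Fin 3, i = 0 ∨ i = 1 ∨ i = 2 := by decide
    rcases hi i with rfl | rfl | rfl
    · show 0 ≤ (12 * s + -2 : ℤ) ∧ (12 * s + -2 : ℤ) < 12 * s + 6
      omega
    · show 0 ≤ (0 * s + 1 : ℤ) ∧ (0 * s + 1 : ℤ) < 12 * s + 6
      omega
    · show 0 ≤ (2 * s + 5 : ℤ) ∧ (2 * s + 5 : ℤ) < 12 * s + 6
      omega

theorem name_letterArc (z : Letter) : letterArc s z = name (match z with
    | .a => .inl (.inl 0, 0)
    | .b => .inl (.inl 0, 1)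
    | .c => .inl (.inl 0, 2)
    | .x => .inr 0
    | .y => .inr 1 : EnteringArc s) := by
  cases z
  · show (4 : ZMod (12 * s + 6)) = ((0 * s + 4 : ℤ) : ZMod (12 * s + 6))
    simp
  · show (-(6 * s + 5) : ZMod (12 * s + 6)) = ((-6 * s + -5 : ℤ) : ZMod (12 * s + 6))
    push_cast
    ring
  · show (6 * s - 2 : ZMod (12 * s + 6)) = ((6 * s + -2 : ℤ) : ZMod (12 * s + 6))
    push_cast
    ring
  · show (1 : ZMod (12 * s + 6)) = ((0 * s + 1 : ℤ) : ZMod (12 * s + 6))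
    simp
  · show (6 * s + 5 : ZMod (12 * s + 6)) = ((6 * s + 5 : ℤ) : ZMod (12 * s + 6))
    push_cast
    ring

theorem sum_ladder (s : ℕ) (f : Fin 4) (j : Fin (s - 3)) (i : Fin 3) :
    val (.inl (.inr (f, j), i) : EnteringArc s) + val (.inl (.inr (f, j), i + 1) : EnteringArc s) +
      val (.inl (.inr (f, j), i + 1 + 1) : EnteringArc s) = 0 := by
  have h : ∀ f i, ladderCurr f i + ladderCurr f (i + 1) + ladderCurr f (i + 1 + 1) = 0 := by
    decide +kernel
  have h1 := congrArg Prod.fst (h f i)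
  have h2 := congrArg (fun p => p.2.1) (h f i)
  have h3 := congrArg (fun p => p.2.2) (h f i)
  simp only [Prod.fst_add, Prod.snd_add, Prod.fst_zero, Prod.snd_zero] at h1 h2 h3
  simp only [val]
  linear_combination (s : ℤ) * h1 + h2 + (j : ℕ) * h3

/-- Kirchhoff's current law. -/
theorem sum_arcCurr (hs : 4 ≤ s) (v : CubicVertex s) (hv : v ≠ .inl 0) (i : Fin 3) :
    arcCurr s (name (.inl (v, i))) + arcCurr s (name (.inl (v, i + 1))) +
      arcCurr s (name (.inl (v, i + 1 + 1))) = 0 := by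
  have hn := natCast_card_eq_zero s
  have hc : ∀ a : EnteringArc s, a ≠ fromDeadEnd → arcCurr s (name a) = name a := fun a ha =>
    arcCurr_of_ne (by rw [← name_fromDeadEnd]; exact (name_bijective hs).1.ne ha)
  rcases v with v | ⟨f, j⟩
  · let c : Fin 13 → Fin 3 → ℤ × ℤ := fun v i => if v = 7 ∧ i = 2 then (6, 3) else fixedCurr v i
    have hsum : ∀ v i, v ≠ 0 → c v i + c v (i + 1) + c v (i + 1 + 1) = (0, 0) ∨
        c v i + c v (i + 1) + c v (i + 1 + 1) = (12, 6) ∨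
        c v i + c v (i + 1) + c v (i + 1 + 1) = (-12, -6) := by decide +kernel
    have hcv : ∀ v i, arcCurr s (name (.inl (.inl v, i))) = (c v i).1 * s + (c v i).2 := by
      intro v i
      by_cases h : v = 7 ∧ i = 2
      · obtain ⟨rfl, rfl⟩ := h
        show arcCurr s (name fromDeadEnd) = ((6 : ℤ) : ZMod (12 * s + 6)) * s + (3 : ℤ)
        rw [name_fromDeadEnd, arcCurr_zero, half]
        push_cast
        ring
      · rw [hc _ fun e => h (by
          simp only [fromDeadEnd, Sum.inl.injEq, Prod.mk.injEq] at e
          exact e)]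
        show (((fixedCurr v i).1 * s + (fixedCurr v i).2 : ℤ) : ZMod (12 * s + 6)) = _
        simp only [c, if_neg h]
        push_cast
        ring
    rw [hcv, hcv, hcv]
    have key : ∀ p q r t : ℤ × ℤ, p + q + r = t → (t.1 * s + t.2 : ZMod (12 * s + 6)) = 0 →
        (p.1 * s + p.2 + (q.1 * s + q.2) + (r.1 * s + r.2) : ZMod (12 * s + 6)) = 0 := by
      rintro p q r t rfl h
      rw [← h]
      simp only [Prod.fst_add, Prod.snd_add]
      push_cast
      ring
    rcases hsum v i (fun e => hv (congrArg _ e)) with h | h | h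
    · exact key _ _ _ _ h (by simp)
    · exact key _ _ _ _ h (by push_cast; exact hn)
    · exact key _ _ _ _ h (by push_cast; linear_combination -hn)
  · rw [hc _ (by simp [fromDeadEnd]), hc _ (by simp [fromDeadEnd]), hc _ (by simp [fromDeadEnd])]
    have := sum_ladder s f j i
    rw [name, name, name, ← Int.cast_add, ← Int.cast_add, this, Int.cast_zero]

theorem isLog (hs : 4 ≤ s) : IsLog s (face hs) := by
  have hs2 : 2 ≤ s := by omega
  have hinj := (name_bijective hs).1
  refine ⟨?_, fun z => ?_, fun d hd hl => ?_, ?_, ?_, ?_⟩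
  · rw [← name_deadEnd, face_name]
    show arcRev s (name deadEnd) = 0
    rw [name_deadEnd, arcRev_half]
  · have h : name (next (match z with
        | .a => .inl (.inl 0, 0)
        | .b => .inl (.inl 0, 1)
        | .c => .inl (.inl 0, 2)
        | .x => .inr 0
        | .y => .inr 1 : EnteringArc s)) = letterArc s (letterSucc z) := by
      rw [name_letterArc]
      cases z <;> rfl
    rw [name_letterArc, face_name, h, ← arcRev_letterNext hs2, arcRev_arcRev]
  · obtain ⟨a, rfl⟩ := (name_bijective hs).2 d
    have hlab : ∀ z, name a ≠ letterArc s z := fun z e => by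
      rw [e, (arcLabel_eq_some_iff hs2).2 rfl] at hl
      exact absurd hl (by simp)
    obtain ⟨v, i, hv, rfl⟩ : ∃ v i, v ≠ Sum.inl 0 ∧ a = Sum.inl (v, i) := by
      rcases a with ⟨v, i⟩ | i
      · refine ⟨v, i, ?_, rfl⟩
        rintro rfl
        have hi : ∀ i : Fin 3, i = 0 ∨ i = 1 ∨ i = 2 := by decide
        rcases hi i with rfl | rfl | rfl
        · exact hlab .a (name_letterArc .a).symm
        · exact hlab .b (name_letterArc .b).symm
        · exact hlab .c (name_letterArc .c).symm
      · have hi : ∀ i : Fin 3, i = 0 ∨ i = 1 ∨ i = 2 := by decide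
        rcases hi i with rfl | rfl | rfl
        · exact absurd (name_letterArc .x).symm (hlab .x)
        · exact absurd (name_letterArc .y).symm (hlab .y)
        · exact absurd name_deadEnd hd
    have h1 : face hs (name (.inl (v, i))) = arcRev s (name (.inl (v, i + 1))) := face_name hs _
    have h2 : face hs (name (.inl (v, i + 1))) = arcRev s (name (.inl (v, i + 1 + 1))) :=
      face_name hs _
    have h3 : face hs (name (.inl (v, i + 1 + 1))) = arcRev s (name (.inl (v, i))) := by
      rw [face_name]
      exact congrArg _ (congrArg name (next_next_next (.inl (v, i))))
    refine ⟨?_, ?_, ?_⟩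
    · rw [h1]
      intro e
      have := hinj ((arcRev_arcRev _).symm.trans ((congrArg _ e).trans (arcRev_arcRev _)))
      simp at this
    · rw [h1, arcRev_arcRev, h2, arcRev_arcRev, h3]
    · rw [h1, arcRev_arcRev, h2, arcCurr_arcRev, arcCurr_arcRev]
      linear_combination -(sum_arcCurr hs v hv i)
  · have h1 : (-2 : ZMod (12 * s + 6)) = name (.inl (.inl 1, 0) : EnteringArc s) := by
      show _ = ((0 * s + -2 : ℤ) : ZMod (12 * s + 6))
      simp
    rw [h1, face_name]
    obtain ⟨b, hb, -⟩ := exists_reverse hs (next (.inl (.inl 1, 0))) (by simp [next, deadEnd])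
      (by simp [next, fromDeadEnd])
    rw [arcRev_name hs (by simp [next, deadEnd]) (by simp [next, fromDeadEnd]) hb, name]
    change (-6 * s + 3 : ℤ) + val b = 0 at hb
    rw [show val b = 6 * s - 3 by omega]
    push_cast
    ring
  · have h1 : (2 : ZMod (12 * s + 6)) = name (.inl (.inl 2, 0) : EnteringArc s) := by
      show _ = ((0 * s + 2 : ℤ) : ZMod (12 * s + 6))
      simp
    rw [h1, face_name]
    obtain ⟨b, hb, -⟩ := exists_reverse hs (next (.inl (.inl 2, 0))) (by simp [next, deadEnd])
      (by simp [next, fromDeadEnd])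
    rw [arcRev_name hs (by simp [next, deadEnd]) (by simp [next, fromDeadEnd]) hb, name]
    change (0 * s + 6 : ℤ) + val b = 0 at hb
    rw [show val b = -6 by omega]
    push_cast
    ring
  · have hsymm : ∀ a, (arcEquiv hs).symm (name a) = a := fun a =>
      (arcEquiv hs).symm_apply_apply a
    refine ⟨fun d => (pos ((arcEquiv hs).symm d)).toNat, ?_, fun d => ?_, fun d hd => ?_, ?_⟩
    · have := hsymm (.inl (.inl 0, 0))
      rw [← name_letterArc .a] at this
      show (pos ((arcEquiv hs).symm (letterArc s .a))).toNat = 0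
      rw [this]
      show (0 * s + 0 : ℤ).toNat = 0
      simp
    · have := pos_bounds hs ((arcEquiv hs).symm d)
      show (pos ((arcEquiv hs).symm d)).toNat < _
      omega
    · obtain ⟨a, rfl⟩ := (name_bijective hs).2 d
      show (pos ((arcEquiv hs).symm (face hs (name a)))).toNat =
        (pos ((arcEquiv hs).symm (name a))).toNat + 1
      obtain ⟨b, hb, hp⟩ : ∃ b, arcRev s (name (next a)) = name b ∧
          (pos b = pos a + 1 ∨ b = .inl (.inl 0, 0)) := by
        by_cases h1 : next a = deadEnd
        · refine ⟨fromDeadEnd, by rw [h1, name_deadEnd, name_fromDeadEnd, arcRev_half], Or.inl ?_⟩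
          obtain rfl : a = deadEnd := next.injective (h1.trans rfl)
          show (2 * s + 6 : ℤ) = 2 * s + 5 + 1
          ring
        by_cases h2 : next a = fromDeadEnd
        · refine ⟨deadEnd, by rw [h2, name_deadEnd, name_fromDeadEnd, arcRev_zero], Or.inl ?_⟩
          obtain rfl : a = .inl (.inl 7, 1) := next.injective (h2.trans rfl)
          show (2 * s + 5 : ℤ) = 2 * s + 4 + 1
          ring
        · obtain ⟨b, hb, hp⟩ := exists_reverse hs (next a) h1 h2
          rw [next_next_next] at hp
          exact ⟨b, arcRev_name hs h1 h2 hb, hp⟩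
      rw [face_name, hb] at hd ⊢
      rw [hsymm, hsymm]
      rcases hp with hp | rfl
      · have := pos_bounds hs a
        omega
      · exact absurd (name_letterArc .a).symm hd
    · have h1 := hsymm (.inl (.inl 0, 2))
      have h2 := hsymm (.inr 0)
      rw [← name_letterArc .c] at h1
      rw [← name_letterArc .x] at h2
      show (pos ((arcEquiv hs).symm (letterArc s .c))).toNat <
        (pos ((arcEquiv hs).symm (letterArc s .x))).toNat
      rw [h1, h2]
      show (12 * s + -4 : ℤ).toNat < (12 * s + -2 : ℤ).toNat
      omega

end

end LadderLog


namespace LadderLog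

section

variable {s : ℕ}

/-- The vertices on the upper side of the ladder. -/
def top (k : Fin (2 * s - 6)) : CubicVertex s :=
  .inr (⟨k % 2, by omega⟩, ⟨k / 2, by omega⟩)

/-- The vertices on the lower side of the ladder. -/
def bot (k : Fin (2 * s - 6)) : CubicVertex s :=
  .inr (⟨2 + k % 2, by omega⟩, ⟨k / 2, by omega⟩)

theorem top_even {k : Fin (2 * s - 6)} {j : ℕ} (h : (k : ℕ) = 2 * j) :
    top k = .inr (0, ⟨j, by omega⟩) :=
  congrArg Sum.inr (Prod.ext (Fin.ext (by show (k : ℕ) % 2 = 0; omega))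
    (Fin.ext (by show (k : ℕ) / 2 = j; omega)))

theorem top_odd {k : Fin (2 * s - 6)} {j : ℕ} (h : (k : ℕ) = 2 * j + 1) :
    top k = .inr (1, ⟨j, by omega⟩) :=
  congrArg Sum.inr (Prod.ext (Fin.ext (by show (k : ℕ) % 2 = 1; omega))
    (Fin.ext (by show (k : ℕ) / 2 = j; omega)))

theorem bot_even {k : Fin (2 * s - 6)} {j : ℕ} (h : (k : ℕ) = 2 * j) :
    bot k = .inr (2, ⟨j, by omega⟩) :=
  congrArg Sum.inr (Prod.ext (Fin.ext (by show 2 + (k : ℕ) % 2 = 2; omega))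
    (Fin.ext (by show (k : ℕ) / 2 = j; omega)))

theorem bot_odd {k : Fin (2 * s - 6)} {j : ℕ} (h : (k : ℕ) = 2 * j + 1) :
    bot k = .inr (3, ⟨j, by omega⟩) :=
  congrArg Sum.inr (Prod.ext (Fin.ext (by show 2 + (k : ℕ) % 2 = 3; omega))
    (Fin.ext (by show (k : ℕ) / 2 = j; omega)))

theorem sumElim_top_bot_injective : Function.Injective (Sum.elim (top (s := s)) bot) := by
  rintro (k | k) (l | l) h <;>
    simp only [Sum.elim_inl, Sum.elim_inr, top, bot, Sum.inr.injEq, Prod.mk.injEq,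
      Fin.mk.injEq] at h
  · exact congrArg Sum.inl (Fin.ext (by omega))
  · omega
  · omega
  · exact congrArg Sum.inr (Fin.ext (by omega))

/-- A vertex of the current graph. -/
noncomputable def vertex (hs : 4 ≤ s) (v : CubicVertex s) : LogVertex (face hs) :=
  (logGraph (face hs)).head (name (.inl (v, 0)))

theorem head_name (hs : 4 ≤ s) (v : CubicVertex s) (i : Fin 3) :
    (logGraph (face hs)).head (name (.inl (v, i))) = vertex hs v := by
  have step : ∀ i, (logGraph (face hs)).head (name (.inl (v, i + 1))) =
      (logGraph (face hs)).head (name (.inl (v, i))) := fun i => by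
    rw [logGraph_head, logGraph_head, arcTail_eq_iff, Perm.sameCycle_comm]
    refine ⟨1, ?_⟩
    rw [zpow_one, vertexRot_apply, arcRev_arcRev, face_name]
    rfl
  have hi : ∀ i : Fin 3, i = 0 ∨ i = 0 + 1 ∨ i = 0 + 1 + 1 := by decide
  rcases hi i with rfl | rfl | rfl
  · rfl
  · exact step 0
  · exact (step _).trans (step 0)

theorem vertex_injective (hs : 4 ≤ s) : Function.Injective (vertex hs) := by
  intro v w h
  rw [vertex, vertex, logGraph_head, logGraph_head, arcTail_eq_iff] at h
  let g : ZMod (12 * s + 6) → CubicVertex s ⊕ Fin 3 := fun d =>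
    Sum.map Prod.fst id ((arcEquiv hs).symm (arcRev s d))
  have hg : ∀ a, g (arcRev s (name a)) = Sum.map Prod.fst id a := fun a => by
    show Sum.map Prod.fst id ((arcEquiv hs).symm (arcRev s (arcRev s (arcEquiv hs a)))) = _
    rw [arcRev_arcRev, symm_apply_apply]
  have := h.eq_of_invariant (f := g) fun d => by
    obtain ⟨a, ha⟩ := (name_bijective hs).2 (arcRev s d)
    obtain rfl : d = arcRev s (name a) := by rw [ha, arcRev_arcRev]
    rw [vertexRot_apply, arcRev_arcRev, face_name, hg, hg]
    rcases a with a | a <;> rfl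
  rw [hg, hg] at this
  exact Sum.inl.inj this

/-- An arc of the ladder whose reverse also enters the ladder leaves the vertex that the reverse
enters. -/
theorem tail_name (hs : 4 ≤ s) {f f' : Fin 4} {j j' : Fin (s - 3)} {i i' : Fin 3}
    (h : val (.inl (.inr (f, j), i) : EnteringArc s) + val (.inl (.inr (f', j'), i')) = 0) :
    (logGraph (face hs)).tail (name (.inl (.inr (f, j), i))) = vertex hs (.inr (f', j')) := by
  rw [← head_name hs _ i', CurrentGraph.head]
  show _ = arcTail _ (arcRev s _)
  rw [arcRev_name hs (by simp [deadEnd]) (by simp [fromDeadEnd]) ((add_comm _ _).trans h)]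
  rfl

/-- The arcs that enter the ladder neither belong to the dead end nor precede a letter. -/
theorem ladder_unlabeled (hs : 4 ≤ s) (f : Fin 4) (j : Fin (s - 3)) (i : Fin 3) :
    name (.inl (.inr (f, j), i)) ≠ half s ∧ arcLabel s (name (.inl (.inr (f, j), i))) = none ∧
      arcCurr s (name (.inl (.inr (f, j), i))) = name (.inl (.inr (f, j), i)) := by
  have hne : ∀ a : EnteringArc s, a ≠ .inl (.inr (f, j), i) →
      name (.inl (.inr (f, j), i)) ≠ name a := fun a h => ((name_bijective hs).1.ne h).symm
  refine ⟨?_, ?_, arcCurr_of_ne ?_⟩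
  · rw [← name_deadEnd]
    exact hne _ (by simp [deadEnd])
  · rcases letterArc_cases (d := name (.inl (.inr (f, j), i) : EnteringArc s))
      (by omega : 2 ≤ s) with ⟨z, hz⟩ | h
    · rw [name_letterArc] at hz
      exact absurd hz (hne _ (by cases z <;> simp))
    · exact h
  · rw [← name_fromDeadEnd]
    exact hne _ (by simp [fromDeadEnd])

theorem abs_val_ladder_le (hs : 4 ≤ s) (f : Fin 4) (j : Fin (s - 3)) (i : Fin 3) :
    -(6 * s + 2) ≤ val (.inl (.inr (f, j), i) : EnteringArc s) ∧
      val (.inl (.inr (f, j), i) : EnteringArc s) ≤ 6 * s + 2 := by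
  obtain ⟨j, hj⟩ := j
  have hlad : ∀ f i, ladderCurr f i ∈ ([(0, -7, -3), (6, -5, -3), (-6, 12, 6), (-6, 5, 3),
      (0, 10, 3), (6, -15, -6), (0, 8, 3), (-6, 4, 3), (6, -12, -6), (6, -4, -3), (0, -11, -3),
      (-6, 15, 6)] : List (ℤ × ℤ × ℤ)) := by decide +kernel
  have h := hlad f i
  simp only [List.mem_cons, List.not_mem_nil, or_false] at h
  simp only [val]
  rcases h with h | h | h | h | h | h | h | h | h | h | h | h <;> rw [h] <;> dsimp only <;>
    omega

theorem sum_valMinAbs (hs : 4 ≤ s) (f : Fin 4) (j : Fin (s - 3)) :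
    ∑ d ∈ Finset.univ.filter (fun d => (logGraph (face hs)).head d = vertex hs (.inr (f, j))),
      ((logGraph (face hs)).curr d).valMinAbs = 0 := by
  obtain ⟨h1, h2, h3⟩ := ladder_unlabeled hs f j 0
  have hv : ∀ i, (name (.inl (.inr (f, j), i) : EnteringArc s)).valMinAbs =
      val (.inl (.inr (f, j), i) : EnteringArc s) := fun i => by
    have := abs_val_ladder_le hs f j i
    refine (ZMod.valMinAbs_spec _ _).2 ⟨rfl, ?_⟩
    rw [Set.mem_Ioc]
    push_cast
    omega
  have e1 : face hs (name (.inl (.inr (f, j), 0))) =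
      arcRev s (name (.inl (.inr (f, j), 0 + 1))) := face_name hs _
  have e2 : face hs (name (.inl (.inr (f, j), 0 + 1))) =
      arcRev s (name (.inl (.inr (f, j), 0 + 1 + 1))) := face_name hs _
  rw [vertex, (isLog hs).sum_head_of_unlabeled h1 h2 ZMod.valMinAbs, e1, arcRev_arcRev, e2,
    arcCurr_arcRev, arcCurr_arcRev, neg_neg, neg_neg, h3, (ladder_unlabeled hs f j _).2.2,
    (ladder_unlabeled hs f j _).2.2, hv, hv, hv]
  exact sum_ladder s f j 0

theorem hasLadder (hs : 4 ≤ s) : HasLadder s (logGraph (face hs)) := by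
  have hcurr : ∀ f j i, (logGraph (face hs)).curr (name (.inl (.inr (f, j), i))) =
      name (.inl (.inr (f, j), i)) := fun f j i => (ladder_unlabeled hs f j i).2.2
  have hcomp : Sum.elim (fun k => vertex hs (top k)) (fun k => vertex hs (bot k)) =
      vertex hs ∘ Sum.elim top bot := by
    ext1 k
    rcases k with k | k <;> rfl
  refine ⟨fun k => vertex hs (top k), fun k => vertex hs (bot k), ?_, ?_, fun k => ?_,
    fun k l hkl => ?_⟩
  · rw [hcomp]
    exact (vertex_injective hs).comp sumElim_top_bot_injective
  · rintro _ ⟨k, rfl⟩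
    rw [hcomp]
    obtain ⟨f, j, h⟩ : ∃ f j, Sum.elim top bot k = (.inr (f, j) : CubicVertex s) := by
      rcases k with k | k <;> exact ⟨_, _, rfl⟩
    rw [Function.comp_apply, h]
    obtain ⟨h1, h2, -⟩ := ladder_unlabeled hs f j 0
    exact ⟨(isLog hs).degree_head_of_unlabeled h1 h2,
      (isLog hs).not_isVortex_of_unlabeled (by omega) h2, sum_valMinAbs hs f j⟩
  · obtain ⟨j, hj | hj⟩ := Nat.even_or_odd' (k : ℕ)
    · refine ⟨name (.inl (.inr (2, ⟨j, by omega⟩), 2)), ?_, ?_⟩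
      · rw [hcurr, hj]
        show ((6 * s + -12 + -6 * (j : ℕ) : ℤ) : ZMod (12 * s + 6)) = _
        push_cast
        ring
      · rw [if_pos (by rw [hj]; exact even_two_mul j)]
        exact ⟨(tail_name hs (i' := 2) (by
          show (6 * s + -12 + -6 * (j : ℕ) : ℤ) + (-6 * s + 12 + 6 * (j : ℕ)) = 0
          ring)).trans (congrArg _ (top_even hj).symm),
          (head_name hs _ _).trans (congrArg _ (bot_even hj).symm)⟩
    · refine ⟨name (.inl (.inr (1, ⟨j, by omega⟩), 2)), ?_, ?_⟩
      · rw [hcurr, hj]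
        show ((6 * s + -15 + -6 * (j : ℕ) : ℤ) : ZMod (12 * s + 6)) = _
        push_cast
        ring
      · rw [if_neg (by rw [hj]; simp)]
        exact ⟨(tail_name hs (i' := 2) (by
          show (6 * s + -15 + -6 * (j : ℕ) : ℤ) + (-6 * s + 15 + 6 * (j : ℕ)) = 0
          ring)).trans (congrArg _ (bot_odd hj).symm),
          (head_name hs _ _).trans (congrArg _ (top_odd hj).symm)⟩
  · obtain ⟨j, hj | hj⟩ := Nat.even_or_odd' (k : ℕ)
    · have hl : (l : ℕ) = 2 * j + 1 := by omega
      refine ⟨⟨name (.inl (.inr (1, ⟨j, by omega⟩), 0)), ?_, ?_⟩,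
        ⟨name (.inl (.inr (3, ⟨j, by omega⟩), 0)), ?_, ?_⟩⟩
      · exact (tail_name hs (i' := 1) (by
          show (-6 * s + 5 + 3 * (j : ℕ) : ℤ) + (6 * s + -5 + -3 * (j : ℕ)) = 0
          ring)).trans (congrArg _ (top_even hj).symm)
      · exact (head_name hs _ _).trans (congrArg _ (top_odd hl).symm)
      · exact (tail_name hs (i' := 1) (by
          show (6 * s + -4 + -3 * (j : ℕ) : ℤ) + (-6 * s + 4 + 3 * (j : ℕ)) = 0
          ring)).trans (congrArg _ (bot_even hj).symm)
      · exact (head_name hs _ _).trans (congrArg _ (bot_odd hl).symm)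
    · have hl : (l : ℕ) = 2 * (j + 1) := by omega
      refine ⟨⟨name (.inl (.inr (0, ⟨j + 1, by omega⟩), 0)), ?_, ?_⟩,
        ⟨name (.inl (.inr (2, ⟨j + 1, by omega⟩), 0)), ?_, ?_⟩⟩
      · exact (tail_name hs (i' := 1) (by
          show (0 * s + -7 + -3 * (j + 1 : ℕ) : ℤ) + (0 * s + 10 + 3 * (j : ℕ)) = 0
          push_cast
          ring)).trans (congrArg _ (top_odd hj).symm)
      · exact (head_name hs _ _).trans (congrArg _ (top_even hl).symm)
      · exact (tail_name hs (i' := 1) (by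
          show (0 * s + 8 + 3 * (j + 1 : ℕ) : ℤ) + (0 * s + -11 + -3 * (j : ℕ)) = 0
          push_cast
          ring)).trans (congrArg _ (bot_odd hj).symm)
      · exact (head_name hs _ _).trans (congrArg _ (bot_even hl).symm)

end

end LadderLog


/-! ### The logs for `s = 2` and `s = 3` -/

/-- The element after `d` in the cyclic sequence `l`. -/
def cyclicNext {n : ℕ} (l : List (ZMod n)) (d : ZMod n) : ZMod n :=
  l.getD ((l.idxOf d + 1) % l.length) d

/-- The element before `d` in the cyclic sequence `l`. -/
def cyclicPrev {n : ℕ} (l : List (ZMod n)) (d : ZMod n) : ZMod n :=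
  l.getD ((l.idxOf d + (l.length - 1)) % l.length) d

/-- The log for `s = 2`. -/
def logTwo : List (ZMod (12 * 2 + 6)) :=
  [4, 17, 13, 20, 6, 8, 11, 2, 24, 14, 23, 18, 3, 22, 28, 9, 16, 10, 26, 1, 29, 25, 7, 21, 19, 27,
    15, 0, 12, 5]

/-- The log for `s = 3`. -/
def logThree : List (ZMod (12 * 3 + 6)) :=
  [4, 23, 19, 26, 35, 22, 17, 2, 36, 24, 10, 21, 0, 31, 39, 30, 6, 8, 11, 32, 14, 29, 7, 33, 3, 34,
    40, 15, 28, 18, 12, 9, 16, 38, 1, 41, 37, 20, 13, 27, 25, 5]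

theorem exists_isLog_two : ∃ F : Perm (ZMod (12 * 2 + 6)), IsLog 2 F :=
  ⟨⟨cyclicNext logTwo, cyclicPrev logTwo, by decide +kernel, by decide +kernel⟩,
    by decide +kernel, by decide +kernel, by decide +kernel, by decide +kernel,
    by decide +kernel, fun d => logTwo.idxOf d, by decide +kernel, by decide +kernel,
    by decide +kernel, by decide +kernel⟩

theorem exists_isLog_three : ∃ F : Perm (ZMod (12 * 3 + 6)), IsLog 3 F :=
  ⟨⟨cyclicNext logThree, cyclicPrev logThree, by decide +kernel, by decide +kernel⟩,
    by decide +kernel, by decide +kernel, by decide +kernel, by decide +kernel,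
    by decide +kernel, fun d => logThree.idxOf d, by decide +kernel, by decide +kernel,
    by decide +kernel, by decide +kernel⟩

/-- For `s = 3` the ladder has no rungs, so any log will do. -/
theorem exists_isLog {s : ℕ} (hs : 2 ≤ s) : ∃ F : Perm (ZMod (12 * s + 6)), IsLog s F ∧
    (3 ≤ s → HasLadder s (logGraph F)) := by
  obtain rfl | rfl | h : s = 2 ∨ s = 3 ∨ 4 ≤ s := by omega
  · obtain ⟨F, hF⟩ := exists_isLog_two
    exact ⟨F, hF, fun h => absurd h (by omega)⟩
  · obtain ⟨F, hF⟩ := exists_isLog_three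
    have no : ∀ k : Fin (2 * 3 - 6), False := fun k => k.elim0
    exact ⟨F, hF, fun _ => ⟨fun k => (no k).elim, fun k => (no k).elim,
      fun k => k.elim (fun k => (no k).elim) fun k => (no k).elim,
      fun _ ⟨k, _⟩ => k.elim (fun k => (no k).elim) fun k => (no k).elim,
      fun k => (no k).elim, fun k => (no k).elim⟩⟩
  · exact ⟨LadderLog.face h, LadderLog.isLog h, fun _ => LadderLog.hasLadder h⟩


theorem mainTheorem1 (s : ℕ) (hs : 2 ≤ s) (γ δ ε : ZMod (12 * s + 6))
    (hγ : γ = 6 * s - 2) (hδ : δ = 1) (hε : ε = 6 * s + 5) :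
    ∃ (W D : Type) (_ : Fintype W) (_ : Fintype D) (_ : DecidableEq W)
      (G : CurrentGraph (ZMod (12 * s + 6)) Letter W D),
      G.IsStandard ∧ VortexConstraints G γ δ ε ∧ (3 ≤ s → HasLadder s G) ∧
      ∃ (R₀ R₁ R₂ R₃ R₄ R₅ : RotationSystem (Vert s)) (g : ℕ),
        G.IsDerived R₀ ∧ R₀.graph = completeMinusLetters s ∧ R₀.IsTriangular ∧ R₀.HasGenus g ∧
        IsCompletion γ δ ε R₀ R₁ R₂ R₃ R₄ R₅ ∧
        R₂.HasGenus (g + 2) ∧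
        R₅.graph = ⊤ ∧ R₅.HasGenus (g + 2) ∧
        IsGraphGenus (⊤ : SimpleGraph (Vert s)) (g + 2) ∧
        g + 2 = ⌈((12 * s + 11 - 3) * (12 * s + 11 - 4) : ℚ) / 12⌉₊ := by
  subst hγ hδ hε
  obtain ⟨F, hF, hladder⟩ := exists_isLog hs
  obtain ⟨R₁, R₂, R₃, R₄, R₅, h, h2, htop, h5⟩ := hF.exists_completion hs
  exact ⟨LogVertex F, ZMod (12 * s + 6), inferInstance, inferInstance, inferInstance, logGraph F,
    hF.isStandard hs, hF.vortexConstraints hs, hladder, hF.derived hs, R₁, R₂, R₃, R₄, R₅,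
    12 * s ^ 2 + 15 * s + 3, hF.isDerived hs, rfl, hF.derived_isTriangular hs,
    hF.derived_hasGenus hs, h, h2, htop, h5, ⟨⟨R₅, htop, h5⟩, fun g ⟨_, hR, hg⟩ =>
      genus_complete_ge hR hg⟩, ceil_genus_complete⟩
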